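/- Let $k$ be an algebraically closed field of characteristic $p>2$ and let $\mathfrak g=\mathfrak g_{\bar 0}\oplus\mathfrak g_{\bar 1}$ be a finite-dimensional restricted Lie superalgebra over $k$: $\mathfrak g$ is a Lie superalgebra (with $[x,[x,x]]=0$ for odd $x$ as part of the axioms), $\mathfrak g_{\bar 0}$ is a restricted Lie algebra with $p$-mapping $x\mapsto x^{[p]}$, and $(\operatorname{ad}x^{[p]})|_{\mathfrak g_{\bar 1}}=(\operatorname{ad}x)^p|_{\mathfrak g_{\bar 1}}$ for $x\in\mathfrak g_{\bar 0}$. Let $u(\mathfrak g)$ be its restricted enveloping superalgebra, the quotient of the enveloping superalgebra $U(\mathfrak g)$ by the ideal generated by the $x^p-x^{[p]}$, $x\in\mathfrak g_{\bar 0}$. **Triangular decompositions.** Let $\mathfrak a\subseteq\mathfrak g$ be a restricted ($\mathbb Z/2$-graded) subalgebra, and let $\mathfrak h$ be a maximal torus of $\mathfrak a_{\bar 0}$. A triangular decomposition of $\mathfrak a$ relative to $\mathfrak h$ is a vector space decomposition $$\mathfrak a=\mathfrak a_{\bar 1}^-\oplus\mathfrak n_{\mathfrak a}^-\oplus\mathfrak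 h\oplus\mathfrak n_{\mathfrak a}^+\oplus\mathfrak a_{\bar 1}^+,\qquad \mathfrak a_{\bar 0}=\mathfrak n_{\mathfrak a}^-\oplus\mathfrak h\oplus\mathfrak n_{\mathfrak a}^+,\quad \mathfrak a_{\bar 1}=\mathfrak a_{\bar 1}^-\oplus\mathfrak a_{\bar 1}^+,$$ such that, for each sign, $\mathfrak a_{\bar 1}^\pm\oplus\mathfrak n_{\mathfrak a}^\pm$ is a restricted graded subalgebra, $\mathfrak n_{\mathfrak a}^\pm$ and $\mathfrak a_{\bar 1}^\pm$ are stable under $\operatorname{ad}\mathfrak h$, and $\mathfrak n_{\mathfrak a}^\pm$ is $p$-nilpotent (each element is killed by an iterate of the $p$-mapping). Put $\mathfrak b_{\mathfrak a}^\pm=\mathfrak a_{\bar 1}^\pm\oplus\mathfrak n_{\mathfrak a}^\pm\oplus\mathfrak h$ and $\Lambda=\{\lambda\in\mathfrak h^*:\lambda(x^{[p]})=\lambda(x)^p\ \text{for all } x\in\mathfrak h\}$. For $\lambda\in\Lambda$ let $k_\lambda$ be the one-dimensional $u(\mathfrak b_{\mathfrak a}^\pm)$-module on which $\mathfrak h$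 acts by $\lambda$ and $\mathfrak a_{\bar 1}^\pm\oplus\mathfrak n_{\mathfrak a}^\pm$ acts by zero. We say that a subspace $V$ of $\mathfrak g$ has *enough weights* if it contains $\dim\mathfrak h$ linearly independent weight vectors for $\operatorname{ad}\mathfrak h$ whose weights are linearly independent elements of $\Lambda$. Let $\mathfrak g=\mathfrak g_{\bar 1}^-\oplus\mathfrak n^-\oplus\mathfrak h\oplus\mathfrak n^+\oplus\mathfrak g_{\bar 1}^+$ be a triangular decomposition of $\mathfrak g$ relative to a maximal torus $\mathfrak h$ of $\mathfrak g_{\bar 0}$. Assume that (A) or (B) holds. (A) One has $\dim\mathfrak n^-<\dim\mathfrak n^+$ and $\dim\mathfrak g_{\bar 1}^-<\dim\mathfrak g_{\bar 1}^+$, and $\mathfrak g$ has a restricted subalgebra $\mathfrak l$ with a triangular decomposition relative to the same $\mathfrak h$ such that: 1. $\mathfrak l_{\bar 1}^-\oplus\mathfrak n_{\mathfrak l}^-\oplus\mathfrak n_{\mathfrak l}^+\oplus\mathfrak l_{\bar 1}^+$ is an ideal of $\mathfrak l$ whose even elements are all killed by an iterate of the $p$-mapping, and $\mathfrak n_{\mathfrak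 l}^+$ has enough weights; 2. $\mathfrak b_{\mathfrak l}^-=\mathfrak b_{\mathfrak g}^-$; 3. $\mathfrak n_{\mathfrak l}^-=\mathfrak n^-$ has enough weights. (B) $\mathfrak g$ has a restricted subalgebra $\mathfrak l$ (for example, but not necessarily, a classical Lie superalgebra) with a triangular decomposition relative to the same $\mathfrak h$, with $\mathfrak n_{\mathfrak l}^+\subseteq\mathfrak n^+$ and $\mathfrak l_{\bar 1}^+\subseteq\mathfrak g_{\bar 1}^+$, such that: 1. $\mathfrak b_{\mathfrak l}^-=\mathfrak b_{\mathfrak g}^-$; 2. there is a bijection $\psi:\Lambda\to\Lambda$ such that for every $\lambda\in\Lambda$ the $u(\mathfrak l)$-supermodules $u(\mathfrak l)\otimes_{u(\mathfrak b_{\mathfrak l}^-)}k_\lambda$ and $u(\mathfrak l)\otimes_{u(\mathfrak b_{\mathfrak l}^+)}k_{\psi(\lambda)}$ have the same composition factors with multiplicities, up to parity change of the factors; 3. some vector space complement of $\mathfrak l$ in $\mathfrak g$ has enough weights. Then $u(\mathfrak g)$ is of one block. That is, the simple $u(\mathfrak g)$-supermodules (with $S$ and its parity change identified) form exactly one class for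 the equivalence relation generated by: $S\sim T$ if $S$ and $T$ are, up to parity change, composition factors of a common finite-dimensional indecomposable $u(\mathfrak g)$-supermodule. -/

import Mathlib

universe u v w

/-- The parity sign `(-1)^i`. -/
def paritySign (k : Type u) [Ring k] (i : ZMod 2) : k := if i = 0 then 1 else -1

/-- The Koszul sign `(-1)^(ij)`. -/
def koszulSign (k : Type u) [Ring k] (i j : ZMod 2) : k := if i = 1 ∧ j = 1 then -1 else 1

/-- A Lie superalgebra structure on the `k`-vector space `g = part 0 ⊕ part 1`
(characteristic different from `2`; the last axiom is the usual extra one, which follows from the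
Jacobi identity except in characteristic `3`). -/
structure LieSuperalgebra (k : Type u) (g : Type v) [Field k] [AddCommGroup g] [Module k g] where
  part : ZMod 2 → Submodule k g
  isCompl : IsCompl (part 0) (part 1)
  bracket : g →ₗ[k] g →ₗ[k] g
  bracket_mem : ∀ {i j : ZMod 2} {x y : g}, x ∈ part i → y ∈ part j → bracket x y ∈ part (i + j)
  skew : ∀ {i j : ZMod 2} {x y : g}, x ∈ part i → y ∈ part j →
    bracket x y = -(koszulSign k i j • bracket y x)
  jacobi : ∀ {i j : ZMod 2} {x y : g} (z : g), x ∈ part i → y ∈ part j →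
    bracket x (bracket y z) = bracket (bracket x y) z + koszulSign k i j • bracket y (bracket x z)
  odd_cube : ∀ {x : g}, x ∈ part 1 → bracket x (bracket x x) = 0

/-- `jacobsonCoeff b x y n j` is the coefficient of `t^j` in `(ad (t x + y))^n (x)`, where
`ad z = b z`. -/
def jacobsonCoeff {k : Type u} {g : Type v} [Field k] [AddCommGroup g] [Module k g]
    (b : g →ₗ[k] g →ₗ[k] g) (x y : g) : ℕ → ℕ → g
  | 0, 0 => x
  | 0, _ + 1 => 0
  | n + 1, 0 => b y (jacobsonCoeff b x y n 0)
  | n + 1, j + 1 => b y (jacobsonCoeff b x y n (j + 1)) + b x (jacobsonCoeff b x y n j)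

/-- A restricted Lie superalgebra in characteristic `p`: the even part carries a `p`-mapping
`x ↦ x^[p]`, with `ad (x^[p]) = (ad x)^p` on the even part (restricted Lie algebra) and on the odd
part (restricted module).  In Jacobson's formula for `(x + y)^[p]`, the term `s_i(x, y)` is `1/i`
times the coefficient of `t^(i-1)` in `(ad (t x + y))^(p-1) (x)`, for `1 ≤ i ≤ p - 1`. -/
structure RestrictedLieSuperalgebra (k : Type u) (p : ℕ) (g : Type v)
    [Field k] [AddCommGroup g] [Module k g] extends LieSuperalgebra k g where
  pmap : part 0 → part 0
  pmap_smul : ∀ (c : k) (x : part 0), pmap (c • x) = c ^ p • pmap x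
  ad_pmap : ∀ (x : part 0) (y : g), bracket (pmap x) y = ((bracket x) ^ p : Module.End k g) y
  pmap_add : ∀ x y : part 0, (pmap (x + y) : g) = pmap x + pmap y +
    ∑ i ∈ Finset.Icc 1 (p - 1),
      ((i : k)⁻¹) • jacobsonCoeff bracket (x : g) (y : g) (p - 1) (i - 1)

namespace RestrictedLieSuperalgebra

variable {k : Type u} {p : ℕ} {g : Type v} [Field k] [AddCommGroup g] [Module k g]

section Subobjects

variable (L : RestrictedLieSuperalgebra k p g)

/-- A restricted (`ℤ/2`-graded) subalgebra. -/
structure IsSubalgebra (a : Submodule k g) : Prop where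
  graded : ∀ {x y : g}, x ∈ L.part 0 → y ∈ L.part 1 → x + y ∈ a → x ∈ a ∧ y ∈ a
  bracket_mem : ∀ {x y : g}, x ∈ a → y ∈ a → L.bracket x y ∈ a
  pmap_mem : ∀ x : L.part 0, (x : g) ∈ a → (L.pmap x : g) ∈ a

theorem jacobsonCoeff_map {g' : Type v} [AddCommGroup g'] [Module k g']
    (b : g →ₗ[k] g →ₗ[k] g) (b' : g' →ₗ[k] g' →ₗ[k] g') (f : g' →ₗ[k] g)
    (hf : ∀ x y, f (b' x y) = b (f x) (f y)) (x y : g') (n j : ℕ) :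
    f (jacobsonCoeff b' x y n j) = jacobsonCoeff b (f x) (f y) n j := by
  induction n generalizing j with
  | zero => cases j <;> simp [jacobsonCoeff]
  | succ n ih => cases j <;> simp [jacobsonCoeff, hf, ih]

/-- A restricted subalgebra, as a restricted Lie superalgebra in its own right. -/
def sub (a : Submodule k g) (ha : L.IsSubalgebra a) : RestrictedLieSuperalgebra k p a where
  part i := (L.part i).comap a.subtype
  isCompl := by
    constructor
    · rw [Submodule.disjoint_def]
      intro x h0 h1
      exact Subtype.ext (Submodule.disjoint_def.1 L.isCompl.disjoint (x : g) h0 h1)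
    · rw [codisjoint_iff, eq_top_iff]
      rintro ⟨x, hx⟩ -
      have hx' : x ∈ L.part 0 ⊔ L.part 1 := by
        rw [L.isCompl.sup_eq_top]; trivial
      obtain ⟨y, hy, z, hz, rfl⟩ := Submodule.mem_sup.1 hx'
      obtain ⟨h0, h1⟩ := ha.graded hy hz hx
      exact Submodule.mem_sup.2 ⟨⟨y, h0⟩, hy, ⟨z, h1⟩, hz, rfl⟩
  bracket := LinearMap.mk₂ k (fun x y => ⟨L.bracket x y, ha.bracket_mem x.2 y.2⟩)
    (by intros; ext; simp) (by intros; ext; simp) (by intros; ext; simp) (by intros; ext; simp)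
  bracket_mem hx hy := L.bracket_mem hx hy
  skew hx hy := Subtype.ext (L.skew hx hy)
  jacobi z hx hy := Subtype.ext (L.jacobi (z : g) hx hy)
  odd_cube hx := Subtype.ext (L.odd_cube hx)
  pmap x := ⟨⟨L.pmap ⟨x.1.1, x.2⟩, ha.pmap_mem ⟨x.1.1, x.2⟩ x.1.2⟩, (L.pmap ⟨x.1.1, x.2⟩).2⟩
  pmap_smul c x := by
    apply Subtype.ext; apply Subtype.ext
    exact congrArg (fun z : L.part 0 => (z : g)) (L.pmap_smul c ⟨x.1.1, x.2⟩)
  ad_pmap x y := by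
    apply Subtype.ext
    refine (L.ad_pmap ⟨x.1.1, x.2⟩ (y : g)).trans ?_
    have h : ∀ (f : Module.End k a) (F : Module.End k g), (∀ z : a, F z = f z) →
        ∀ (m : ℕ) (z : a), (F ^ m) z = ((f ^ m) z : a) := by
      intro f F hF m
      induction m with
      | zero => simp
      | succ m ih =>
        intro z
        rw [pow_succ, pow_succ, Module.End.mul_apply, Module.End.mul_apply, hF, ih]
    exact h _ _ (fun _ => rfl) p y
  pmap_add x y := by
    apply Subtype.ext
    refine (L.pmap_add ⟨x.1.1, x.2⟩ ⟨y.1.1, y.2⟩).trans ?_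
    have h : ∀ n j, ((jacobsonCoeff (LinearMap.mk₂ k
        (fun x y : a => (⟨L.bracket x y, ha.bracket_mem x.2 y.2⟩ : a))
        (by intros; ext; simp) (by intros; ext; simp) (by intros; ext; simp)
        (by intros; ext; simp)) (x : a) (y : a) n j : a) : g) =
        jacobsonCoeff L.bracket (x.1.1 : g) (y.1.1 : g) n j := fun n j =>
      jacobsonCoeff_map L.bracket _ a.subtype (fun _ _ => rfl) _ _ n j
    simp [h]

end Subobjects

section Enveloping

variable (L : RestrictedLieSuperalgebra k p g)

/-- The defining relations of the restricted enveloping superalgebra: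
`xy - (-1)^(ij) yx = [x, y]` for `x`, `y` homogeneous of parity `i`, `j`, and `x^p = x^[p]` for `x`
even. -/
inductive EnvRel : TensorAlgebra k g → TensorAlgebra k g → Prop
  | bracket {i j : ZMod 2} {x y : g} (hx : x ∈ L.part i) (hy : y ∈ L.part j) :
      EnvRel (TensorAlgebra.ι k x * TensorAlgebra.ι k y -
        koszulSign k i j • (TensorAlgebra.ι k y * TensorAlgebra.ι k x))
        (TensorAlgebra.ι k (L.bracket x y))
  | pmap (x : L.part 0) :
      EnvRel (TensorAlgebra.ι k (x : g) ^ p) (TensorAlgebra.ι k (L.pmap x : g))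

/-- The restricted enveloping superalgebra `u(g)`. -/
def Env : Type (max u v) := RingQuot L.EnvRel

noncomputable instance : Ring L.Env := inferInstanceAs (Ring (RingQuot L.EnvRel))

noncomputable instance : Algebra k L.Env := inferInstanceAs (Algebra k (RingQuot L.EnvRel))

/-- The quotient map from the tensor algebra to `u(g)`. -/
noncomputable def mkEnv : TensorAlgebra k g →ₐ[k] L.Env := RingQuot.mkAlgHom k L.EnvRel

/-- The canonical map `g → u(g)`. -/
noncomputable def ι : g →ₗ[k] L.Env := L.mkEnv.toLinearMap ∘ₗ TensorAlgebra.ι k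

theorem ι_bracket {i j : ZMod 2} {x y : g} (hx : x ∈ L.part i) (hy : y ∈ L.part j) :
    L.ι x * L.ι y - koszulSign k i j • (L.ι y * L.ι x) = L.ι (L.bracket x y) := by
  have h : L.mkEnv _ = L.mkEnv _ := RingQuot.mkAlgHom_rel k (EnvRel.bracket (L := L) hx hy)
  rw [map_sub, map_smul, map_mul, map_mul] at h
  exact h

theorem ι_pmap (x : L.part 0) : L.ι (x : g) ^ p = L.ι (L.pmap x : g) := by
  have h : L.mkEnv _ = L.mkEnv _ := RingQuot.mkAlgHom_rel k (EnvRel.pmap (L := L) x)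
  rw [map_pow] at h
  exact h

/-- The parity involution of `g`, acting on `part i` by `(-1)^i`. -/
noncomputable def parity : g →ₗ[k] g :=
  (L.part 0).projection (L.part 1) L.isCompl - (L.part 1).projection (L.part 0) L.isCompl.symm

theorem eq_zero_or_one (i : ZMod 2) : i = 0 ∨ i = 1 := by
  revert i; decide

theorem parity_apply {i : ZMod 2} {x : g} (hx : x ∈ L.part i) :
    L.parity x = paritySign k i • x := by
  rcases eq_zero_or_one i with rfl | rfl
  · have h0 := Submodule.projection_apply_of_mem_left L.isCompl hx
    have h1 : (L.part 1).projection (L.part 0) L.isCompl.symm x = 0 := by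
      simpa using hx
    simp [parity, h0, h1, paritySign]
  · have h0 := Submodule.projection_apply_of_mem_left L.isCompl.symm hx
    have h1 : (L.part 0).projection (L.part 1) L.isCompl x = 0 := by
      simpa using hx
    simp [parity, h0, h1, paritySign]

theorem paritySign_add (i j : ZMod 2) :
    paritySign k (i + j) = paritySign k i * paritySign k j := by
  have h11 : (1 + 1 : ZMod 2) = 0 := by decide
  rcases eq_zero_or_one i with rfl | rfl <;> rcases eq_zero_or_one j with rfl | rfl <;>
    simp [paritySign, h11]

theorem paritySign_mul_self (i : ZMod 2) : paritySign k i * paritySign k i = 1 := by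
  rcases eq_zero_or_one i with rfl | rfl <;> simp [paritySign]

theorem lift_parity_rel ⦃a b : TensorAlgebra k g⦄ (h : L.EnvRel a b) :
    TensorAlgebra.lift k (L.ι ∘ₗ L.parity) a = TensorAlgebra.lift k (L.ι ∘ₗ L.parity) b := by
  rcases h with ⟨hx, hy⟩ | ⟨x⟩
  · rename_i i j x y
    simp only [map_sub, map_mul, map_smul, TensorAlgebra.lift_ι_apply, LinearMap.comp_apply]
    rw [L.parity_apply hx, L.parity_apply hy, L.parity_apply (L.bracket_mem hx hy),
      paritySign_add]
    simp only [map_smul, ← L.ι_bracket hx hy, smul_mul_smul_comm, smul_sub]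
    rw [smul_comm (koszulSign k i j), mul_comm (paritySign k j)]
  · simp only [map_pow, TensorAlgebra.lift_ι_apply, LinearMap.comp_apply]
    rw [L.parity_apply x.2, L.parity_apply (L.pmap x).2]
    simpa [paritySign] using L.ι_pmap x

/-- The parity automorphism of `u(g)`, which extends the parity involution of `g`. -/
noncomputable def envParity : L.Env →ₐ[k] L.Env :=
  RingQuot.liftAlgHom k ⟨TensorAlgebra.lift k (L.ι ∘ₗ L.parity), L.lift_parity_rel⟩

theorem envParity_ι (x : g) : L.envParity (L.ι x) = L.ι (L.parity x) :=
  (RingQuot.liftAlgHom_mkAlgHom_apply k (TensorAlgebra.lift k (L.ι ∘ₗ L.parity))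
    L.lift_parity_rel (TensorAlgebra.ι k x)).trans (TensorAlgebra.lift_ι_apply _ _)

theorem parity_parity (x : g) : L.parity (L.parity x) = x := by
  have hx : x ∈ L.part 0 ⊔ L.part 1 := by
    rw [L.isCompl.sup_eq_top]; trivial
  obtain ⟨y, hy, z, hz, rfl⟩ := Submodule.mem_sup.1 hx
  simp [L.parity_apply hy, L.parity_apply hz, paritySign]

theorem env_hom_ext {f f' : L.Env →ₐ[k] L.Env} (h : ∀ x, f (L.ι x) = f' (L.ι x)) : f = f' := by
  refine RingQuot.ringQuot_ext' _ f f' ?_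
  refine TensorAlgebra.hom_ext ?_
  ext x
  exact h x

theorem envParity_envParity (a : L.Env) : L.envParity (L.envParity a) = a := by
  have h : L.envParity.comp L.envParity = AlgHom.id k L.Env :=
    L.env_hom_ext fun x => by simp [envParity_ι, parity_parity]
  exact DFunLike.congr_fun h a

/-- The `ℤ/2`-grading of `u(g)` (characteristic different from `2`): the parity automorphism acts
on the component of parity `i` by `(-1)^i`.  As `u(g)` is spanned by products of homogeneous
elements of `g`, this is the grading induced by that of `g`. -/
def envPart (i : ZMod 2) : Submodule k L.Env where
  carrier := {a | L.envParity a = paritySign k i • a}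
  add_mem' ha hb := by
    simp only [Set.mem_ofPred_eq] at *
    rw [map_add, ha, hb, smul_add]
  zero_mem' := by simp
  smul_mem' c a ha := by
    simp only [Set.mem_ofPred_eq] at *
    rw [map_smul, ha, smul_comm]

end Enveloping

section Modules

variable (L : RestrictedLieSuperalgebra k p g)

/-- A supermodule over `u(g)` (equivalently, a restricted `g`-supermodule).  Since `u(g)` is
generated by `g`, it is enough to ask that `g` respects parities. -/
structure Supermodule where
  carrier : Type w
  [addCommGroup : AddCommGroup carrier]
  [moduleField : Module k carrier]
  [moduleEnv : Module L.Env carrier]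
  [isScalarTower : IsScalarTower k L.Env carrier]
  part : ZMod 2 → Submodule k carrier
  isCompl : IsCompl (part 0) (part 1)
  smul_mem : ∀ {i j : ZMod 2} {x : g} {m : carrier}, x ∈ L.part i → m ∈ part j →
    L.ι x • m ∈ part (i + j)

namespace Supermodule

attribute [instance] addCommGroup moduleField moduleEnv isScalarTower

variable {L}

/-- Graded submodules. -/
def IsGraded (M : L.Supermodule) (N : Submodule L.Env M.carrier) : Prop :=
  ∀ ⦃x y⦄, x ∈ M.part 0 → y ∈ M.part 1 → x + y ∈ N → x ∈ N ∧ y ∈ N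

/-- Simple supermodules. -/
def IsSimple (M : L.Supermodule) : Prop :=
  Nontrivial M.carrier ∧
    ∀ N : Submodule L.Env M.carrier, M.IsGraded N → N = ⊥ ∨ N = ⊤

/-- Indecomposable supermodules. -/
def IsIndecomposable (M : L.Supermodule) : Prop :=
  Nontrivial M.carrier ∧
    ∀ N N' : Submodule L.Env M.carrier, M.IsGraded N → M.IsGraded N' → IsCompl N N' →
      N = ⊥ ∨ N' = ⊥

/-- `f` is homogeneous of some degree `ε`: it preserves or reverses the parity. -/
def IsHomogeneousMap {M S : L.Supermodule} {B : Submodule L.Env M.carrier}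
    (f : B →ₗ[L.Env] S.carrier) : Prop :=
  ∃ ε : ZMod 2, ∀ (i : ZMod 2) (b : B), (b : M.carrier) ∈ M.part i → f b ∈ S.part (i + ε)

/-- `S` is, up to parity change, a composition factor of `M`: it is simple and isomorphic to
`B / A` for graded submodules `A ≤ B` of `M` (here `A` is the kernel of `f`). -/
def IsCompositionFactor (S M : L.Supermodule) : Prop :=
  S.IsSimple ∧ ∃ B : Submodule L.Env M.carrier, M.IsGraded B ∧
    ∃ f : B →ₗ[L.Env] S.carrier, IsHomogeneousMap f ∧ Function.Surjective f

/-- `M` has a composition series `⊥ = c 0 ≤ c 1 ≤ ⋯ ≤ c n = ⊤` of graded submodules, with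
`c (i + 1) / c i` isomorphic, up to parity change, to the simple supermodule `S i`. -/
def HasCompositionFactors (M : L.Supermodule) {n : ℕ} (S : Fin n → L.Supermodule) : Prop :=
  ∃ c : Fin (n + 1) → Submodule L.Env M.carrier,
    c 0 = ⊥ ∧ c (Fin.last n) = ⊤ ∧ (∀ i, M.IsGraded (c i)) ∧
    ∀ i : Fin n, c i.castSucc ≤ c i.succ ∧ (S i).IsSimple ∧
      ∃ f : c i.succ →ₗ[L.Env] (S i).carrier, IsHomogeneousMap f ∧ Function.Surjective f ∧
        ∀ b : c i.succ, f b = 0 ↔ (b : M.carrier) ∈ c i.castSucc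

/-- `[M] = [N]`: the formal sums of composition factors of `M` and `N` agree (up to parity
change of the factors). -/
def SameClass (M N : Supermodule.{u, v, w} L) : Prop :=
  ∃ (n : ℕ) (S : Fin n → Supermodule.{u, v, w} L) (σ : Equiv.Perm (Fin n)),
    M.HasCompositionFactors S ∧ N.HasCompositionFactors (S ∘ σ)

/-- `S` and `T` are composition factors, up to parity change, of a common finite-dimensional
indecomposable supermodule. -/
def Linked (S T : Supermodule.{u, v, w} L) : Prop :=
  ∃ M : Supermodule.{u, v, w} L, Module.Finite k M.carrier ∧ M.IsIndecomposable ∧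
    S.IsCompositionFactor M ∧ T.IsCompositionFactor M

end Supermodule

/-- `u(g)` is of one block: the simple `u(g)`-supermodules form exactly one class for the
equivalence relation generated by being composition factors (up to parity change) of a common
indecomposable supermodule. -/
def OneBlock : Prop :=
  (∃ S : Supermodule.{u, v, max u v} L, S.IsSimple) ∧
    ∀ S T : Supermodule.{u, v, max u v} L, S.IsSimple → T.IsSimple →
      Relation.EqvGen Supermodule.Linked S T

end Modules

section Triangular

variable (L : RestrictedLieSuperalgebra k p g)

/-- A torus of the even part: an abelian restricted subalgebra consisting of semisimple elements,
where `x` is semisimple if it lies in the span of `x^[p], x^[p]^2, …`. -/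
structure IsTorus (h : Submodule k g) : Prop where
  le_even : h ≤ L.part 0
  abelian : ∀ {x y : g}, x ∈ h → y ∈ h → L.bracket x y = 0
  pmap_mem : ∀ x : L.part 0, (x : g) ∈ h → (L.pmap x : g) ∈ h
  semisimple : ∀ x : L.part 0, (x : g) ∈ h →
    x ∈ Submodule.span k (Set.range fun n : ℕ => L.pmap^[n + 1] x)

/-- A maximal torus of the even part of the restricted subalgebra `a`. -/
def IsMaximalTorus (a h : Submodule k g) : Prop :=
  Maximal (fun t => L.IsTorus t ∧ t ≤ a) h

/-- Every element of the (even) subspace `n` is killed by some iterate of the `p`-mapping. -/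
def IsPNilpotent (n : Submodule k g) : Prop :=
  ∀ x : L.part 0, (x : g) ∈ n → ∃ m : ℕ, L.pmap^[m] x = 0

/-- One half `o ⊕ n` (odd and even part) of a triangular decomposition: `o ⊕ n` is a restricted
graded subalgebra with `n` `p`-nilpotent, and it is normalised by `h`.  Thus `o ⊕ n ⊕ h` is a
restricted subalgebra on which every restricted weight of `h`, extended by zero, defines a
one-dimensional restricted module. -/
structure IsNilpotentHalf (h n o : Submodule k g) : Prop where
  even : n ≤ L.part 0
  odd : o ≤ L.part 1
  torus_even : ∀ {x y : g}, x ∈ h → y ∈ n → L.bracket x y ∈ n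
  torus_odd : ∀ {x y : g}, x ∈ h → y ∈ o → L.bracket x y ∈ o
  even_even : ∀ {x y : g}, x ∈ n → y ∈ n → L.bracket x y ∈ n
  even_odd : ∀ {x y : g}, x ∈ n → y ∈ o → L.bracket x y ∈ o
  odd_odd : ∀ {x y : g}, x ∈ o → y ∈ o → L.bracket x y ∈ n
  pmap_mem : ∀ x : L.part 0, (x : g) ∈ n → (L.pmap x : g) ∈ n
  pNilpotent : L.IsPNilpotent n

/-- A triangular decomposition `a = o⁻ ⊕ n⁻ ⊕ h ⊕ n⁺ ⊕ o⁺` of a restricted subalgebra `a`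
(`a = ⊤` for the whole superalgebra) relative to a maximal torus `h` of its even part, where
`n⁻ ⊕ h ⊕ n⁺` is the even part of `a` and `o⁻ ⊕ o⁺` is the odd part. -/
structure TriangularDecomposition (a h : Submodule k g) where
  nMinus : Submodule k g
  nPlus : Submodule k g
  oMinus : Submodule k g
  oPlus : Submodule k g
  maximalTorus : L.IsMaximalTorus a h
  minus : L.IsNilpotentHalf h nMinus oMinus
  plus : L.IsNilpotentHalf h nPlus oPlus
  even_sup : nMinus ⊔ h ⊔ nPlus = a ⊓ L.part 0
  disjoint_minus : Disjoint nMinus h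
  disjoint_plus : Disjoint (nMinus ⊔ h) nPlus
  odd_sup : oMinus ⊔ oPlus = a ⊓ L.part 1
  disjoint_odd : Disjoint oMinus oPlus

/-- The set `Λ` of restricted weights: `λ (x^[p]) = λ (x)^p` for `x ∈ h`. -/
def restrictedWeights (h : Submodule k g) : Set (Module.Dual k h) :=
  {lam | ∀ (x : L.part 0) (hx : (x : g) ∈ h) (hx' : (L.pmap x : g) ∈ h),
    lam ⟨L.pmap x, hx'⟩ = lam ⟨x, hx⟩ ^ p}

/-- The subspace `V` contains `dim h` linearly independent weight vectors with linearly
independent weights in `Λ`. -/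
def HasIndependentWeights (h V : Submodule k g) : Prop :=
  ∃ (x : Fin (Module.finrank k h) → g)
    (α : Fin (Module.finrank k h) → L.restrictedWeights h),
    (∀ i, x i ∈ V) ∧ (∀ i (z : h), L.bracket (z : g) (x i) = (α i : Module.Dual k h) z • x i) ∧
    LinearIndependent k x ∧ LinearIndependent k (fun i => (α i : Module.Dual k h))

section BabyVerma

variable {L} {a h : Submodule k g} (ha : L.IsSubalgebra a)

/-- Generators of the left ideal of `u(a)` defining a baby Verma module: the elements of `n` and
`o`, and `x - λ(x)` for `x ∈ h`. -/
def babyVermaGenerators (n o : Submodule k g) (lam : Module.Dual k h) :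
    Set (L.sub a ha).Env :=
  {b | (∃ y : a, ((y : g) ∈ n ∨ (y : g) ∈ o) ∧ b = (L.sub a ha).ι y) ∨
    ∃ (y : a) (hy : (y : g) ∈ h),
      b = (L.sub a ha).ι y - algebraMap k (L.sub a ha).Env (lam ⟨y, hy⟩)}

/-- The left ideal `u(a) · ker (u(o ⊕ n ⊕ h) → k)` of `u(a)`, for the character of
`u(o ⊕ n ⊕ h)` given by `λ` on `h` and zero on `o ⊕ n`. -/
noncomputable def babyVermaIdeal (n o : Submodule k g) (lam : Module.Dual k h) :
    Submodule (L.sub a ha).Env (L.sub a ha).Env :=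
  Submodule.span (L.sub a ha).Env (babyVermaGenerators ha n o lam)

theorem envParity_mem_babyVermaIdeal {n o : Submodule k g} (hh : h ≤ L.part 0)
    (hn : n ≤ L.part 0) (ho : o ≤ L.part 1) (lam : Module.Dual k h) {b : (L.sub a ha).Env}
    (hb : b ∈ babyVermaIdeal ha n o lam) :
    (L.sub a ha).envParity b ∈ babyVermaIdeal ha n o lam := by
  have key : ∀ {i : ZMod 2} {y : a}, (y : g) ∈ L.part i →
      (L.sub a ha).envParity ((L.sub a ha).ι y) = paritySign k i • (L.sub a ha).ι y := by
    intro i y hy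
    have hy' : y ∈ (L.sub a ha).part i := hy
    rw [envParity_ι, parity_apply _ hy', map_smul]
  refine Submodule.span_induction (p := fun b _ =>
    (L.sub a ha).envParity b ∈ babyVermaIdeal ha n o lam) ?_ ?_ ?_ ?_ hb
  · rintro b (⟨y, hy, rfl⟩ | ⟨y, hy, rfl⟩)
    · have hmem : (L.sub a ha).ι y ∈ babyVermaIdeal ha n o lam :=
        Submodule.subset_span (Or.inl ⟨y, hy, rfl⟩)
      rcases hy with hy | hy
      · rw [key (hn hy)]; exact Submodule.smul_of_tower_mem _ _ hmem
      · rw [key (ho hy)]; exact Submodule.smul_of_tower_mem _ _ hmem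
    · rw [map_sub, key (hh hy), AlgHom.commutes]
      simp only [paritySign, if_true, one_smul]
      exact Submodule.subset_span (Or.inr ⟨y, hy, rfl⟩)
  · simp
  · intro x y _ _ hx hy
    rw [map_add]; exact Submodule.add_mem _ hx hy
  · intro c x _ hx
    rw [smul_eq_mul, map_mul]; exact Submodule.smul_mem _ _ hx

variable [NeZero (2 : k)]

/-- The module `u(a) ⊗ k_λ` induced from the one-dimensional module `k_λ` over `u(o ⊕ n ⊕ h)`, as
the quotient of `u(a)` by the left ideal `babyVermaIdeal`, with the grading induced from `u(a)`
(so that the canonical generator is even). -/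
noncomputable def babyVerma {n o : Submodule k g} (hh : h ≤ L.part 0)
    (hn : n ≤ L.part 0) (ho : o ≤ L.part 1) (lam : Module.Dual k h) :
    Supermodule.{u, v, max u v} (L.sub a ha) where
  carrier := (L.sub a ha).Env ⧸ babyVermaIdeal ha n o lam
  part i := ((L.sub a ha).envPart i).map
    ((babyVermaIdeal ha n o lam).mkQ.restrictScalars k)
  isCompl := by
    have h2 : (2 : k) ≠ 0 := NeZero.ne 2
    constructor
    · rw [Submodule.disjoint_def]
      rintro _ ⟨b, hb, rfl⟩ ⟨c, hc, hbc⟩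
      have hb' : (L.sub a ha).envParity b = b := by
        have : (L.sub a ha).envParity b = _ := hb
        simpa [paritySign] using this
      have hc' : (L.sub a ha).envParity c = -c := by
        have : (L.sub a ha).envParity c = _ := hc
        simpa [paritySign] using this
      have h1 : c - b ∈ babyVermaIdeal ha n o lam :=
        (Submodule.Quotient.eq _).1 hbc
      have h3 := envParity_mem_babyVermaIdeal ha hh hn ho lam h1
      rw [map_sub, hb', hc'] at h3
      have h4 : (2 : k) • b ∈ babyVermaIdeal ha n o lam := by
        have := Submodule.neg_mem _ (Submodule.add_mem _ h1 h3)
        convert this using 1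
        rw [two_smul]; abel
      have h5 := Submodule.smul_of_tower_mem _ ((2 : k)⁻¹) h4
      rw [smul_smul, inv_mul_cancel₀ h2, one_smul] at h5
      exact (Submodule.Quotient.mk_eq_zero _).2 h5
    · rw [codisjoint_iff, eq_top_iff]
      intro x _
      obtain ⟨b, rfl⟩ := Submodule.Quotient.mk_surjective _ x
      have hb := (L.sub a ha).envParity_envParity b
      refine Submodule.mem_sup.2 ⟨_, ⟨(2 : k)⁻¹ • (b + (L.sub a ha).envParity b), ?_, rfl⟩,
        _, ⟨(2 : k)⁻¹ • (b - (L.sub a ha).envParity b), ?_, rfl⟩, ?_⟩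
      · change (L.sub a ha).envParity _ = _
        rw [map_smul, map_add, hb]
        simp [paritySign, add_comm]
      · change (L.sub a ha).envParity _ = _
        rw [map_smul, map_sub, hb]
        simp only [paritySign, one_ne_zero, if_false, neg_smul, one_smul, ← smul_neg, neg_sub]
      · rw [← map_add, ← smul_add]
        have : b + (L.sub a ha).envParity b + (b - (L.sub a ha).envParity b) = (2 : k) • b := by
          rw [two_smul]; abel
        rw [this, smul_smul, inv_mul_cancel₀ h2, one_smul]
        rfl
  smul_mem := by
    rintro i j x _ hx ⟨b, hb, rfl⟩
    refine ⟨(L.sub a ha).ι x * b, ?_, rfl⟩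
    have hb' : (L.sub a ha).envParity b = _ := hb
    change (L.sub a ha).envParity _ = _
    rw [map_mul, envParity_ι, parity_apply _ hx, hb', map_smul, smul_mul_smul_comm,
      paritySign_add]

/-- `u(a) ⊗_{u(b⁻)} k_λ`, where `b⁻ = o⁻ ⊕ n⁻ ⊕ h`. -/
noncomputable def TriangularDecomposition.babyVermaMinus (T : L.TriangularDecomposition a h)
    (lam : L.restrictedWeights h) : Supermodule.{u, v, max u v} (L.sub a ha) :=
  babyVerma ha T.maximalTorus.prop.1.le_even T.minus.even T.minus.odd (lam : Module.Dual k h)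

/-- `u(a) ⊗_{u(b⁺)} k_λ`, where `b⁺ = o⁺ ⊕ n⁺ ⊕ h`. -/
noncomputable def TriangularDecomposition.babyVermaPlus (T : L.TriangularDecomposition a h)
    (lam : L.restrictedWeights h) : Supermodule.{u, v, max u v} (L.sub a ha) :=
  babyVerma ha T.maximalTorus.prop.1.le_even T.plus.even T.plus.odd (lam : Module.Dual k h)

end BabyVerma

namespace TriangularDecomposition

variable {L} {a h : Submodule k g}

/-- The subalgebra `b⁻ = o⁻ ⊕ n⁻ ⊕ h`. -/
def borelMinus (T : L.TriangularDecomposition a h) : Submodule k g := T.oMinus ⊔ T.nMinus ⊔ h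

/-- The subspace `o⁻ ⊕ n⁻ ⊕ n⁺ ⊕ o⁺`. -/
def offTorus (T : L.TriangularDecomposition a h) : Submodule k g :=
  T.oMinus ⊔ T.nMinus ⊔ T.nPlus ⊔ T.oPlus

/-- The decomposition is long: `dim n⁻ < dim n⁺` and `dim o⁻ < dim o⁺`. -/
def IsLong (T : L.TriangularDecomposition a h) : Prop :=
  Module.finrank k T.nMinus < Module.finrank k T.nPlus ∧
    Module.finrank k T.oMinus < Module.finrank k T.oPlus

/-- `o⁻ ⊕ n⁻ ⊕ n⁺ ⊕ o⁺` is a `p`-nilpotent (graded) ideal of `a`. -/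
def OffTorusIsPNilpotentIdeal (T : L.TriangularDecomposition a h) : Prop :=
  (∀ {x y : g}, x ∈ a → y ∈ T.offTorus → L.bracket x y ∈ T.offTorus) ∧
    L.IsPNilpotent T.offTorus

/-- First set of hypotheses on a triangular decomposition of `g`: it is long, and there is a
restricted subalgebra `l` with a triangular decomposition relative to the same torus, such that
the part of `l` off the torus is a `p`-nilpotent ideal of `l`, `n_l⁺` contains `dim h` linearly
independent weight vectors with linearly independent weights, `b_l⁻ = b⁻`, and `n_l⁻ = n⁻`
contains `dim h` such vectors. -/
def LongHypotheses (T : L.TriangularDecomposition ⊤ h) : Prop :=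
  T.IsLong ∧
  ∃ (l : Submodule k g) (_ : L.IsSubalgebra l) (Tl : L.TriangularDecomposition l h),
    Tl.OffTorusIsPNilpotentIdeal ∧
    L.HasIndependentWeights h Tl.nPlus ∧
    Tl.borelMinus = T.borelMinus ∧
    Tl.nMinus = T.nMinus ∧
    L.HasIndependentWeights h T.nMinus

/-- Second set of hypotheses on a triangular decomposition of `g`: there is a restricted
subalgebra `l` with a triangular decomposition relative to the same torus and compatible with that
of `g`, such that `b_l⁻ = b⁻`, the classes of the two families of baby Verma modules of `l` agree
up to a bijection `ψ` of the restricted weights, and some complement of `l` in `g` contains `dim h`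
linearly independent weight vectors with linearly independent weights. -/
def BabyVermaHypotheses [NeZero (2 : k)] (T : L.TriangularDecomposition ⊤ h) : Prop :=
  ∃ (l : Submodule k g) (hl : L.IsSubalgebra l) (Tl : L.TriangularDecomposition l h),
    Tl.nPlus ≤ T.nPlus ∧ Tl.oPlus ≤ T.oPlus ∧
    Tl.borelMinus = T.borelMinus ∧
    (∃ ψ : Equiv.Perm (L.restrictedWeights h), ∀ lam : L.restrictedWeights h,
      (Tl.babyVermaMinus hl lam).SameClass (Tl.babyVermaPlus hl (ψ lam))) ∧
    ∃ C : Submodule k g, IsCompl l C ∧ L.HasIndependentWeights h C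

end TriangularDecomposition

end Triangular

end RestrictedLieSuperalgebra

/-!
Write `b⁻ = o⁻ + n⁻ + h` for the negative Borel subalgebra of `g`. Every simple supermodule has a
homogeneous vector of some weight `λ ∈ Λ` killed by `o⁻ + n⁻` (Engel's theorem for nil subalgebras
of Lie superalgebras, `Supermodule.hasInvariants`), and dually for the positive half. Since `Λ` is
generated as a monoid by any `dim h` linearly independent weights `α i`
(`mem_closure_of_linearIndependent`), it is enough to find for every `λ` an indecomposable module
whose composition factors include all simple modules with a singular vector of weight `λ` and at
least one with a singular vector of weight `λ + α i`, for each `i`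
(`oneBlock_of_forall_exists_isIndecomposable`).

The indecomposable modules are `M = u(g) ⊗_{u(l)} Z`, where `Z` is the module that `l` induces
from a one-dimensional module of `b_l⁻ = b⁻`. The generator of `M` is an eigenvector of `b⁻`, and
a complement `o⁺ + n⁺` of `b⁻` acts nilpotently, so Engel's theorem gives `M` a unique maximal
`(o⁺ + n⁺)`-stable subspace, and `M` is indecomposable
(`Supermodule.isIndecomposable_of_span_eq_top`).

The composition factors come from one observation (`FreeExtension.isSubquotient_ind_of_weight`).
Let `b = I + h` with `I` a nil ideal, and let `w` be a nonzero weight vector of weight `μ` in a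
`b`-module `Q`. Modulo a maximal graded submodule `A` not containing `w`, the ideal `I` kills `w`,
so `(A + k w) / A` is the one-dimensional module of weight `μ`, and `u(g) ⊗_{u(b)} Q` has as
composition factors all simple modules with a singular vector of weight `μ` for `I`, of which
there is at least one. When `Q` is a baby Verma module with generator `v` of weight `λ` and `y`
has weight `α`, the vector `w = y v` has weight `λ + α`, and it is nonzero when `y` lies outside
the subalgebra from which `Q` is induced (`ι_smul_babyVermaGen_ne_zero`).

* In the first case take `b = l` and `Q = Z`, with `y` one of the weight vectors of `n_l⁺`.
* In the second case take `b = b⁺` and `Q` the module that `b⁺` induces from a weight of `b_l⁺`,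
  with `y` the component in `n⁺` or `o⁺` of one of the weight vectors of the complement of `l`.
  Then `u(g) ⊗_{u(b⁺)} Q` is a quotient of the module induced from `u(l) ⊗_{u(b_l⁺)} k_μ`, whose
  composition factors agree with those of the indecomposable module `M` for `λ = ψ⁻¹ μ`, because
  induction is exact (`Supermodule.SameClass.isSubquotient_ind`).

Exactness of induction and `y v ≠ 0` rest on the Poincaré–Birkhoff–Witt theorem for `u(g)`
(`HomBasis.pbwBasis`) and the resulting freeness of `u(g)` over `u(a)`, encoded as
`FreeExtension`. The theorem is proved by Bergman's diamond lemma: the words in an ordered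
homogeneous basis of `g` in which no rewriting rule applies form a basis, since overlapping rules
give the same result modulo lower relations (`HomBasis.IsRel.sub_mem_below`). Jacobson's formula
for `(x + y)^p` reduces the relation `x^p = x^[p]` to basis elements (`map_pmap_of_span`).
-/

open Module

/-! ### Jacobson's formula -/

/-- The commutator of an associative algebra, as a bilinear map. -/
noncomputable def commutatorBilin (k : Type u) (A : Type v) [Field k] [Ring A] [Algebra k A] :
    A →ₗ[k] A →ₗ[k] A :=
  LinearMap.mul k A - (LinearMap.mul k A).flip

theorem commutatorBilin_apply {k : Type u} {A : Type v} [Field k] [Ring A] [Algebra k A]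
    (a b : A) : commutatorBilin k A a b = a * b - b * a := by
  simp [commutatorBilin]

theorem choose_pred_mul_neg_one_pow {R : Type*} [Ring R] (p : ℕ) [hp : Fact p.Prime] [CharP R p]
    {j : ℕ} (hj : j < p) : ((p - 1).choose j : R) * (-1) ^ j = 1 := by
  induction j with
  | zero => simp
  | succ j ih =>
    have h1 := ih (by omega)
    have h2 : ((p.choose (j + 1) : ℕ) : R) = 0 :=
      (CharP.cast_eq_zero_iff R p _).2 (hp.out.dvd_choose_self (by omega) hj)
    have h3 : p.choose (j + 1) = (p - 1).choose j + (p - 1).choose (j + 1) := by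
      conv_lhs => rw [show p = (p - 1) + 1 by omega]
      exact Nat.choose_succ_succ _ _
    rw [h3, Nat.cast_add] at h2
    rw [pow_succ, mul_neg_one, mul_neg, ← neg_mul, eq_neg_of_add_eq_zero_right h2, neg_neg, h1]

/-- In characteristic `p`, `∑ y^a z y^b` over `a + b = p - 1` is `(ad y)^(p-1) z`. -/
theorem ad_iterate_pred_char {R : Type*} [Ring R] (p : ℕ) [hp : Fact p.Prime] [CharP R p]
    (y z : R) :
    (fun a => y * a - a * y)^[p - 1] z =
      ∑ m ∈ Finset.range p, y ^ m * z * y ^ (p - 1 - m) := by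
  have hc : Commute (LinearMap.mulLeft ℤ y) (-LinearMap.mulRight ℤ y) :=
    Commute.neg_right (LinearMap.commute_mulLeft_right y y)
  have hp1 : p - 1 + 1 = p := Nat.succ_pred_prime hp.out
  have h0 : (fun a => y * a - a * y) = ⇑(LinearMap.mulLeft ℤ y + -LinearMap.mulRight ℤ y) := by
    ext a; simp [sub_eq_add_neg]
  rw [h0, ← Module.End.pow_apply, hc.add_pow, hp1, LinearMap.sum_apply]
  refine Finset.sum_congr rfl fun m hm => ?_
  have hm := Finset.mem_range.1 hm
  rw [neg_pow, LinearMap.pow_mulLeft, LinearMap.pow_mulRight]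
  have h1 := choose_pred_mul_neg_one_pow (R := R) p (j := p - 1 - m) (by omega)
  rw [Nat.choose_symm (by omega)] at h1
  have h2 : ∀ (n : ℕ) (a : R), ((-1 : Module.End ℤ R) ^ n) a = (-1) ^ n * a := by
    intro n a
    rcases Nat.even_or_odd n with h | h <;> simp [h.neg_one_pow]
  have h3 : ∀ (n : ℕ) (a : R), ((n : Module.End ℤ R)) a = (n : R) * a := by
    intro n a
    simp
  simp only [Module.End.mul_apply, h2, h3, LinearMap.mulLeft_apply, LinearMap.mulRight_apply]
  have h4 : ((-1 : R) ^ (p - 1 - m)) * (((p - 1).choose m : R)) = 1 := by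
    rw [← (Nat.cast_commute ((p - 1).choose m) ((-1 : R) ^ (p - 1 - m))).eq, h1]
  have h5 : ∀ a : R, ((-1 : R) ^ (p - 1 - m)) * ((((p - 1).choose m : R)) * a) = a := by
    intro a; rw [← mul_assoc, h4, one_mul]
  rw [mul_assoc _ z, h5, ← mul_assoc]

open Polynomial in
/-- Jacobson's formula for `(x + y)^p` in an associative algebra of characteristic `p`. -/
theorem add_pow_char_eq_add_jacobsonCoeff {k : Type u} {A : Type v} [Field k] [Ring A] [Algebra k A]
    (p : ℕ) [hp : Fact p.Prime] [CharP k p] (x y : A) :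
    (x + y) ^ p = x ^ p + y ^ p + ∑ i ∈ Finset.Icc 1 (p - 1),
      ((i : k)⁻¹) • jacobsonCoeff (commutatorBilin k A) x y (p - 1) (i - 1) := by
  rcases subsingleton_or_nontrivial A with hA | hA
  · exact Subsingleton.elim _ _
  have : CharP A p := charP_of_injective_algebraMap (algebraMap k A).injective p
  set F : A[X] := C x * X + C y with hF
  have hcoeff : ∀ n j, ((fun G => F * G - G * F)^[n] (C x)).coeff j =
      jacobsonCoeff (commutatorBilin k A) x y n j := by
    intro n
    induction n with
    | zero => intro j; cases j <;> simp [jacobsonCoeff, coeff_C]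
    | succ n ih =>
      intro j
      rw [Function.iterate_succ_apply']
      set G := (fun G => F * G - G * F)^[n] (C x)
      have : F * G - G * F = C x * G * X + C y * G - (G * C x * X + G * C y) := by
        simp only [hF, add_mul, mul_add, mul_assoc, X_mul]
      rw [this]
      cases j with
      | zero => simp [jacobsonCoeff, commutatorBilin_apply, ← ih, mul_coeff_zero]
      | succ j =>
        simp only [jacobsonCoeff, commutatorBilin_apply, ← ih, coeff_sub, coeff_add, coeff_mul_X,
          coeff_C_mul, coeff_mul_C]
        abel
  have hder : ∀ n, derivative (F ^ n) =
      ∑ m ∈ Finset.range n, F ^ m * C x * F ^ (n - 1 - m) := by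
    have h1 : derivative F = C x := by simp [hF]
    intro n
    induction n with
    | zero => simp
    | succ n ih =>
      rw [pow_succ, derivative_mul, ih, h1, Finset.sum_range_succ, Finset.sum_mul]
      congr 1
      · refine Finset.sum_congr rfl fun m hm => ?_
        have hm := Finset.mem_range.1 hm
        rw [mul_assoc, ← pow_succ]
        congr 2
        omega
      · simp
  have hs : ∀ i ∈ Finset.Icc 1 (p - 1), (F ^ p).coeff i =
      ((i : k)⁻¹) • jacobsonCoeff (commutatorBilin k A) x y (p - 1) (i - 1) := by
    intro i hi
    obtain ⟨hi1, hi2⟩ := Finset.mem_Icc.1 hi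
    have h1 := congrArg (fun G => coeff G (i - 1)) (hder p)
    simp only [← ad_iterate_pred_char, hcoeff, coeff_derivative] at h1
    have h2 : ((i - 1 : ℕ) : A) + 1 = algebraMap k A (i : k) := by
      rw [map_natCast]; exact_mod_cast congrArg (Nat.cast (R := A)) (by omega : i - 1 + 1 = i)
    have h3 : (i : k) ≠ 0 := by
      rw [Ne, CharP.cast_eq_zero_iff k p]
      exact fun h => by have := Nat.le_of_dvd (by omega) h; omega
    rw [← h1, Nat.sub_add_cancel hi1, h2, ← Algebra.commutes, ← Algebra.smul_def, smul_smul,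
      inv_mul_cancel₀ h3, one_smul]
  have hdeg : F.natDegree ≤ 1 := by
    rw [hF]; compute_degree
  have hdegp : (F ^ p).natDegree ≤ p := by
    simpa using natDegree_pow_le_of_le p hdeg
  let e : A[X] →+* A := eval₂RingHom' (RingHom.id A) 1 (fun a => by simp)
  have he : e F = x + y := by
    change eval₂ (RingHom.id A) 1 F = _
    rw [hF, eval₂_add, eval₂_mul_X]
    simp
  have h0 : (F ^ p).coeff 0 = y ^ p := by
    rw [← constantCoeff_apply, map_pow]; simp [hF]
  have hpp : (F ^ p).coeff p = x ^ p := by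
    have := coeff_pow_of_natDegree_le hdeg (m := p)
    rw [mul_one] at this
    rw [this]; simp [hF, coeff_C]
  have hp1 : p - 1 + 1 = p := Nat.succ_pred_prime hp.out
  rw [← he, ← map_pow]
  change eval₂ (RingHom.id A) 1 (F ^ p) = _
  rw [eval₂_eq_sum_range' _ (Nat.lt_succ_of_le hdegp)]
  simp only [RingHom.id_apply, one_pow, mul_one]
  rw [Finset.sum_range_succ, hpp]
  have h1 : ∑ i ∈ Finset.range p, (F ^ p).coeff i =
      ∑ i ∈ Finset.range (p - 1), (F ^ p).coeff (i + 1) + y ^ p := by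
    rw [← h0, ← Finset.sum_range_succ', hp1]
  have h2 : ∑ i ∈ Finset.range (p - 1), (F ^ p).coeff (i + 1) =
      ∑ i ∈ Finset.Icc 1 (p - 1), (F ^ p).coeff i := by
    rw [← Finset.sum_image (f := fun i => (F ^ p).coeff i) (g := fun i => i + 1) (by simp)]
    congr 1
    ext i
    simp only [Finset.mem_image, Finset.mem_range, Finset.mem_Icc]
    exact ⟨by rintro ⟨a, h, rfl⟩; omega, fun h => ⟨i - 1, by omega⟩⟩
  rw [h1, h2, Finset.sum_congr rfl hs]
  abel

/-! ### Triangular families and the order on words -/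

section Triangular

variable {k T ι α : Type*} [Field k] [AddCommGroup T] [Module k T] [LinearOrder α]

/-- A family differing from a basis by lower terms, with respect to a rank function `μ`, is
linearly independent. -/
theorem linearIndependent_of_triangular (b : Basis ι k T) (μ : ι → α) (v : ι → T)
    (hv : ∀ i, v i - b i ∈ Submodule.span k (b '' {j | μ j < μ i})) : LinearIndependent k v := by
  classical
  rw [linearIndependent_iff']
  intro s c hs
  by_contra! hne
  obtain ⟨i₀, hi₀, hc₀⟩ := hne
  obtain ⟨i, hi, hmax⟩ := (s.filter fun i => c i ≠ 0).exists_max_image μ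
    ⟨i₀, Finset.mem_filter.2 ⟨hi₀, hc₀⟩⟩
  obtain ⟨his, hci⟩ := Finset.mem_filter.1 hi
  have hrepr : ∀ j, c j ≠ 0 → j ∈ s → b.repr (v j) i = b.repr (b j) i := by
    intro j hj hjs
    have h1 : ¬ μ i < μ j := not_lt.2 (hmax j (Finset.mem_filter.2 ⟨hjs, hj⟩))
    have h2 := (b.mem_span_image).1 (hv j)
    have h3 : b.repr (v j - b j) i = 0 := by
      by_contra h
      exact h1 (h2 (Finsupp.mem_support_iff.2 h))
    rw [map_sub, Finsupp.sub_apply] at h3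
    exact sub_eq_zero.1 h3
  have h := congrArg (fun x => b.repr x i) hs
  simp only [map_sum, map_smul, Finsupp.finsetSum_apply, Finsupp.smul_apply, smul_eq_mul,
    map_zero, Finsupp.zero_apply] at h
  rw [Finset.sum_eq_single i] at h
  · rw [hrepr i hci his] at h
    simp at h
    exact hci h
  · intro j hj hji
    by_cases hcj : c j = 0
    · simp [hcj]
    · rw [hrepr j hcj hj]; simp [hji]
  · exact fun h => absurd his h

theorem span_range_eq_top_of_triangular [WellFoundedLT α] (b : Basis ι k T) (μ : ι → α) (v : ι → T)
    (hv : ∀ i, v i - b i ∈ Submodule.span k (b '' {j | μ j < μ i})) :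
    Submodule.span k (Set.range v) = ⊤ := by
  have key : ∀ (a : α) (i : ι), μ i = a → b i ∈ Submodule.span k (Set.range v) := by
    intro a
    induction a using WellFoundedLT.induction with
    | ind a ih =>
      rintro i rfl
      have h1 : Submodule.span k (b '' {j | μ j < μ i}) ≤ Submodule.span k (Set.range v) := by
        rw [Submodule.span_le]
        rintro _ ⟨j, hj, rfl⟩
        exact ih _ hj j rfl
      have h2 := Submodule.sub_mem _ (Submodule.subset_span (Set.mem_range_self i)) (h1 (hv i))
      simpa using h2
  rw [eq_top_iff, ← b.span_eq, Submodule.span_le]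
  rintro _ ⟨i, rfl⟩
  exact key _ i rfl

/-- The linear-algebra core of the diamond lemma.  `S i x` says that `x` is a relation with leading
term `b i`.  If any two relations with the same leading term differ by relations with smaller
leading terms, then the span of the relations is complementary to the span of the `b i` that are
not leading terms. -/
theorem isCompl_span_of_confluent [WellFoundedLT α] (b : Basis ι k T) (μ : ι → α)
    (S : ι → T → Prop)
    (hlead : ∀ i x, S i x → x - b i ∈ Submodule.span k (b '' {j | μ j < μ i}))
    (hconf : ∀ i x y, S i x → S i y →
      x - y ∈ Submodule.span k {z | ∃ j, μ j < μ i ∧ S j z}) :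
    IsCompl (Submodule.span k {z | ∃ i, S i z}) (Submodule.span k (b '' {i | ∀ x, ¬ S i x})) := by
  classical
  let v : ι → T := fun i => if h : ∃ x, S i x then h.choose else b i
  have hvS : ∀ i, (∃ x, S i x) → S i (v i) := by
    intro i h
    simp only [v, dif_pos h]
    exact h.choose_spec
  have hvb : ∀ i, (∀ x, ¬ S i x) → v i = b i := by
    intro i h
    simp only [v]
    rw [dif_neg (by simpa using h)]
  have hv : ∀ i, v i - b i ∈ Submodule.span k (b '' {j | μ j < μ i}) := by
    intro i
    by_cases h : ∃ x, S i x
    · exact hlead i _ (hvS i h)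
    · rw [hvb i (by simpa using h), sub_self]; exact Submodule.zero_mem _
  have himg : v '' {i | ∀ x, ¬ S i x} = b '' {i | ∀ x, ¬ S i x} :=
    Set.image_congr fun i hi => hvb i hi
  have hrel : Submodule.span k {z | ∃ i, S i z} = Submodule.span k (v '' {i | ∃ x, S i x}) := by
    apply le_antisymm
    · rw [Submodule.span_le]
      have key : ∀ (a : α) (i : ι) (x : T), μ i = a → S i x →
          x ∈ Submodule.span k (v '' {i | ∃ x, S i x}) := by
        intro a
        induction a using WellFoundedLT.induction with
        | ind a ih =>
          rintro i x rfl hx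
          have h1 := hconf i x (v i) hx (hvS i ⟨x, hx⟩)
          have h2 : Submodule.span k {z | ∃ j, μ j < μ i ∧ S j z} ≤
              Submodule.span k (v '' {i | ∃ x, S i x}) := by
            rw [Submodule.span_le]
            rintro z ⟨j, hj, hz⟩
            exact ih _ hj j z rfl hz
          have h3 : v i ∈ Submodule.span k (v '' {i | ∃ x, S i x}) :=
            Submodule.subset_span ⟨i, ⟨x, hx⟩, rfl⟩
          simpa using Submodule.add_mem _ (h2 h1) h3
      rintro z ⟨i, hz⟩
      exact key _ i z rfl hz
    · rw [Submodule.span_le]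
      rintro _ ⟨i, hi, rfl⟩
      exact Submodule.subset_span ⟨i, hvS i hi⟩
  rw [hrel, ← himg]
  constructor
  · refine (linearIndependent_of_triangular b μ v hv).disjoint_span_image ?_
    rw [Set.disjoint_left]
    rintro i ⟨x, hx⟩ h
    exact h x hx
  · rw [codisjoint_iff, ← Submodule.span_union, ← Set.image_union]
    rw [← span_range_eq_top_of_triangular b μ v hv, ← Set.image_univ]
    congr 2
    ext i
    by_cases h : ∃ x, S i x <;> simp_all

end Triangular

namespace List

variable {κ : Type*} [LinearOrder κ]

/-- The number of inversions of a word. -/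
def inversions : List κ → ℕ
  | [] => 0
  | a :: l => l.countP (· < a) + inversions l

/-- `w.IsLower w'`: the word `w` is shorter than `w'`, or it is a rearrangement of `w'` with fewer
inversions. -/
def IsLower (w w' : List κ) : Prop :=
  w.length < w'.length ∨ (w.Perm w' ∧ w.inversions < w'.inversions)

theorem inversions_append_lt_left (u : List κ) {w w' : List κ} (hp : w.Perm w')
    (h : w.inversions < w'.inversions) : (u ++ w).inversions < (u ++ w').inversions := by
  induction u with
  | nil => exact h
  | cons a u ih =>
    simp only [cons_append, inversions]
    have : (u ++ w).countP (· < a) = (u ++ w').countP (· < a) :=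
      (hp.append_left u).countP_eq _
    omega

theorem inversions_append (w v : List κ) :
    (w ++ v).inversions = w.inversions + (w.map fun a => v.countP (· < a)).sum + v.inversions := by
  induction w with
  | nil => simp [inversions]
  | cons a w ih => simp [inversions, ih, countP_append]; omega

theorem inversions_append_lt_right (v : List κ) {w w' : List κ} (hp : w.Perm w')
    (h : w.inversions < w'.inversions) : (w ++ v).inversions < (w' ++ v).inversions := by
  have : (w.map fun a => v.countP (· < a)).sum = (w'.map fun a => v.countP (· < a)).sum :=
    (hp.map _).sum_eq
  rw [inversions_append, inversions_append]
  omega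

theorem IsLower.append {w w' : List κ} (h : w.IsLower w') (u v : List κ) :
    (u ++ w ++ v).IsLower (u ++ w' ++ v) := by
  rcases h with h | ⟨hp, h⟩
  · left; simp; omega
  · exact Or.inr ⟨(hp.append_left u).append_right v,
      inversions_append_lt_right v (hp.append_left u) (inversions_append_lt_left u hp h)⟩

theorem inversions_replicate (n : ℕ) (a : κ) : (replicate n a).inversions = 0 := by
  induction n with
  | zero => rfl
  | succ n ih => simp [replicate_succ, inversions, ih, countP_replicate]

/-- The order on words by length and number of inversions. -/
def wordRank (w : List κ) : ℕ ×ₗ ℕ := toLex (w.length, w.inversions)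

theorem IsLower.wordRank_lt {w w' : List κ} (h : w.IsLower w') : w.wordRank < w'.wordRank := by
  rw [wordRank, wordRank, Prod.Lex.toLex_lt_toLex]
  rcases h with h | ⟨hp, h⟩
  · exact Or.inl h
  · exact Or.inr ⟨hp.length_eq, h⟩

end List

/-! ### Rewriting rules for the restricted enveloping superalgebra -/

namespace RestrictedLieSuperalgebra

variable {k : Type u} {p : ℕ} {g : Type v} [Field k] [AddCommGroup g] [Module k g]

theorem koszulSign_comm (i j : ZMod 2) : koszulSign k i j = koszulSign k j i := by
  simp only [koszulSign, and_comm]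

theorem koszulSign_mul_self (i j : ZMod 2) : koszulSign k i j * koszulSign k i j = 1 := by
  unfold koszulSign; split_ifs <;> simp

theorem koszulSign_zero_left (j : ZMod 2) : koszulSign k 0 j = 1 := by
  simp [koszulSign]

theorem koszulSign_zero_right (j : ZMod 2) : koszulSign k j 0 = 1 := by
  simp [koszulSign]

theorem koszulSign_add_right (i j l : ZMod 2) :
    koszulSign k i (j + l) = koszulSign k i j * koszulSign k i l := by
  have h11 : (1 + 1 : ZMod 2) = 0 := by decide
  rcases eq_zero_or_one i with rfl | rfl <;> rcases eq_zero_or_one j with rfl | rfl <;>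
    rcases eq_zero_or_one l with rfl | rfl <;> simp [koszulSign, h11]

/-- A basis of `g` consisting of homogeneous elements. -/
structure HomBasis (L : RestrictedLieSuperalgebra k p g) (κ : Type w) where
  basis : Basis κ k g
  parity : κ → ZMod 2
  mem : ∀ i, basis i ∈ L.part (parity i)

section TensorRel

variable (L : RestrictedLieSuperalgebra k p g)

local notation "τ" => TensorAlgebra.ι k (M := g)

/-- The defining relation `xy - (-1)^(ab) yx - [x, y]` of the enveloping superalgebra, in the
tensor algebra, for `x`, `y` of parity `a`, `b`. -/
noncomputable def commRel (a b : ZMod 2) (x y : g) : TensorAlgebra k g :=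
  τ x * τ y - koszulSign k a b • (τ y * τ x) - τ (L.bracket x y)

theorem commRel_swap {a b : ZMod 2} {x y : g} (hx : x ∈ L.part a) (hy : y ∈ L.part b) :
    L.commRel a b x y = -(koszulSign k a b • L.commRel b a y x) := by
  unfold commRel
  rw [L.skew hx hy, koszulSign_comm b a, map_neg, map_smul]
  have h := koszulSign_mul_self (k := k) a b
  simp only [smul_sub, smul_smul, h]
  module

/-- The consequence of the Jacobi identity that resolves the overlaps `xyz`. -/
theorem commRel_jacobi {a b c : ZMod 2} {x y z : g} (hx : x ∈ L.part a) (hy : y ∈ L.part b) :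
    L.commRel a b x y * τ z - τ x * L.commRel b c y z =
      -(koszulSign k a b • (τ y * L.commRel a c x z)) +
      koszulSign k b c • (L.commRel a c x z * τ y) -
      (koszulSign k a b * koszulSign k a c) • (L.commRel b c y z * τ x) +
      (koszulSign k b c * koszulSign k a c) • (τ z * L.commRel a b x y) +
      L.commRel a (b + c) x (L.bracket y z) - L.commRel (a + b) c (L.bracket x y) z -
      koszulSign k a b • L.commRel b (a + c) y (L.bracket x z) := by
  have hj := congrArg τ (L.jacobi z hx hy)
  rw [map_add, map_smul] at hj
  unfold commRel
  rw [koszulSign_add_right, koszulSign_comm (a + b), koszulSign_add_right, koszulSign_add_right,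
    koszulSign_comm b a, koszulSign_comm c a, koszulSign_comm c b]
  have h1 := koszulSign_mul_self (k := k) a b
  have h2 := koszulSign_mul_self (k := k) a c
  have h3 := koszulSign_mul_self (k := k) b c
  generalize koszulSign k a b = s at *
  generalize koszulSign k a c = t at *
  generalize koszulSign k b c = r at *
  simp only [mul_sub, sub_mul, smul_mul_assoc, mul_smul_comm, smul_sub, smul_smul, mul_assoc]
  linear_combination (norm := skip) hj - h1 • (r • (τ (L.bracket x z) * τ y))
  match_scalars <;> ring

end TensorRel

namespace HomBasis

variable {L : RestrictedLieSuperalgebra k p g} {κ : Type w} (E : L.HomBasis κ)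

local notation "τ" => TensorAlgebra.ι k (M := g)

/-- The element of the tensor algebra given by a word in the basis. -/
noncomputable def word (w : List κ) : TensorAlgebra k g := (w.map fun i => τ (E.basis i)).prod

@[simp] theorem word_nil : E.word [] = 1 := rfl

@[simp] theorem word_cons (i : κ) (w : List κ) : E.word (i :: w) = τ (E.basis i) * E.word w := by
  simp [word]

@[simp] theorem word_append (w w' : List κ) : E.word (w ++ w') = E.word w * E.word w' := by
  simp [word]

theorem word_singleton (i : κ) : E.word [i] = τ (E.basis i) := by simp

@[simp] theorem word_replicate (n : ℕ) (i : κ) :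
    E.word (List.replicate n i) = τ (E.basis i) ^ n := by
  simp [word]

/-- The words in a basis of `g` form a basis of the tensor algebra. -/
noncomputable def wordBasis : Basis (List κ) k (TensorAlgebra k g) :=
  E.basis.tensorAlgebra.reindex FreeMonoid.toList

theorem wordBasis_apply (w : List κ) : E.wordBasis w = E.word w := by
  have h : ∀ w : List κ, FreeAlgebra.equivMonoidAlgebraFreeMonoid.symm
      (MonoidAlgebra.of k _ (FreeMonoid.ofList w)) = (w.map (FreeAlgebra.ι k)).prod := by
    intro w
    simp [FreeAlgebra.equivMonoidAlgebraFreeMonoid, FreeMonoid.lift_apply]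
  rw [wordBasis, Basis.reindex_apply, Basis.tensorAlgebra, Basis.map_apply]
  refine (congrArg (TensorAlgebra.equivFreeAlgebra E.basis).symm (h w)).trans ?_
  rw [map_list_prod, List.map_map, word]
  congr 2
  ext i
  simp

theorem mem_span_of_mem_part {a : ZMod 2} {x : g} (hx : x ∈ L.part a) :
    x ∈ Submodule.span k {y | ∃ i, E.parity i = a ∧ E.basis i = y} := by
  set S : ZMod 2 → Submodule k g := fun a =>
    Submodule.span k {y | ∃ i, E.parity i = a ∧ E.basis i = y}
  have hle : ∀ a, S a ≤ L.part a := by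
    intro a
    rw [Submodule.span_le]
    rintro _ ⟨i, rfl, rfl⟩
    exact E.mem i
  have htop : S 0 ⊔ S 1 = ⊤ := by
    rw [eq_top_iff, ← E.basis.span_eq, Submodule.span_le]
    rintro _ ⟨i, rfl⟩
    rcases eq_zero_or_one (E.parity i) with h | h
    · exact Submodule.mem_sup_left (Submodule.subset_span ⟨i, h, rfl⟩)
    · exact Submodule.mem_sup_right (Submodule.subset_span ⟨i, h, rfl⟩)
  obtain ⟨y, hy, z, hz, rfl⟩ := Submodule.mem_sup.1 (htop ▸ Submodule.mem_top : x ∈ S 0 ⊔ S 1)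
  rcases eq_zero_or_one a with rfl | rfl
  · have : z = 0 := Submodule.disjoint_def.1 L.isCompl.disjoint z
      (by simpa using Submodule.sub_mem _ hx (hle 0 hy)) (hle 1 hz)
    rw [this, add_zero]; exact hy
  · have : y = 0 := Submodule.disjoint_def.1 L.isCompl.disjoint y (hle 0 hy)
      (by simpa using Submodule.sub_mem _ hx (hle 1 hz))
    rw [this, zero_add]; exact hz

variable [LinearOrder κ]

/-- The rewriting rules: `E.IsRule r t` says that `t` is a relation of `u(g)` with leading
word `r`. -/
inductive IsRule : List κ → TensorAlgebra k g → Prop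
  | swap {i j : κ} (h : j < i) :
      IsRule [i, j] (L.commRel (E.parity i) (E.parity j) (E.basis i) (E.basis j))
  | square {i : κ} (h : E.parity i = 1) :
      IsRule [i, i] ((2 : k)⁻¹ • L.commRel 1 1 (E.basis i) (E.basis i))
  | power {i : κ} (h : E.parity i = 0) :
      IsRule (List.replicate p i)
        (τ (E.basis i) ^ p - τ (L.pmap ⟨E.basis i, h ▸ E.mem i⟩ : g))

/-- `E.IsRel w x`: `x` is obtained from a rewriting rule by multiplying with words on both sides,
and `w` is the leading word of `x`. -/
def IsRel (w : List κ) (x : TensorAlgebra k g) : Prop :=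
  ∃ u r t v, E.IsRule r t ∧ w = u ++ r ++ v ∧ x = E.word u * t * E.word v

/-- The span of the relations with leading word lower than `w`. -/
def below (w : List κ) : Submodule k (TensorAlgebra k g) :=
  Submodule.span k {x | ∃ w', w'.IsLower w ∧ E.IsRel w' x}

/-- The span of the relations whose leading word has length at most `d`. -/
def relLE (d : ℕ) : Submodule k (TensorAlgebra k g) :=
  Submodule.span k {x | ∃ w', w'.length ≤ d ∧ E.IsRel w' x}

variable {E}

theorem IsRule.isRel {r : List κ} {t : TensorAlgebra k g} (h : E.IsRule r t) : E.IsRel r t :=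
  ⟨[], r, t, [], h, by simp, by simp⟩

theorem IsRel.mul {w : List κ} {x : TensorAlgebra k g} (h : E.IsRel w x) (u v : List κ) :
    E.IsRel (u ++ w ++ v) (E.word u * x * E.word v) := by
  obtain ⟨u', r, t, v', hr, rfl, rfl⟩ := h
  exact ⟨u ++ u', r, t, v' ++ v, hr, by simp, by simp [mul_assoc]⟩

theorem relLE_mono {d d' : ℕ} (h : d ≤ d') : E.relLE d ≤ E.relLE d' :=
  Submodule.span_mono fun _ ⟨w', hw, hx⟩ => ⟨w', hw.trans h, hx⟩

theorem relLE_le_below {d : ℕ} {w : List κ} (h : d < w.length) : E.relLE d ≤ E.below w :=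
  Submodule.span_mono fun _ ⟨w', hw, hx⟩ => ⟨w', Or.inl (by omega), hx⟩

theorem IsRel.mem_below {w w' : List κ} {x : TensorAlgebra k g} (h : E.IsRel w' x)
    (hw : w'.IsLower w) : x ∈ E.below w := Submodule.subset_span ⟨w', hw, h⟩

theorem IsRule.mul_mem {r : List κ} {t : TensorAlgebra k g} (h : E.IsRule r t)
    (u v : List κ) {w : List κ} (hw : (u ++ r ++ v).IsLower w) :
    E.word u * t * E.word v ∈ E.below w :=
  (h.isRel.mul u v).mem_below hw

theorem mul_mem_below {w : List κ} {x : TensorAlgebra k g} (hx : x ∈ E.below w) (u v : List κ) :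
    E.word u * x * E.word v ∈ E.below (u ++ w ++ v) := by
  induction hx using Submodule.span_induction with
  | mem x h =>
    obtain ⟨w', hw, hx⟩ := h
    exact (hx.mul u v).mem_below (hw.append u v)
  | zero => simp
  | add x y _ _ hx hy => rw [mul_add, add_mul]; exact Submodule.add_mem _ hx hy
  | smul c x _ hx => rw [mul_smul_comm, smul_mul_assoc]; exact Submodule.smul_mem _ _ hx

theorem tensor_mul_mem_relLE {d : ℕ} {x : TensorAlgebra k g} (hx : x ∈ E.relLE d) (z : g) :
    τ z * x ∈ E.relLE (d + 1) := by
  induction E.basis.mem_span z using Submodule.span_induction with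
  | mem z h =>
    obtain ⟨i, rfl⟩ := h
    induction hx using Submodule.span_induction with
    | mem x h =>
      obtain ⟨w', hw, hx⟩ := h
      exact Submodule.subset_span ⟨[i] ++ w' ++ [], by simpa using hw, by simpa using hx.mul [i] []⟩
    | zero => simp
    | add x y _ _ hx hy => rw [mul_add]; exact Submodule.add_mem _ hx hy
    | smul c x _ hx => rw [mul_smul_comm]; exact Submodule.smul_mem _ _ hx
  | zero => simp
  | add y z _ _ hy hz => rw [map_add, add_mul]; exact Submodule.add_mem _ hy hz
  | smul c z _ hz => rw [map_smul, smul_mul_assoc]; exact Submodule.smul_mem _ _ hz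

theorem mul_tensor_mem_relLE {d : ℕ} {x : TensorAlgebra k g} (hx : x ∈ E.relLE d) (z : g) :
    x * τ z ∈ E.relLE (d + 1) := by
  induction E.basis.mem_span z using Submodule.span_induction with
  | mem z h =>
    obtain ⟨i, rfl⟩ := h
    induction hx using Submodule.span_induction with
    | mem x h =>
      obtain ⟨w', hw, hx⟩ := h
      exact Submodule.subset_span ⟨[] ++ w' ++ [i], by simpa using hw, by simpa using hx.mul [] [i]⟩
    | zero => simp
    | add x y _ _ hx hy => rw [add_mul]; exact Submodule.add_mem _ hx hy
    | smul c x _ hx => rw [smul_mul_assoc]; exact Submodule.smul_mem _ _ hx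
  | zero => simp
  | add y z _ _ hy hz => rw [map_add, mul_add]; exact Submodule.add_mem _ hy hz
  | smul c z _ hz => rw [map_smul, mul_smul_comm]; exact Submodule.smul_mem _ _ hz

variable [NeZero (2 : k)]

theorem bracket_self_of_even {x : g} (hx : x ∈ L.part 0) : L.bracket x x = 0 := by
  have h := L.skew hx hx
  rw [koszulSign_zero_left, one_smul] at h
  have h2 : (2 : k) • L.bracket x x = 0 := by
    rw [two_smul]; exact add_eq_zero_iff_eq_neg.2 h
  exact (smul_eq_zero.1 h2).resolve_left (NeZero.ne 2)

theorem commRel_basis_mem (i j : κ) :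
    L.commRel (E.parity i) (E.parity j) (E.basis i) (E.basis j) ∈ E.relLE 2 := by
  rcases lt_trichotomy j i with h | rfl | h
  · exact Submodule.subset_span ⟨_, by simp, (IsRule.swap h).isRel⟩
  · rcases eq_zero_or_one (E.parity j) with h | h
    · have h0 : E.basis j ∈ L.part 0 := h ▸ E.mem j
      rw [h, commRel, bracket_self_of_even h0, koszulSign_zero_left]
      simp
    · have h1 : (2 : k)⁻¹ • L.commRel 1 1 (E.basis j) (E.basis j) ∈ E.relLE 2 :=
        Submodule.subset_span ⟨_, by simp, (IsRule.square h).isRel⟩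
      have h2 := Submodule.smul_mem _ (2 : k) h1
      rwa [smul_smul, mul_inv_cancel₀ (NeZero.ne 2), one_smul, ← h] at h2
  · rw [commRel_swap L (E.mem i) (E.mem j)]
    exact Submodule.neg_mem _ (Submodule.smul_mem _ _
      (Submodule.subset_span ⟨_, by simp, (IsRule.swap h).isRel⟩))

/-- By bilinearity and (super)symmetry, all commutation relations follow from the rules. -/
theorem commRel_mem {a b : ZMod 2} {x y : g} (hx : x ∈ L.part a) (hy : y ∈ L.part b) :
    L.commRel a b x y ∈ E.relLE 2 := by
  replace hx := E.mem_span_of_mem_part hx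
  replace hy := E.mem_span_of_mem_part hy
  induction hx using Submodule.span_induction with
  | mem x h =>
    obtain ⟨i, rfl, rfl⟩ := h
    induction hy using Submodule.span_induction with
    | mem y h =>
      obtain ⟨j, rfl, rfl⟩ := h
      exact commRel_basis_mem i j
    | zero => simp [commRel]
    | add y z _ _ hy hz =>
      convert Submodule.add_mem _ hy hz using 1
      simp only [commRel, map_add, mul_add, add_mul, smul_add]; abel
    | smul c z _ hz =>
      convert Submodule.smul_mem _ c hz using 1
      simp only [commRel, map_smul, mul_smul_comm, smul_mul_assoc, smul_sub,
        smul_smul, mul_comm c]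
  | zero => simp [commRel]
  | add y z _ _ hy hz =>
    convert Submodule.add_mem _ hy hz using 1
    simp only [commRel, map_add, LinearMap.add_apply, mul_add, add_mul, smul_add]; abel
  | smul c z _ hz =>
    convert Submodule.smul_mem _ c hz using 1
    simp only [commRel, map_smul, LinearMap.smul_apply, mul_smul_comm, smul_mul_assoc, smul_sub,
      smul_smul, mul_comm c]

end HomBasis
end RestrictedLieSuperalgebra

/-! ### Confluence of the rewriting rules -/

namespace RestrictedLieSuperalgebra

variable {k : Type u} {p : ℕ} {g : Type v} [Field k] [AddCommGroup g] [Module k g]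

theorem two_lt_of_char (k : Type u) [Field k] (p : ℕ) [hp : Fact p.Prime] [CharP k p]
    [NeZero (2 : k)] : 2 < p := by
  refine lt_of_le_of_ne hp.out.two_le ?_
  rintro rfl
  exact NeZero.ne (2 : k) (by exact_mod_cast CharP.cast_eq_zero k 2)

namespace HomBasis

variable {L : RestrictedLieSuperalgebra k p g} {κ : Type w} {E : L.HomBasis κ} [LinearOrder κ]

local notation "τ" => TensorAlgebra.ι k (M := g)

/-- The words of a relation other than its leading word are lower than the leading word. -/
theorem IsRule.sub_word_mem [hp : Fact p.Prime] [CharP k p] [NeZero (2 : k)]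
    {r : List κ} {t : TensorAlgebra k g} (h : E.IsRule r t) :
    t - E.word r ∈ Submodule.span k (E.word '' {w | w.IsLower r}) := by
  have hp2 := two_lt_of_char k p
  have hτ : ∀ (z : g) (r : List κ), 1 < r.length →
      τ z ∈ Submodule.span k (E.word '' {w | w.IsLower r}) := by
    intro z r hr
    induction E.basis.mem_span z using Submodule.span_induction with
    | mem z h =>
      obtain ⟨i, rfl⟩ := h
      exact Submodule.subset_span ⟨[i], Or.inl (by simpa using hr), by simp⟩
    | zero => simp
    | add y z _ _ hy hz => rw [map_add]; exact Submodule.add_mem _ hy hz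
    | smul c z _ hz => rw [map_smul]; exact Submodule.smul_mem _ _ hz
  cases h with
  | @swap i j h =>
    have h1 : E.word [j, i] ∈ Submodule.span k (E.word '' {w | w.IsLower [i, j]}) := by
      refine Submodule.subset_span ⟨_, Or.inr ⟨List.Perm.swap _ _ _, ?_⟩, rfl⟩
      simp [List.inversions, h, h.le]
    have h2 := Submodule.sub_mem _ (Submodule.neg_mem _ (Submodule.smul_mem _
      (koszulSign k (E.parity i) (E.parity j)) h1))
      (hτ (L.bracket (E.basis i) (E.basis j)) [i, j] (by simp))
    convert h2 using 1
    simp only [commRel, word_cons, word_nil, mul_one]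
    abel
  | @square i h =>
    have h2 := Submodule.neg_mem _ (Submodule.smul_mem _ (2 : k)⁻¹
      (hτ (L.bracket (E.basis i) (E.basis i)) [i, i] (by simp)))
    convert h2 using 1
    have h3 : koszulSign k 1 1 = -1 := by simp [koszulSign]
    simp only [commRel, word_cons, word_nil, mul_one, h3]
    have h4 : (2 : k) ≠ 0 := NeZero.ne 2
    match_scalars <;> field_simp
    ring
  | @power i h =>
    have h2 := Submodule.neg_mem _ (hτ (L.pmap ⟨E.basis i, h ▸ E.mem i⟩ : g)
      (List.replicate p i) (by simp; omega))
    convert h2 using 1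
    rw [word_replicate]
    abel

theorem IsRel.sub_word_mem [hp : Fact p.Prime] [CharP k p] [NeZero (2 : k)]
    {w : List κ} {x : TensorAlgebra k g} (h : E.IsRel w x) :
    x - E.word w ∈ Submodule.span k (E.word '' {w' | w'.IsLower w}) := by
  obtain ⟨u, r, t, v, hr, rfl, rfl⟩ := h
  have key : ∀ z ∈ Submodule.span k (E.word '' {w' | w'.IsLower r}),
      E.word u * z * E.word v ∈ Submodule.span k (E.word '' {w' | w'.IsLower (u ++ r ++ v)}) := by
    intro z hz
    induction hz using Submodule.span_induction with
    | mem z h =>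
      obtain ⟨w', hw, rfl⟩ := h
      exact Submodule.subset_span ⟨u ++ w' ++ v, hw.append u v, by simp [mul_assoc]⟩
    | zero => simp
    | add x y _ _ hx hy => rw [mul_add, add_mul]; exact Submodule.add_mem _ hx hy
    | smul c x _ hx => rw [mul_smul_comm, smul_mul_assoc]; exact Submodule.smul_mem _ _ hx
  have := key _ hr.sub_word_mem
  rwa [mul_sub, sub_mul, ← word_append, ← word_append] at this

theorem bracket_pow_mem {c : ZMod 2} {y z : g} (hy : y ∈ L.part 0) (hz : z ∈ L.part c) (n : ℕ) :
    (L.bracket y ^ n : Module.End k g) z ∈ L.part c := by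
  induction n with
  | zero => simpa
  | succ n ih =>
    rw [pow_succ', Module.End.mul_apply]
    simpa using L.bracket_mem hy ih

variable [NeZero (2 : k)]

theorem tensor_ad_iterate_sub_mem {c : ZMod 2} {y z : g} (hy : y ∈ L.part 0) (hz : z ∈ L.part c)
    (n : ℕ) : (fun a => τ y * a - a * τ y)^[n] (τ z) - τ ((L.bracket y ^ n : Module.End k g) z) ∈
      E.relLE (n + 1) := by
  induction n with
  | zero => simp
  | succ n ih =>
    rw [Function.iterate_succ_apply', pow_succ', Module.End.mul_apply]
    set a := (fun a => τ y * a - a * τ y)^[n] (τ z)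
    set zn := (L.bracket y ^ n : Module.End k g) z
    have h1 : L.commRel 0 c y zn ∈ E.relLE (n + 1 + 1) :=
      relLE_mono (by omega) (commRel_mem hy (bracket_pow_mem hy hz n))
    have h2 := Submodule.sub_mem _ (tensor_mul_mem_relLE ih y) (mul_tensor_mem_relLE ih y)
    convert Submodule.add_mem _ h1 h2 using 1
    rw [commRel, koszulSign_zero_left, one_smul, mul_sub, sub_mul]
    abel

theorem pow_tensor_commutator_mem {y z : g} (hy : y ∈ L.part 0) (hz : z ∈ L.part 0)
    (hyz : L.bracket y z = 0) (n : ℕ) : τ y ^ n * τ z - τ z * τ y ^ n ∈ E.relLE (n + 1) := by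
  induction n with
  | zero => simp
  | succ n ih =>
    have h1 := tensor_mul_mem_relLE ih y
    have h2 : L.commRel 0 0 y z * τ y ^ n ∈ E.relLE (2 + n) := by
      clear ih h1
      induction n with
      | zero => simpa using commRel_mem hy hz
      | succ n ih =>
        rw [pow_succ, ← mul_assoc]
        exact mul_tensor_mem_relLE ih y
    rw [show 2 + n = n + 1 + 1 by omega] at h2
    convert Submodule.add_mem _ h1 h2 using 1
    rw [commRel, hyz, koszulSign_zero_left, one_smul, map_zero, pow_succ']
    noncomm_ring

variable [hp : Fact p.Prime] [CharP k p]

/-- The commutation of a `p`-th power, modulo relations of length at most `p`; this resolves the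
overlaps between the commutation rules and the power rules. -/
theorem power_commutator_mem {c : ZMod 2} (y : L.part 0) {z : g} (hz : z ∈ L.part c) :
    τ (y : g) ^ p * τ z - τ z * τ (y : g) ^ p -
      ∑ m ∈ Finset.range p, τ (y : g) ^ m * L.commRel 0 c y z * τ (y : g) ^ (p - 1 - m) -
      τ (L.bracket (L.pmap y) z) ∈ E.relLE p := by
  have : CharP (TensorAlgebra k g) p :=
    charP_of_injective_algebraMap (algebraMap k (TensorAlgebra k g)).injective p
  have hp1 : p - 1 + 1 = p := Nat.succ_pred_prime hp.out
  set Y := τ (y : g)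
  have htel : ∀ n, Y ^ n * τ z - τ z * Y ^ n =
      ∑ m ∈ Finset.range n, Y ^ m * (Y * τ z - τ z * Y) * Y ^ (n - 1 - m) := by
    intro n
    induction n with
    | zero => simp
    | succ n ih =>
      rw [Finset.sum_range_succ]
      have : ∑ m ∈ Finset.range n, Y ^ m * (Y * τ z - τ z * Y) * Y ^ (n + 1 - 1 - m) =
          (∑ m ∈ Finset.range n, Y ^ m * (Y * τ z - τ z * Y) * Y ^ (n - 1 - m)) * Y := by
        rw [Finset.sum_mul]
        refine Finset.sum_congr rfl fun m hm => ?_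
        have := Finset.mem_range.1 hm
        rw [mul_assoc _ _ Y, ← pow_succ]
        congr 2; omega
      rw [this, ← ih]
      simp only [add_tsub_cancel_right, Nat.sub_self, pow_zero, mul_one]
      noncomm_ring
  have h1 := tensor_ad_iterate_sub_mem (E := E) y.2
    (by simpa using L.bracket_mem y.2 hz : L.bracket y z ∈ L.part c) (p - 1)
  rw [ad_iterate_pred_char, hp1, ← Module.End.mul_apply, ← pow_succ, hp1, ← L.ad_pmap] at h1
  convert h1 using 1
  rw [htel p, ← Finset.sum_sub_distrib]
  congr 1
  refine Finset.sum_congr rfl fun m _ => ?_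
  rw [← sub_mul, ← mul_sub, commRel, koszulSign_zero_left, one_smul]
  congr 2
  abel

/-- The overlap `i j ⋯ j` of a commutation rule and a power rule. -/
theorem overlap_swap_power {i j : κ} (hij : j < i) (hj : E.parity j = 0) :
    L.commRel (E.parity i) (E.parity j) (E.basis i) (E.basis j) * τ (E.basis j) ^ (p - 1) -
      τ (E.basis i) * (τ (E.basis j) ^ p - τ (L.pmap ⟨E.basis j, hj ▸ E.mem j⟩ : g)) ∈
      E.below (i :: List.replicate p j) := by
  have hp1 : p - 1 + 1 = p := Nat.succ_pred_prime hp.out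
  set y : L.part 0 := ⟨E.basis j, hj ▸ E.mem j⟩ with hy
  have h1 := relLE_le_below (w := i :: List.replicate p j) (by simp)
    (power_commutator_mem (E := E) y (E.mem i))
  have h2 := relLE_le_below (w := i :: List.replicate p j)
    (by simpa using (two_lt_of_char k p).le)
    (commRel_mem (E := E) (L.pmap y).2 (E.mem i))
  have h3 : (τ (E.basis j) ^ p - τ (L.pmap y : g)) * τ (E.basis i) ∈
      E.below (i :: List.replicate p j) := by
    have h4 := (IsRule.power hj).isRel.mul [] [i]
    rw [word_nil, one_mul, word_singleton] at h4
    refine h4.mem_below (Or.inr ⟨?_, ?_⟩)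
    · simp [List.perm_append_singleton]
    · have h5 : ([] ++ List.replicate p j ++ [i]).inversions = 0 := by
        simp [List.inversions_append, List.inversions_replicate, List.inversions, hij.le]
      rw [h5]
      simp [List.inversions, List.countP_replicate, hij, hp.out.pos]
  have h5 : ∀ m ∈ Finset.range (p - 1), τ (E.basis j) ^ (m + 1) * L.commRel 0 (E.parity i)
      y (E.basis i) * τ (E.basis j) ^ (p - 1 - (m + 1)) ∈ E.below (i :: List.replicate p j) := by
    intro m hm
    have hm := Finset.mem_range.1 hm
    have h6 := (IsRule.swap (E := E) hij).isRel.mul (List.replicate (m + 1) j)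
      (List.replicate (p - 1 - (m + 1)) j)
    rw [word_replicate, word_replicate, commRel_swap L (E.mem i) (E.mem j), hj] at h6
    rw [koszulSign_zero_right, one_smul, mul_neg, neg_mul] at h6
    refine (Submodule.neg_mem_iff _).1 ?_
    refine h6.mem_below (Or.inr ⟨?_, ?_⟩)
    · have h7 : (i :: List.replicate p j).Perm (List.replicate (m + 1) j ++
          i :: (List.replicate 1 j ++ List.replicate (p - 1 - (m + 1)) j)) := by
        refine List.Perm.trans ?_ List.perm_middle.symm
        rw [List.replicate_append_replicate, List.replicate_append_replicate]
        rw [show m + 1 + (1 + (p - 1 - (m + 1))) = p by omega]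
      simpa using h7.symm
    · simp only [List.inversions_append, List.inversions_replicate, List.inversions,
        List.countP_replicate, List.countP_cons, List.countP_nil]
      simp [hij, not_lt.2 hij.le]
      omega
  have h6 := Submodule.sum_mem (E.below (i :: List.replicate p j)) h5
  have h7 := Submodule.sub_mem _ (Submodule.sub_mem _ (Submodule.add_mem _ h1 h6) h3) h2
  have hsum : ∀ f : ℕ → TensorAlgebra k g, ∑ m ∈ Finset.range p, f m =
      ∑ m ∈ Finset.range (p - 1), f (m + 1) + f 0 := fun f => by
    rw [← Finset.sum_range_succ', hp1]
  rw [hsum] at h7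
  rw [commRel_swap L (E.mem i) (E.mem j), hj]
  convert h7 using 1
  simp only [commRel, koszulSign_zero_left, koszulSign_zero_right, one_smul, pow_zero, one_mul,
    Nat.sub_zero, sub_mul, mul_sub, neg_mul]
  abel

/-- The overlap `i ⋯ i j` of a power rule and a commutation rule. -/
theorem overlap_power_swap {i j : κ} (hij : j < i) (hi : E.parity i = 0) :
    (τ (E.basis i) ^ p - τ (L.pmap ⟨E.basis i, hi ▸ E.mem i⟩ : g)) * τ (E.basis j) -
    τ (E.basis i) ^ (p - 1) * L.commRel (E.parity i) (E.parity j) (E.basis i) (E.basis j) ∈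
      E.below (List.replicate p i ++ [j]) := by
  have hp1 : p - 1 + 1 = p := Nat.succ_pred_prime hp.out
  set y : L.part 0 := ⟨E.basis i, hi ▸ E.mem i⟩ with hy
  have h1 := relLE_le_below (w := List.replicate p i ++ [j]) (by simp)
    (power_commutator_mem (E := E) y (E.mem j))
  have h2 := relLE_le_below (w := List.replicate p i ++ [j])
    (by simpa using (two_lt_of_char k p).le)
    (commRel_mem (E := E) (L.pmap y).2 (E.mem j))
  have hperm : (j :: List.replicate p i).Perm (List.replicate p i ++ [j]) :=
    (List.perm_append_singleton _ _).symm
  have hinv : (List.replicate p i ++ [j]).inversions = p := by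
    simp [List.inversions_append, List.inversions_replicate, List.inversions, hij]
  have h3 : τ (E.basis j) * (τ (E.basis i) ^ p - τ (L.pmap y : g)) ∈
      E.below (List.replicate p i ++ [j]) := by
    have h4 := (IsRule.power hi).isRel.mul [j] []
    rw [word_nil, mul_one, word_singleton] at h4
    refine h4.mem_below (Or.inr ⟨by simpa using hperm, ?_⟩)
    rw [hinv]
    simp [List.inversions, List.inversions_replicate, List.countP_replicate,
      not_lt.2 hij.le, hp.out.pos]
  have h5 : ∀ m ∈ Finset.range (p - 1), τ (E.basis i) ^ m * L.commRel 0 (E.parity j)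
      y (E.basis j) * τ (E.basis i) ^ (p - 1 - m) ∈ E.below (List.replicate p i ++ [j]) := by
    intro m hm
    have hm := Finset.mem_range.1 hm
    have h6 := (IsRule.swap (E := E) hij).isRel.mul (List.replicate m i)
      (List.replicate (p - 1 - m) i)
    rw [word_replicate, word_replicate, hi] at h6
    refine h6.mem_below (Or.inr ⟨?_, ?_⟩)
    · have h7 : (j :: List.replicate p i).Perm (List.replicate (m + 1) i ++
          j :: (List.replicate (p - 1 - m) i)) := by
        refine List.Perm.trans ?_ List.perm_middle.symm
        rw [List.replicate_append_replicate, show m + 1 + (p - 1 - m) = p by omega]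
      refine List.Perm.trans ?_ hperm
      rw [List.replicate_succ'] at h7
      simpa using h7.symm
    · rw [hinv]
      simp only [List.inversions_append, List.inversions_replicate, List.inversions,
        List.countP_replicate, List.countP_cons, List.countP_nil]
      simp [hij, not_lt.2 hij.le]
      omega
  have h6 := Submodule.sum_mem (E.below (List.replicate p i ++ [j])) h5
  have h7 := Submodule.sub_mem _ (Submodule.add_mem _ (Submodule.add_mem _ h1 h6) h3) h2
  have hsum : ∀ f : ℕ → TensorAlgebra k g, ∑ m ∈ Finset.range p, f m =
      ∑ m ∈ Finset.range (p - 1), f m + f (p - 1) := fun f => by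
    rw [← Finset.sum_range_succ, hp1]
  rw [hsum] at h7
  rw [hi]
  convert h7 using 1
  simp only [commRel, koszulSign_zero_left, one_smul, pow_zero, mul_one,
    Nat.sub_self, sub_mul, mul_sub]
  abel

theorem IsRule.pair {i j : κ} {t : TensorAlgebra k g} (h : E.IsRule [i, j] t) :
    (j < i ∧ t = L.commRel (E.parity i) (E.parity j) (E.basis i) (E.basis j)) ∨
      (j = i ∧ E.parity i = 1 ∧ t = (2 : k)⁻¹ • L.commRel 1 1 (E.basis i) (E.basis i)) := by
  have hp2 := two_lt_of_char k p
  generalize hr : [i, j] = r at h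
  cases h with
  | @swap i' j' h' =>
    simp only [List.cons.injEq, and_true] at hr
    obtain ⟨rfl, rfl⟩ := hr
    exact Or.inl ⟨h', rfl⟩
  | @square i' h' =>
    simp only [List.cons.injEq, and_true] at hr
    obtain ⟨rfl, rfl⟩ := hr
    exact Or.inr ⟨rfl, h', rfl⟩
  | @power i' h' =>
    have := congrArg List.length hr
    simp only [List.length_cons, List.length_nil, List.length_replicate] at this
    omega

/-- The overlaps of two quadratic rules. -/
theorem overlap_quadratic {i j l : κ} {t t' : TensorAlgebra k g} (ht : E.IsRule [i, j] t)
    (ht' : E.IsRule [j, l] t') :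
    t * τ (E.basis l) - τ (E.basis i) * t' ∈ E.below [i, j, l] := by
  have h2 : (2 : k) ≠ 0 := NeZero.ne 2
  have h11 : koszulSign k 1 1 = -1 := by simp [koszulSign]
  have low : ∀ {a b : ZMod 2} {x y : g}, x ∈ L.part a → y ∈ L.part b →
      L.commRel a b x y ∈ E.below [i, j, l] := fun hx hy =>
    relLE_le_below (by simp) (commRel_mem hx hy)
  have hij := E.mem i
  have hb : ∀ i j, L.bracket (E.basis i) (E.basis j) ∈ L.part (E.parity i + E.parity j) :=
    fun i j => L.bracket_mem (E.mem i) (E.mem j)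
  have key := L.commRel_jacobi (c := E.parity l) (z := E.basis l) (E.mem i) (E.mem j)
  have l1 := low (E.mem i) (hb j l)
  have l2 := low (hb i j) (E.mem l)
  have l3 := low (E.mem j) (hb i l)
  rcases ht.pair with ⟨hji, rfl⟩ | ⟨rfl, hj, rfl⟩
  · rcases ht'.pair with ⟨hlj, rfl⟩ | ⟨rfl, hl, rfl⟩
    · have hli := hlj.trans hji
      rw [key]
      have r1 := (IsRule.swap (E := E) hli).mul_mem [j] [] (w := [i, j, l])
        (Or.inr ⟨List.Perm.swap _ _ _, by
          simp [List.inversions, hli, hji, hlj, hji.le]⟩)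
      have r2 := (IsRule.swap (E := E) hli).mul_mem [] [j] (w := [i, j, l])
        (Or.inr ⟨(List.Perm.swap _ _ _).cons _, by
          simp [List.inversions, hli, hji, hlj, hlj.le]⟩)
      have r3 := (IsRule.swap (E := E) hlj).mul_mem [] [i] (w := [i, j, l])
        (Or.inr ⟨List.perm_append_singleton i [j, l], by
          simp [List.inversions, hli, hji, hlj, hli.le, hji.le]⟩)
      have r4 := (IsRule.swap (E := E) hji).mul_mem [l] [] (w := [i, j, l])
        (Or.inr ⟨(List.perm_append_singleton l [i, j]).symm, by
          simp [List.inversions, hli, hji, hlj, hli.le, hlj.le]⟩)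
      simp only [word_nil, word_singleton, one_mul, mul_one] at r1 r2 r3 r4
      exact Submodule.sub_mem _ (Submodule.sub_mem _ (Submodule.add_mem _ (Submodule.add_mem _
        (Submodule.sub_mem _ (Submodule.add_mem _ (Submodule.neg_mem _ (Submodule.smul_mem _ _ r1))
        (Submodule.smul_mem _ _ r2)) (Submodule.smul_mem _ _ r3)) (Submodule.smul_mem _ _ r4)) l1)
        l2) (Submodule.smul_mem _ _ l3)
    · have r1 := (IsRule.swap (E := E) hji).mul_mem [l] [] (w := [i, l, l])
        (Or.inr ⟨List.Perm.swap _ _ _, by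
          simp [List.inversions, hji, hji.le]⟩)
      have r2 := (IsRule.square (E := E) hl).mul_mem [] [i] (w := [i, l, l])
        (Or.inr ⟨List.perm_append_singleton i [l, l], by
          simp [List.inversions, hji, hji.le]⟩)
      simp only [word_nil, word_singleton, one_mul, mul_one] at r1 r2
      rw [hl] at key l1 l2 l3 r1 ⊢
      rw [h11, koszulSign_mul_self] at key
      have := Submodule.sub_mem _ (Submodule.neg_mem _ (Submodule.smul_mem _
        (koszulSign k (E.parity i) 1) r1)) (Submodule.sub_mem _ r2
        (Submodule.smul_mem _ (2 : k)⁻¹ (Submodule.sub_mem _ (Submodule.sub_mem _ l1 l2)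
          (Submodule.smul_mem _ (koszulSign k (E.parity i) 1) l3))))
      convert this using 1
      simp only [smul_mul_assoc, mul_smul_comm]
      linear_combination (norm := skip) (2 : k)⁻¹ • key
      match_scalars <;> field_simp <;> ring
  · rcases ht'.pair with ⟨hlj, rfl⟩ | ⟨rfl, hl, rfl⟩
    · have r1 := (IsRule.swap (E := E) hlj).mul_mem [] [j] (w := [j, j, l])
        (Or.inr ⟨(List.Perm.swap _ _ _).cons _, by
          simp [List.inversions, hlj, hlj.le]⟩)
      have r2 := (IsRule.square (E := E) hj).mul_mem [l] [] (w := [j, j, l])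
        (Or.inr ⟨(List.perm_append_singleton l [j, j]).symm, by
          simp [List.inversions, hlj, hlj.le]⟩)
      simp only [word_nil, word_singleton, one_mul, mul_one] at r1 r2
      rw [hj] at key l1 l2 l3 r1 ⊢
      rw [h11, koszulSign_mul_self] at key
      have := Submodule.add_mem _ (Submodule.add_mem _ (Submodule.smul_mem _
        (koszulSign k 1 (E.parity l)) r1) r2)
        (Submodule.smul_mem _ (2 : k)⁻¹ (Submodule.sub_mem _ (Submodule.sub_mem _ l1 l2)
          (Submodule.smul_mem _ (-1 : k) l3)))
      convert this using 1
      simp only [smul_mul_assoc, mul_smul_comm]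
      linear_combination (norm := skip) (2 : k)⁻¹ • key
      match_scalars <;> field_simp <;> ring
    · have h3 : E.basis l ∈ L.part 1 := hj ▸ E.mem l
      have h4 := Submodule.smul_mem _ (2 : k)⁻¹ (low h3 (L.bracket_mem h3 h3))
      convert h4 using 1
      have h5 : (1 + 1 : ZMod 2) = 0 := by decide
      rw [commRel, commRel, L.odd_cube h3, h5, koszulSign_zero_right, one_smul, h11]
      simp only [smul_mul_assoc, mul_smul_comm, mul_sub, sub_mul, mul_assoc, map_zero]
      module

/-- No rewriting rule applies inside the leading word of another one. -/
theorem IsRule.eq_of_infix {r r' m s : List κ} {t t' : TensorAlgebra k g} (h : E.IsRule r t)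
    (h' : E.IsRule r' t') (hr : r = m ++ r' ++ s) : m = [] ∧ s = [] ∧ t = t' := by
  have hp2 := two_lt_of_char k p
  have hlen := congrArg List.length hr
  simp only [List.length_append] at hlen
  have aux : m.length = 0 → s.length = 0 → m = [] ∧ s = [] := fun h1 h2 =>
    ⟨List.length_eq_zero_iff.1 h1, List.length_eq_zero_iff.1 h2⟩
  cases h with
  | @swap i j hij =>
    cases h' with
    | @swap i' j' hij' =>
      simp only [List.length_cons, List.length_nil] at hlen
      obtain ⟨rfl, rfl⟩ := aux (by omega) (by omega)
      simp only [List.nil_append, List.append_nil, List.cons.injEq, and_true] at hr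
      obtain ⟨rfl, rfl⟩ := hr
      exact ⟨rfl, rfl, rfl⟩
    | @square i' hi' =>
      simp only [List.length_cons, List.length_nil] at hlen
      obtain ⟨rfl, rfl⟩ := aux (by omega) (by omega)
      simp only [List.nil_append, List.append_nil, List.cons.injEq, and_true] at hr
      obtain ⟨rfl, rfl⟩ := hr
      exact absurd hij (lt_irrefl _)
    | @power i' hi' =>
      simp only [List.length_cons, List.length_nil, List.length_replicate] at hlen
      omega
  | @square i hi =>
    cases h' with
    | @swap i' j' hij' =>
      simp only [List.length_cons, List.length_nil] at hlen
      obtain ⟨rfl, rfl⟩ := aux (by omega) (by omega)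
      simp only [List.nil_append, List.append_nil, List.cons.injEq, and_true] at hr
      obtain ⟨rfl, rfl⟩ := hr
      exact absurd hij' (lt_irrefl _)
    | @square i' hi' =>
      simp only [List.length_cons, List.length_nil] at hlen
      obtain ⟨rfl, rfl⟩ := aux (by omega) (by omega)
      simp only [List.nil_append, List.append_nil, List.cons.injEq, and_true] at hr
      obtain ⟨rfl, -⟩ := hr
      exact ⟨rfl, rfl, rfl⟩
    | @power i' hi' =>
      simp only [List.length_cons, List.length_nil, List.length_replicate] at hlen
      omega
  | @power i hi =>
    have hmem : ∀ x ∈ r', x = i := fun x hx =>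
      List.eq_of_mem_replicate (n := p) (by rw [hr]; simp [hx])
    cases h' with
    | @swap i' j' hij' =>
      rw [hmem i' (by simp), hmem j' (by simp)] at hij'
      exact absurd hij' (lt_irrefl _)
    | @square i' hi' =>
      rw [hmem i' (by simp), hi] at hi'
      exact absurd hi' (by decide)
    | @power i' hi' =>
      obtain rfl := hmem i' (by simp [hp.out.ne_zero])
      simp only [List.length_replicate] at hlen
      obtain ⟨rfl, rfl⟩ := aux (by omega) (by omega)
      exact ⟨rfl, rfl, rfl⟩

/-- Two rules whose leading words overlap give the same result, modulo lower relations. -/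
theorem IsRule.overlap {m s q : List κ} {t t' : TensorAlgebra k g} (h : E.IsRule (m ++ s) t)
    (h' : E.IsRule (s ++ q) t') (hm : m ≠ []) (hs : s ≠ []) (hq : q ≠ []) :
    t * E.word q - E.word m * t' ∈ E.below (m ++ s ++ q) := by
  have hp1 : p - 1 + 1 = p := Nat.succ_pred_prime hp.out
  have pair : ∀ {a b : List κ} {i j : κ}, a ≠ [] → b ≠ [] → a ++ b = [i, j] →
      a = [i] ∧ b = [j] := by
    intro a b i j ha hb hab
    rcases a with - | ⟨a, a'⟩
    · exact absurd rfl ha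
    · rcases a' with - | ⟨a', a''⟩ <;> simp_all
  have h₀ := h
  have h₀' := h'
  generalize hr : m ++ s = r at h
  generalize hr' : s ++ q = r' at h'
  cases h with
  | @swap i j hij =>
    obtain ⟨rfl, rfl⟩ := pair hm hs hr
    cases h' with
    | @swap i' j' hij' =>
      obtain ⟨h1, rfl⟩ := pair (by simp) hq hr'
      simpa using overlap_quadratic h₀ h₀'
    | @square i' hi' =>
      obtain ⟨h1, rfl⟩ := pair (by simp) hq hr'
      simpa using overlap_quadratic h₀ h₀'
    | @power i' hi' =>
      have h1 := List.append_eq_replicate_iff.1 hr'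
      obtain ⟨h1, h2, h3⟩ := h1
      simp only [List.length_singleton, List.replicate_one, List.cons.injEq, and_true] at h1 h2
      subst h2
      rw [show q.length = p - 1 by omega] at h3
      subst h3
      have := overlap_swap_power (E := E) hij hi'
      rw [← hr'] at this
      simpa using this
  | @square i hi =>
    obtain ⟨rfl, rfl⟩ := pair hm hs hr
    cases h' with
    | @swap i' j' hij' =>
      obtain ⟨h1, rfl⟩ := pair (by simp) hq hr'
      simpa using overlap_quadratic h₀ h₀'
    | @square i' hi' =>
      obtain ⟨h1, rfl⟩ := pair (by simp) hq hr'
      simpa using overlap_quadratic h₀ h₀'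
    | @power i' hi' =>
      have h1 : i = i' := List.eq_of_mem_replicate (n := p) (by rw [← hr']; simp)
      rw [h1, hi'] at hi
      exact absurd hi (by decide)
  | @power i hi =>
    obtain ⟨h1, h2, h3⟩ := List.append_eq_replicate_iff.1 hr
    have hsi : ∀ x ∈ s, x = i := fun x hx =>
      List.eq_of_mem_replicate (n := p) (by rw [← hr]; simp [hx])
    cases h' with
    | @swap i' j' hij' =>
      obtain ⟨rfl, rfl⟩ := pair hs hq hr'
      obtain rfl := hsi i' (by simp)
      rw [List.length_singleton] at h1
      rw [show m.length = p - 1 by omega] at h2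
      subst h2
      have := overlap_power_swap (E := E) hij' hi
      simpa using this
    | @square i' hi' =>
      obtain ⟨rfl, rfl⟩ := pair hs hq hr'
      obtain rfl := hsi i' (by simp)
      rw [hi] at hi'
      exact absurd hi' (by decide)
    | @power i' hi' =>
      obtain ⟨h4, h5, h6⟩ := List.append_eq_replicate_iff.1 hr'
      obtain rfl : i = i' := by
        obtain ⟨x, hx⟩ := List.exists_mem_of_ne_nil s hs
        rw [← hsi x hx]
        exact List.eq_of_mem_replicate (n := p) (by rw [← hr']; simp [hx])
      have hmq : m.length = q.length := by omega
      have h7 : m = q := by rw [h2, h6, hmq]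
      have h8 : 0 < s.length := List.length_pos_iff.2 hs
      have hp2 := two_lt_of_char k p
      set y : L.part 0 := ⟨E.basis i, hi ▸ E.mem i⟩
      have h9 : L.bracket y (L.pmap y) = 0 := by
        have h10 : ∀ n, (L.bracket (y : g) ^ (n + 1) : Module.End k g) y = 0 := fun n => by
          rw [pow_succ, Module.End.mul_apply, bracket_self_of_even y.2, map_zero]
        rw [L.skew y.2 (L.pmap y).2, koszulSign_zero_left, one_smul, L.ad_pmap, neg_eq_zero]
        simpa [hp1] using h10 (p - 1)
      rw [← hr, ← h7]
      have h10 := relLE_le_below (d := m.length + 1) (w := m ++ s ++ m)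
        (by simp only [List.length_append]; omega)
        (pow_tensor_commutator_mem (E := E) y.2 (L.pmap y).2 h9 m.length)
      convert h10 using 1
      have h11 : E.word m = τ (E.basis i) ^ m.length := by rw [h2, word_replicate]; simp
      rw [h11, sub_mul, mul_sub, ← pow_add, ← pow_add, add_comm p]
      abel

/-- Two rules applying at positions of one word, the first at its beginning, give the same result
modulo lower relations. -/
theorem IsRule.sub_mem_below {r r' m v v' : List κ} {t t' : TensorAlgebra k g} (h : E.IsRule r t)
    (h' : E.IsRule r' t') (hr : r ++ v = m ++ (r' ++ v')) :
    t * E.word v - E.word m * t' * E.word v' ∈ E.below (r ++ v) := by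
  have disjoint : ∀ {a : List κ}, m = r ++ a → v = a ++ (r' ++ v') →
      t * E.word v - E.word m * t' * E.word v' ∈ E.below (r ++ v) := by
    rintro a rfl rfl
    -- `t a r' v' - r a t' v' = t a (r' - t') v' - (r - t) a t' v'`
    have h1 : ∀ z ∈ Submodule.span k (E.word '' {w | w.IsLower r'}),
        t * E.word a * z * E.word v' ∈ E.below (r ++ (a ++ (r' ++ v'))) := by
      intro z hz
      induction hz using Submodule.span_induction with
      | mem z hz =>
        obtain ⟨w', hw, rfl⟩ := hz
        have h2 := h.mul_mem [] (a ++ w' ++ v') (w := r ++ (a ++ (r' ++ v')))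
          (by simpa using hw.append (r ++ a) v')
        simpa [mul_assoc] using h2
      | zero => simp
      | add x y _ _ hx hy => rw [mul_add, add_mul]; exact Submodule.add_mem _ hx hy
      | smul c x _ hx => rw [mul_smul_comm, smul_mul_assoc]; exact Submodule.smul_mem _ _ hx
    have h2 : ∀ z ∈ Submodule.span k (E.word '' {w | w.IsLower r}),
        z * E.word a * t' * E.word v' ∈ E.below (r ++ (a ++ (r' ++ v'))) := by
      intro z hz
      induction hz using Submodule.span_induction with
      | mem z hz =>
        obtain ⟨w', hw, rfl⟩ := hz
        have h2 := h'.mul_mem (w' ++ a) v' (w := r ++ (a ++ (r' ++ v')))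
          (by simpa using hw.append [] (a ++ (r' ++ v')))
        simpa [mul_assoc] using h2
      | zero => simp
      | add x y _ _ hx hy => simp only [add_mul]; exact Submodule.add_mem _ hx hy
      | smul c x _ hx => simp only [smul_mul_assoc]; exact Submodule.smul_mem _ _ hx
    have h3 := Submodule.sub_mem _ (h2 _ h.sub_word_mem) (h1 _ h'.sub_word_mem)
    convert h3 using 1
    simp only [word_append]
    noncomm_ring
  rcases List.append_eq_append_iff.1 hr with ⟨a, h1, h2⟩ | ⟨b, rfl, h2⟩
  · exact disjoint h1 h2
  · rcases List.append_eq_append_iff.1 h2 with ⟨a, rfl, rfl⟩ | ⟨c, rfl, rfl⟩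
    · obtain ⟨rfl, rfl, rfl⟩ := h.eq_of_infix h' (m := m) (s := a) (by simp)
      simp
    · by_cases hb : b = []
      · subst hb
        exact disjoint (a := []) (by simp) (by simp)
      by_cases hm : m = []
      · subst hm
        obtain ⟨-, rfl, rfl⟩ := h'.eq_of_infix h (m := []) (s := c) (by simp)
        simp
      by_cases hc : c = []
      · subst hc
        obtain ⟨rfl, -, rfl⟩ := h.eq_of_infix h' (m := m) (s := []) (by simp)
        simp
      have h3 := mul_mem_below (h.overlap h' hm hb hc) [] v'
      simpa [sub_mul, mul_assoc] using h3

/-- Any two relations with the same leading word agree modulo lower relations. -/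
theorem IsRel.sub_mem_below {w : List κ} {x x' : TensorAlgebra k g} (h : E.IsRel w x)
    (h' : E.IsRel w x') : x - x' ∈ E.below w := by
  obtain ⟨u, r, t, v, hr, rfl, rfl⟩ := h
  obtain ⟨u', r', t', v', hr', hw, rfl⟩ := h'
  rw [List.append_assoc, List.append_assoc] at hw
  rcases List.append_eq_append_iff.1 hw with ⟨a, rfl, h2⟩ | ⟨b, rfl, h2⟩
  · have h3 := mul_mem_below (hr.sub_mem_below hr' h2) u []
    simpa [mul_sub, mul_assoc] using h3
  · have h3 := mul_mem_below (hr'.sub_mem_below hr h2) u' []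
    rw [← Submodule.neg_mem_iff, neg_sub]
    rw [h2] at h3
    simpa [mul_sub, mul_assoc] using h3

end HomBasis
end RestrictedLieSuperalgebra

/-! ### The universal property and the basis of irreducible words -/

namespace RestrictedLieSuperalgebra

variable {k : Type u} {p : ℕ} {g : Type v} [Field k] [AddCommGroup g] [Module k g]

section Lift

variable (L : RestrictedLieSuperalgebra k p g) {A : Type*} [Ring A] [Algebra k A]

theorem mkEnv_surjective : Function.Surjective L.mkEnv :=
  RingQuot.mkAlgHom_surjective k L.EnvRel

theorem mkEnv_ι (x : g) : L.mkEnv (TensorAlgebra.ι k x) = L.ι x := rfl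

theorem lift_envRel (f : g →ₗ[k] A)
    (hb : ∀ {i j : ZMod 2} {x y : g}, x ∈ L.part i → y ∈ L.part j →
      f x * f y - koszulSign k i j • (f y * f x) = f (L.bracket x y))
    (hp : ∀ x : L.part 0, f x ^ p = f (L.pmap x)) ⦃a b : TensorAlgebra k g⦄ (h : L.EnvRel a b) :
    TensorAlgebra.lift k f a = TensorAlgebra.lift k f b := by
  cases h with
  | bracket hx hy => simpa using hb hx hy
  | pmap x => simpa using hp x

/-- The universal property of `u(g)`. -/
noncomputable def lift (f : g →ₗ[k] A)
    (hb : ∀ {i j : ZMod 2} {x y : g}, x ∈ L.part i → y ∈ L.part j →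
      f x * f y - koszulSign k i j • (f y * f x) = f (L.bracket x y))
    (hp : ∀ x : L.part 0, f x ^ p = f (L.pmap x)) : L.Env →ₐ[k] A :=
  RingQuot.liftAlgHom k ⟨TensorAlgebra.lift k f, L.lift_envRel f hb hp⟩

theorem lift_mkEnv (f : g →ₗ[k] A)
    (hb : ∀ {i j : ZMod 2} {x y : g}, x ∈ L.part i → y ∈ L.part j →
      f x * f y - koszulSign k i j • (f y * f x) = f (L.bracket x y))
    (hp : ∀ x : L.part 0, f x ^ p = f (L.pmap x)) (t : TensorAlgebra k g) :
    L.lift f hb hp (L.mkEnv t) = TensorAlgebra.lift k f t :=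
  RingQuot.liftAlgHom_mkAlgHom_apply k (TensorAlgebra.lift k f) (L.lift_envRel f hb hp) t

theorem lift_ι (f : g →ₗ[k] A)
    (hb : ∀ {i j : ZMod 2} {x y : g}, x ∈ L.part i → y ∈ L.part j →
      f x * f y - koszulSign k i j • (f y * f x) = f (L.bracket x y))
    (hp : ∀ x : L.part 0, f x ^ p = f (L.pmap x)) (x : g) : L.lift f hb hp (L.ι x) = f x := by
  rw [← mkEnv_ι, lift_mkEnv, TensorAlgebra.lift_ι_apply]

theorem jacobsonCoeff_mem {x y : g} (hx : x ∈ L.part 0) (hy : y ∈ L.part 0) (n j : ℕ) :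
    jacobsonCoeff L.bracket x y n j ∈ L.part 0 := by
  have hb : ∀ {x y : g}, x ∈ L.part 0 → y ∈ L.part 0 → L.bracket x y ∈ L.part 0 := fun hx hy => by
    simpa using L.bracket_mem hx hy
  induction n generalizing j with
  | zero => cases j with
    | zero => exact hx
    | succ j => exact Submodule.zero_mem _
  | succ n ih => cases j with
    | zero => exact hb hy (ih 0)
    | succ j => exact Submodule.add_mem _ (hb hy (ih _)) (hb hx (ih _))

theorem map_jacobsonCoeff (f : g →ₗ[k] A)
    (hb : ∀ {x y : g}, x ∈ L.part 0 → y ∈ L.part 0 → f x * f y - f y * f x = f (L.bracket x y))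
    {x y : g} (hx : x ∈ L.part 0) (hy : y ∈ L.part 0) (n j : ℕ) :
    f (jacobsonCoeff L.bracket x y n j) =
      jacobsonCoeff (commutatorBilin k A) (f x) (f y) n j := by
  induction n generalizing j with
  | zero => cases j <;> simp [jacobsonCoeff]
  | succ n ih =>
    have hm := L.jacobsonCoeff_mem hx hy n
    cases j <;> simp only [jacobsonCoeff, map_add, ← ih, commutatorBilin_apply, hb hx (hm _),
      hb hy (hm _)]

/-- Compatibility with the `p`-mapping can be checked on a spanning set of the even part, by
Jacobson's formula. -/
theorem map_pmap_of_span [hp : Fact p.Prime] [CharP k p] (f : g →ₗ[k] A)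
    (hb : ∀ {x y : g}, x ∈ L.part 0 → y ∈ L.part 0 → f x * f y - f y * f x = f (L.bracket x y))
    (s : Set (L.part 0)) (hs : Submodule.span k s = ⊤)
    (h : ∀ x ∈ s, f x ^ p = f (L.pmap x)) (x : L.part 0) : f x ^ p = f (L.pmap x) := by
  have hx : x ∈ Submodule.span k s := hs ▸ Submodule.mem_top
  induction hx using Submodule.span_induction with
  | mem x hx => exact h x hx
  | zero =>
    have h0 : L.pmap 0 = 0 := by
      have := L.pmap_smul 0 0
      simpa [hp.out.ne_zero] using this
    simp [h0, hp.out.ne_zero]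
  | add x y _ _ hx hy =>
    rw [L.pmap_add, map_add, map_add, map_sum, Submodule.coe_add, map_add,
      add_pow_char_eq_add_jacobsonCoeff (k := k), hx, hy]
    simp only [map_smul, L.map_jacobsonCoeff f hb x.2 y.2]
  | smul c x _ hx =>
    rw [L.pmap_smul, Submodule.coe_smul, Submodule.coe_smul, map_smul, map_smul, smul_pow, hx]

end Lift

namespace HomBasis

variable {L : RestrictedLieSuperalgebra k p g} {κ : Type w} (E : L.HomBasis κ)

local notation "τ" => TensorAlgebra.ι k (M := g)

theorem span_even_eq_top :
    Submodule.span k {x : L.part 0 | ∃ i, E.parity i = 0 ∧ E.basis i = x} = ⊤ := by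
  rw [eq_top_iff]
  rintro ⟨x, hx⟩ -
  have h1 := E.mem_span_of_mem_part hx
  have h2 : {y | ∃ i, E.parity i = 0 ∧ E.basis i = y} =
      (L.part 0).subtype '' {x : L.part 0 | ∃ i, E.parity i = 0 ∧ E.basis i = x} := by
    ext y
    constructor
    · rintro ⟨i, hi, rfl⟩
      exact ⟨⟨E.basis i, hi ▸ E.mem i⟩, ⟨i, hi, rfl⟩, rfl⟩
    · rintro ⟨z, ⟨i, hi, hz⟩, rfl⟩
      exact ⟨i, hi, hz⟩
  rw [h2, ← Submodule.map_span] at h1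
  obtain ⟨z, hz, hzx⟩ := h1
  have : z = ⟨x, hx⟩ := Subtype.ext hzx
  rwa [← this]

/-- The element of `u(g)` given by a word in the basis. -/
noncomputable def envWord (w : List κ) : L.Env := (w.map fun i => L.ι (E.basis i)).prod

@[simp] theorem envWord_nil : E.envWord [] = 1 := rfl

@[simp] theorem envWord_cons (i : κ) (w : List κ) :
    E.envWord (i :: w) = L.ι (E.basis i) * E.envWord w := by
  simp [envWord]

@[simp] theorem envWord_append (w w' : List κ) :
    E.envWord (w ++ w') = E.envWord w * E.envWord w' := by
  simp [envWord]

theorem mkEnv_word (w : List κ) : L.mkEnv (E.word w) = E.envWord w := by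
  rw [word, map_list_prod, List.map_map]
  rfl

variable [LinearOrder κ]

/-- The irreducible words: those in which no rewriting rule applies. -/
def IsIrreducible (w : List κ) : Prop := ∀ x, ¬ E.IsRel w x

/-- The span of all the relations, which is the kernel of the map to `u(g)`. -/
def relSpan : Submodule k (TensorAlgebra k g) := Submodule.span k {x | ∃ w, E.IsRel w x}

variable {E}

theorem mul_mem_relSpan (a b : TensorAlgebra k g) {x : TensorAlgebra k g} (hx : x ∈ E.relSpan) :
    a * x * b ∈ E.relSpan := by
  induction hx using Submodule.span_induction with
  | mem x h =>
    obtain ⟨w, h⟩ := h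
    induction E.wordBasis.mem_span a using Submodule.span_induction with
    | mem a ha =>
      obtain ⟨u, rfl⟩ := ha
      induction E.wordBasis.mem_span b using Submodule.span_induction with
      | mem b hb =>
        obtain ⟨v, rfl⟩ := hb
        rw [wordBasis_apply, wordBasis_apply]
        exact Submodule.subset_span ⟨_, h.mul u v⟩
      | zero => simp
      | add x y _ _ hx hy => rw [mul_add]; exact Submodule.add_mem _ hx hy
      | smul c x _ hx => rw [mul_smul_comm]; exact Submodule.smul_mem _ _ hx
    | zero => simp
    | add x y _ _ hx hy => simp only [add_mul]; exact Submodule.add_mem _ hx hy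
    | smul c x _ hx => simp only [smul_mul_assoc]; exact Submodule.smul_mem _ _ hx
  | zero => simp
  | add x y _ _ hx hy => rw [mul_add, add_mul]; exact Submodule.add_mem _ hx hy
  | smul c x _ hx => rw [mul_smul_comm, smul_mul_assoc]; exact Submodule.smul_mem _ _ hx

theorem relLE_le_relSpan (d : ℕ) : E.relLE d ≤ E.relSpan :=
  Submodule.span_mono fun _ ⟨w, _, h⟩ => ⟨w, h⟩

theorem mkEnv_eq_zero_of_mem_relSpan {t : TensorAlgebra k g} (ht : t ∈ E.relSpan) :
    L.mkEnv t = 0 := by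
  induction ht using Submodule.span_induction with
  | mem x h =>
    obtain ⟨w, u, r, t, v, hr, rfl, rfl⟩ := h
    have hc : ∀ {a b : ZMod 2} {x y : g}, x ∈ L.part a → y ∈ L.part b →
        L.mkEnv (L.commRel a b x y) = 0 := by
      intro a b x y hx hy
      simp only [commRel, map_sub, map_mul, map_smul, mkEnv_ι, L.ι_bracket hx hy, sub_self]
    have : L.mkEnv t = 0 := by
      cases hr with
      | @swap i j h => exact hc (E.mem i) (E.mem j)
      | @square i h =>
        have hi : E.basis i ∈ L.part 1 := h ▸ E.mem i
        rw [map_smul, hc hi hi, smul_zero]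
      | @power i h =>
        rw [map_sub, map_pow, mkEnv_ι, mkEnv_ι, ← L.ι_pmap, sub_self]
    simp [this]
  | zero => simp
  | add x y _ _ hx hy => rw [map_add, hx, hy, add_zero]
  | smul c x _ hx => rw [map_smul, hx, smul_zero]

variable [NeZero (2 : k)] [hp : Fact p.Prime] [CharP k p]

theorem mem_relSpan_of_mkEnv_eq_zero {t : TensorAlgebra k g} (ht : L.mkEnv t = 0) :
    t ∈ E.relSpan := by
  let I : Ideal (TensorAlgebra k g) :=
    { E.relSpan with
      smul_mem' := fun a x hx => by simpa using mul_mem_relSpan a 1 hx }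
  have hI : ∀ x, x ∈ I ↔ x ∈ E.relSpan := fun _ => Iff.rfl
  have : I.IsTwoSided := ⟨fun b hx => by
    rw [hI] at *
    simpa using mul_mem_relSpan 1 b hx⟩
  let f : g →ₗ[k] (TensorAlgebra k g ⧸ I) := (Ideal.Quotient.mkₐ k I).toLinearMap ∘ₗ τ
  have hf : ∀ x, f x = Ideal.Quotient.mkₐ k I (τ x) := fun _ => rfl
  have hb : ∀ {i j : ZMod 2} {x y : g}, x ∈ L.part i → y ∈ L.part j →
      f x * f y - koszulSign k i j • (f y * f x) = f (L.bracket x y) := by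
    intro i j x y hx hy
    have h1 : L.commRel i j x y ∈ I := relLE_le_relSpan 2 (commRel_mem hx hy)
    have h2 : Ideal.Quotient.mkₐ k I (L.commRel i j x y) = 0 := Ideal.Quotient.eq_zero_iff_mem.2 h1
    rw [commRel, map_sub, map_sub, map_mul, map_smul, map_mul] at h2
    exact sub_eq_zero.1 h2
  have hp : ∀ x : L.part 0, f x ^ p = f (L.pmap x) := by
    refine L.map_pmap_of_span f (fun hx hy => by simpa [koszulSign_zero_left] using hb hx hy) _
      E.span_even_eq_top ?_
    rintro ⟨_, hx⟩ ⟨i, hi, rfl⟩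
    have h1 : τ (E.basis i) ^ p - τ (L.pmap ⟨E.basis i, hi ▸ E.mem i⟩ : g) ∈ I :=
      Submodule.subset_span ⟨_, (IsRule.power hi).isRel⟩
    have h2 := (Ideal.Quotient.eq_zero_iff_mem (I := I)).2 h1
    exact sub_eq_zero.1 h2
  have h1 := L.lift_mkEnv f hb hp t
  rw [ht, map_zero] at h1
  have h2 : TensorAlgebra.lift k f = Ideal.Quotient.mkₐ k I := by
    ext x
    simp [hf]
  rw [h2] at h1
  exact (Ideal.Quotient.eq_zero_iff_mem (I := I)).1 h1.symm

variable (E)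

/-- The diamond lemma: every tensor is congruent modulo the relations to a unique combination of
irreducible words. -/
theorem isCompl_relSpan :
    IsCompl E.relSpan (Submodule.span k (E.wordBasis '' {w | E.IsIrreducible w})) := by
  refine isCompl_span_of_confluent E.wordBasis List.wordRank E.IsRel ?_ ?_
  · intro w x h
    rw [wordBasis_apply]
    refine Submodule.span_mono ?_ h.sub_word_mem
    rintro _ ⟨w', hw, rfl⟩
    exact ⟨w', List.IsLower.wordRank_lt hw, E.wordBasis_apply w'⟩
  · intro w x y hx hy
    refine Submodule.span_mono ?_ (hx.sub_mem_below hy)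
    rintro z ⟨w', hw, h⟩
    exact ⟨w', List.IsLower.wordRank_lt hw, h⟩

/-- The Poincaré–Birkhoff–Witt theorem: the irreducible words form a basis of `u(g)`. -/
noncomputable def envBasis : Basis {w : List κ // E.IsIrreducible w} k L.Env := by
  refine Basis.mk (v := fun w => E.envWord w.1) ?_ ?_
  · have h1 : LinearIndependent k (fun w : {w : List κ // E.IsIrreducible w} => E.wordBasis w.1) :=
      E.wordBasis.linearIndependent.comp _ Subtype.val_injective
    have h2 := h1.map (f := L.mkEnv.toLinearMap) ?_
    · have h3 : (fun w : {w : List κ // E.IsIrreducible w} => E.envWord w.1) =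
          L.mkEnv.toLinearMap ∘ fun w : {w : List κ // E.IsIrreducible w} => E.wordBasis w.1 := by
        ext w
        simp [wordBasis_apply, mkEnv_word]
      rw [h3]
      exact h2
    · have h3 : Set.range (fun w : {w : List κ // E.IsIrreducible w} => E.wordBasis w.1) =
          E.wordBasis '' {w | E.IsIrreducible w} := by
        ext x; simp
      rw [h3]
      refine E.isCompl_relSpan.symm.disjoint.mono_right ?_
      intro t ht
      exact mem_relSpan_of_mkEnv_eq_zero ht
  · intro a _
    obtain ⟨t, rfl⟩ := L.mkEnv_surjective a
    obtain ⟨x, hx, y, hy, rfl⟩ := Submodule.mem_sup.1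
      (E.isCompl_relSpan.sup_eq_top ▸ Submodule.mem_top : t ∈ _ ⊔ _)
    rw [map_add, mkEnv_eq_zero_of_mem_relSpan hx, zero_add]
    have h1 := Submodule.mem_map_of_mem (f := L.mkEnv.toLinearMap) hy
    rw [Submodule.map_span] at h1
    refine Submodule.span_mono ?_ h1
    rintro _ ⟨_, ⟨w, hw, rfl⟩, rfl⟩
    exact ⟨⟨w, hw⟩, by simp [wordBasis_apply, mkEnv_word]⟩

theorem envBasis_apply (w : {w : List κ // E.IsIrreducible w}) :
    E.envBasis w = E.envWord w.1 := by
  rw [envBasis, Basis.mk_apply]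

end HomBasis
end RestrictedLieSuperalgebra

/-! ### Reduced words -/

section RuleWord

variable {κ : Type*} [LinearOrder κ]

/-- The leading words of the rewriting rules, for letters of parity `par`. -/
def IsRuleWord (p : ℕ) (par : κ → ZMod 2) (r : List κ) : Prop :=
  (∃ i j, j < i ∧ r = [i, j]) ∨ (∃ i, par i = 1 ∧ r = [i, i]) ∨
    ∃ i, par i = 0 ∧ r = List.replicate p i

theorem IsRuleWord.map_iff {κ' : Type*} [LinearOrder κ'] {p : ℕ} (hp : p ≠ 0) {par : κ → ZMod 2}
    {par' : κ' → ZMod 2} {f : κ → κ'} (hf : StrictMono f) (hpar : ∀ i, par' (f i) = par i)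
    {r : List κ} : IsRuleWord p par' (r.map f) ↔ IsRuleWord p par r := by
  have pair : ∀ {i j : κ'}, r.map f = [i, j] → ∃ a b, f a = i ∧ f b = j ∧ r = [a, b] := by
    intro i j h
    obtain ⟨a, r', h1, h2, h3⟩ := List.map_eq_cons_iff.1 h
    obtain ⟨b, r'', h4, h5, h6⟩ := List.map_eq_cons_iff.1 h3
    exact ⟨a, b, h2, h5, by rw [h1, h4, List.map_eq_nil_iff.1 h6]⟩
  constructor
  · rintro (⟨i, j, hij, h⟩ | ⟨i, hi, h⟩ | ⟨i, hi, h⟩)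
    · obtain ⟨a, b, rfl, rfl, rfl⟩ := pair h
      exact Or.inl ⟨a, b, hf.lt_iff_lt.1 hij, rfl⟩
    · obtain ⟨a, b, rfl, hb, rfl⟩ := pair h
      exact Or.inr (Or.inl ⟨a, by rw [← hpar, hi], by rw [hf.injective hb]⟩)
    · rw [List.eq_replicate_iff, List.length_map] at h
      obtain ⟨h1, h2⟩ := h
      obtain ⟨j, hj⟩ := List.exists_mem_of_length_pos (l := r) (by omega)
      obtain rfl : f j = i := h2 _ (List.mem_map_of_mem hj)
      refine Or.inr (Or.inr ⟨j, by rw [← hpar, hi], ?_⟩)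
      rw [List.eq_replicate_iff]
      exact ⟨h1, fun b hb => hf.injective (h2 _ (List.mem_map_of_mem hb))⟩
  · rintro (⟨i, j, hij, rfl⟩ | ⟨i, hi, rfl⟩ | ⟨i, hi, rfl⟩)
    · exact Or.inl ⟨f i, f j, hf hij, rfl⟩
    · exact Or.inr (Or.inl ⟨f i, by rw [hpar, hi], rfl⟩)
    · exact Or.inr (Or.inr ⟨f i, by rw [hpar, hi], by simp⟩)

/-- The words in which no rewriting rule applies. -/
def IsReducedWord (p : ℕ) (par : κ → ZMod 2) (w : List κ) : Prop :=
  ∀ u r v, IsRuleWord p par r → w ≠ u ++ r ++ v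

variable {p : ℕ} {par : κ → ZMod 2}

theorem isReducedWord_singleton (hp : 2 < p) (i : κ) : IsReducedWord p par [i] := by
  intro u r v hr h
  have hlen := congrArg List.length h
  simp only [List.length_append, List.length_singleton] at hlen
  rcases hr with ⟨_, _, -, rfl⟩ | ⟨_, -, rfl⟩ | ⟨_, -, rfl⟩ <;> simp at hlen <;> omega

theorem isReducedWord_nil (hp : 2 < p) : IsReducedWord p par [] := by
  intro u r v hr h
  have hlen := congrArg List.length h
  simp only [List.length_append, List.length_nil] at hlen
  rcases hr with ⟨_, _, -, rfl⟩ | ⟨_, -, rfl⟩ | ⟨_, -, rfl⟩ <;> simp at hlen <;> omega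

theorem IsReducedWord.pairwise_le {w : List κ} (h : IsReducedWord p par w) :
    w.Pairwise (· ≤ ·) := by
  rw [← List.isChain_iff_pairwise, List.isChain_iff_forall_rel_of_append_cons_cons]
  intro a b u v hw
  by_contra hab
  exact h u [a, b] v (Or.inl ⟨a, b, not_le.1 hab, rfl⟩) (by simpa using hw)

theorem List.exists_eq_append_replicate_of_pairwise_le {w : List κ} (h : w.Pairwise (· ≤ ·))
    (x : κ) : ∃ u v, w = u ++ List.replicate (w.count x) x ++ v := by
  induction w with
  | nil => exact ⟨[], [], by simp⟩
  | cons a w ih =>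
    obtain ⟨h1, h2⟩ := List.pairwise_cons.1 h
    obtain ⟨u, v, huv⟩ := ih h2
    rcases eq_or_ne a x with rfl | hax
    · rw [List.count_cons_self]
      rcases eq_or_ne (w.count a) 0 with h0 | h0
      · exact ⟨[], w, by simp [h0]⟩
      · have hu : ∀ b ∈ u, b = a := by
          intro b hb
          have h3 : b ≤ a := by
            rw [huv, List.append_assoc] at h2
            refine (List.pairwise_append.1 h2).2.2 b hb a ?_
            simp [h0]
          exact le_antisymm h3 (h1 b (by rw [huv]; simp [hb]))
        obtain ⟨m, rfl⟩ : ∃ m, u = List.replicate m a := ⟨_, List.eq_replicate_iff.2 ⟨rfl, hu⟩⟩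
        refine ⟨[], List.replicate m a ++ v, ?_⟩
        generalize w.count a = n at *
        rw [huv, List.nil_append, List.replicate_succ, List.cons_append, ← List.append_assoc,
          List.replicate_append_replicate, List.replicate_append_replicate, Nat.add_comm]
    · rw [List.count_cons_of_ne hax]
      exact ⟨a :: u, v, by simpa using huv⟩

theorem IsReducedWord.count_lt (hp : 2 < p) {w : List κ} (h : IsReducedWord p par w) (x : κ) :
    w.count x < p := by
  by_contra hc
  obtain ⟨u, v, hw⟩ := List.exists_eq_append_replicate_of_pairwise_le h.pairwise_le x
  have hpar : par x = 0 ∨ par x = 1 := by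
    generalize par x = i; revert i; decide
  rcases hpar with h0 | h1
  · obtain ⟨n, hn⟩ : ∃ n, w.count x = p + n := ⟨w.count x - p, by omega⟩
    rw [hn, ← List.replicate_append_replicate] at hw
    exact h u (List.replicate p x) (List.replicate n x ++ v) (Or.inr (Or.inr ⟨x, h0, rfl⟩))
      (hw.trans (by simp only [List.append_assoc]))
  · obtain ⟨n, hn⟩ : ∃ n, w.count x = 2 + n := ⟨w.count x - 2, by omega⟩
    rw [hn, ← List.replicate_append_replicate] at hw
    exact h u (List.replicate 2 x) (List.replicate n x ++ v) (Or.inr (Or.inl ⟨x, h1, rfl⟩))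
      (hw.trans (by simp only [List.append_assoc]))

/-- A reduced word is determined by the multiplicities of its letters, which are less than `p`. -/
theorem finite_isReducedWord [Finite κ] (hp : 2 < p) :
    Finite {w : List κ // IsReducedWord p par w} := by
  refine Finite.of_injective (β := κ → Fin p)
    (fun w x => ⟨w.1.count x, w.2.count_lt hp x⟩) ?_
  intro w w' h
  refine Subtype.ext ?_
  have h1 : w.1.Perm w'.1 := List.perm_iff_count.2 fun x => by
    simpa using congrArg (fun f => (f x : ℕ)) h
  exact h1.eq_of_pairwise (fun a b _ _ h1 h2 => le_antisymm h1 h2) w.2.pairwise_le w'.2.pairwise_le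

end RuleWord

section Split

variable {ι κ : Type*} [LinearOrder ι] [LinearOrder κ] {p : ℕ} {par : ι ⊕ₗ κ → ZMod 2}

theorem isReducedWord_inl_append_inr_iff (hp : 2 < p) (c : List ι) (d : List κ) :
    IsReducedWord p par (c.map Sum.inlₗ ++ d.map Sum.inrₗ) ↔
      IsReducedWord p (fun i => par (Sum.inlₗ i)) c ∧
        IsReducedWord p (fun i => par (Sum.inrₗ i)) d := by
  have hp0 : p ≠ 0 := by omega
  constructor
  · intro h
    constructor
    · rintro u r v hr rfl
      refine h (u.map Sum.inlₗ) (r.map Sum.inlₗ) (v.map Sum.inlₗ ++ d.map Sum.inrₗ)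
        ((IsRuleWord.map_iff hp0 Sum.Lex.inl_strictMono fun _ => rfl).2 hr) (by simp)
    · rintro u r v hr rfl
      refine h (c.map Sum.inlₗ ++ u.map Sum.inrₗ) (r.map Sum.inrₗ) (v.map Sum.inrₗ)
        ((IsRuleWord.map_iff hp0 Sum.Lex.inr_strictMono fun _ => rfl).2 hr) (by simp)
  · rintro ⟨hc, hd⟩ u r v hr h
    have hleft : ∀ {a b : List (ι ⊕ₗ κ)}, c.map Sum.inlₗ = a ++ r ++ b → False := by
      intro a b h
      obtain ⟨ar, b', rfl, h1, rfl⟩ := List.map_eq_append_iff.1 h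
      obtain ⟨a', r', rfl, rfl, rfl⟩ := List.map_eq_append_iff.1 h1
      exact hc a' r' b' ((IsRuleWord.map_iff hp0 Sum.Lex.inl_strictMono fun _ => rfl).1 hr) rfl
    have hright : ∀ {a b : List (ι ⊕ₗ κ)}, d.map Sum.inrₗ = a ++ r ++ b → False := by
      intro a b h
      obtain ⟨ar, b', rfl, h1, rfl⟩ := List.map_eq_append_iff.1 h
      obtain ⟨a', r', rfl, rfl, rfl⟩ := List.map_eq_append_iff.1 h1
      exact hd a' r' b' ((IsRuleWord.map_iff hp0 Sum.Lex.inr_strictMono fun _ => rfl).1 hr) rfl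
    have hstraddle : ∀ {a b : List (ι ⊕ₗ κ)} {i : ι} {j : κ}, r = a ++ b → Sum.inlₗ i ∈ a →
        Sum.inrₗ j ∈ b → False := by
      rintro a b i j hab hi hj
      have hij : (Sum.inlₗ i : ι ⊕ₗ κ) < Sum.inrₗ j := Sum.Lex.inl_lt_inr _ _
      have hne : a ≠ [] := List.ne_nil_of_mem hi
      have hne' : b ≠ [] := List.ne_nil_of_mem hj
      have hpair : ∀ {x y : ι ⊕ₗ κ}, r = [x, y] → x = Sum.inlₗ i ∧ y = Sum.inrₗ j := by
        intro x y h
        rw [h] at hab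
        rcases a with - | ⟨x', a⟩
        · exact absurd rfl hne
        · rcases a with - | ⟨a, a'⟩
          · simp only [List.cons_append, List.nil_append, List.cons.injEq] at hab
            obtain ⟨rfl, rfl⟩ := hab
            simp only [List.mem_singleton] at hi hj
            exact ⟨hi.symm, hj.symm⟩
          · simp_all
      rcases hr with ⟨x, y, hxy, h1⟩ | ⟨x, -, h1⟩ | ⟨x, -, h1⟩
      · obtain ⟨rfl, rfl⟩ := hpair h1
        exact lt_asymm hij hxy
      · obtain ⟨rfl, h2⟩ := hpair h1
        exact hij.ne h2
      · have h2 : Sum.inlₗ i = x := List.eq_of_mem_replicate (n := p) (by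
          rw [← h1, hab]; exact List.mem_append_left _ hi)
        have h3 : Sum.inrₗ j = x := List.eq_of_mem_replicate (n := p) (by
          rw [← h1, hab]; exact List.mem_append_right _ hj)
        exact hij.ne (h2.trans h3.symm)
    rw [List.append_assoc] at h
    rcases List.append_eq_append_iff.1 h with ⟨a, h1, h2⟩ | ⟨b, h1, h2⟩
    · exact hright (a := a) (b := v) (by rw [h2]; simp)
    · rcases List.append_eq_append_iff.1 h2 with ⟨a, rfl, h3⟩ | ⟨a, rfl, h3⟩
      · exact hleft (a := u) (b := a) (by rw [h1]; simp)
      · rcases b with - | ⟨x, b⟩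
        · exact hright (a := []) (b := v) (by simpa using h3)
        rcases a with - | ⟨y, a⟩
        · exact hleft (a := u) (b := []) (by simpa using h1)
        have hx : x ∈ c.map Sum.inlₗ := by rw [h1]; simp
        have hy : y ∈ d.map Sum.inrₗ := by rw [h3]; simp
        obtain ⟨i, -, rfl⟩ := List.mem_map.1 hx
        obtain ⟨j, -, rfl⟩ := List.mem_map.1 hy
        exact hstraddle (a := Sum.inlₗ i :: b) (b := Sum.inrₗ j :: a) (i := i) (j := j) rfl
          (by simp) (by simp)

theorem List.exists_map_inl_append_map_inr {w : List (ι ⊕ₗ κ)} (h : w.Pairwise (· ≤ ·)) :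
    ∃ (c : List ι) (d : List κ), w = c.map Sum.inlₗ ++ d.map Sum.inrₗ := by
  induction w with
  | nil => exact ⟨[], [], rfl⟩
  | cons a w ih =>
    obtain ⟨h1, h2⟩ := List.pairwise_cons.1 h
    obtain ⟨c, d, rfl⟩ := ih h2
    rcases a with i | j
    · exact ⟨i :: c, d, rfl⟩
    · rcases c with - | ⟨i, c⟩
      · exact ⟨[], j :: d, rfl⟩
      · exact absurd (h1 (Sum.inlₗ i) (by simp)) (Sum.Lex.not_inr_le_inl)

theorem List.map_inl_append_map_inr_inj {c c' : List ι} {d d' : List κ}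
    (h : (c.map Sum.inlₗ ++ d.map Sum.inrₗ : List (ι ⊕ₗ κ)) =
      c'.map Sum.inlₗ ++ d'.map Sum.inrₗ) : c = c' ∧ d = d' := by
  induction c generalizing c' with
  | nil =>
    rcases c' with - | ⟨i, c'⟩
    · exact ⟨rfl, List.map_injective_iff.2 Sum.Lex.inr_strictMono.injective h⟩
    · rcases d with - | ⟨j, d⟩ <;> simp at h
  | cons i c ih =>
    rcases c' with - | ⟨i', c'⟩
    · rcases d' with - | ⟨j, d'⟩ <;> simp at h
    · simp only [List.map_cons, List.cons_append, List.cons.injEq] at h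
      obtain ⟨rfl, rfl⟩ := ih h.2
      exact ⟨by rw [Sum.Lex.inl_strictMono.injective h.1], rfl⟩

/-- A reduced word in a sum of two alphabets is a reduced word in the first alphabet followed by a
reduced word in the second one. -/
noncomputable def reducedWordEquiv (hp : 2 < p) :
    ((_ : {c : List ι // IsReducedWord p (fun i => par (Sum.inlₗ i)) c}) ×
      {d : List κ // IsReducedWord p (fun i => par (Sum.inrₗ i)) d}) ≃
      {w : List (ι ⊕ₗ κ) // IsReducedWord p par w} :=
  Equiv.ofBijective
    (fun s => ⟨s.1.1.map Sum.inlₗ ++ s.2.1.map Sum.inrₗ,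
      (isReducedWord_inl_append_inr_iff hp _ _).2 ⟨s.1.2, s.2.2⟩⟩) (by
    constructor
    · rintro ⟨⟨c, hc⟩, ⟨d, hd⟩⟩ ⟨⟨c', hc'⟩, ⟨d', hd'⟩⟩ h
      obtain ⟨rfl, rfl⟩ := List.map_inl_append_map_inr_inj (congrArg Subtype.val h)
      rfl
    · rintro ⟨w, hw⟩
      obtain ⟨c, d, rfl⟩ := List.exists_map_inl_append_map_inr hw.pairwise_le
      obtain ⟨hc, hd⟩ := (isReducedWord_inl_append_inr_iff hp c d).1 hw
      exact ⟨⟨⟨c, hc⟩, ⟨d, hd⟩⟩, rfl⟩)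

end Split

/-! ### Freeness over the enveloping algebra of a subalgebra -/

namespace RestrictedLieSuperalgebra

variable {k : Type u} {p : ℕ} {g : Type v} [Field k] [AddCommGroup g] [Module k g]

namespace HomBasis

variable {L : RestrictedLieSuperalgebra k p g} {κ : Type w} (E : L.HomBasis κ)

theorem envParity_envWord (w : List κ) :
    L.envParity (E.envWord w) = paritySign k (w.map E.parity).sum • E.envWord w := by
  induction w with
  | nil => simp [paritySign]
  | cons i w ih =>
    rw [envWord_cons, map_mul, ih, envParity_ι, parity_apply _ (E.mem i), map_smul,
      smul_mul_smul_comm, List.map_cons, List.sum_cons, paritySign_add]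

variable [LinearOrder κ]

theorem isIrreducible_iff {w : List κ} : E.IsIrreducible w ↔ IsReducedWord p E.parity w := by
  constructor
  · rintro h u r v (⟨i, j, hij, rfl⟩ | ⟨i, hi, rfl⟩ | ⟨i, hi, rfl⟩) hw
    · exact h _ ⟨u, _, _, v, IsRule.swap hij, hw, rfl⟩
    · exact h _ ⟨u, _, _, v, IsRule.square hi, hw, rfl⟩
    · exact h _ ⟨u, _, _, v, IsRule.power hi, hw, rfl⟩
  · rintro h x ⟨u, r, t, v, hr, hw, rfl⟩
    refine h u r v ?_ hw
    cases hr with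
    | @swap i j h => exact Or.inl ⟨i, j, h, rfl⟩
    | @square i h => exact Or.inr (Or.inl ⟨i, h, rfl⟩)
    | @power i h => exact Or.inr (Or.inr ⟨i, h, rfl⟩)

variable [NeZero (2 : k)] [hp : Fact p.Prime] [CharP k p]

/-- The basis of `u(g)` given by the reduced words. -/
noncomputable def pbwBasis : Basis {w : List κ // IsReducedWord p E.parity w} k L.Env :=
  E.envBasis.reindex (Equiv.subtypeEquivRight fun _ => E.isIrreducible_iff)

theorem pbwBasis_apply (w : {w : List κ // IsReducedWord p E.parity w}) :
    E.pbwBasis w = E.envWord w.1 := by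
  rw [pbwBasis, Basis.reindex_apply, envBasis_apply]
  rfl

end HomBasis

section Existence

variable (L : RestrictedLieSuperalgebra k p g)

theorem exists_homBasis [Module.Finite k g] :
    ∃ m n : ℕ, Nonempty (L.HomBasis (Fin m ⊕ₗ Fin n)) := by
  refine ⟨_, _, ⟨⟨(((finBasis k (L.part 0)).prod (finBasis k (L.part 1))).map
    (Submodule.prodEquivOfIsCompl _ _ L.isCompl)).reindex toLex,
    fun s => Sum.elim (fun _ => 0) (fun _ => 1) (ofLex s), ?_⟩⟩⟩
  intro s
  obtain ⟨s, rfl⟩ := toLex.surjective s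
  rw [Basis.reindex_apply, Equiv.symm_apply_apply]
  rcases s with i | i
  · change (((finBasis k (L.part 0)).prod (finBasis k (L.part 1))).map
      (Submodule.prodEquivOfIsCompl _ _ L.isCompl)) (Sum.inl i) ∈ L.part 0
    simp
  · change (((finBasis k (L.part 0)).prod (finBasis k (L.part 1))).map
      (Submodule.prodEquivOfIsCompl _ _ L.isCompl)) (Sum.inr i) ∈ L.part 1
    simp

variable {L} {a : Submodule k g} (ha : L.IsSubalgebra a)

/-- A homogeneous basis of a subalgebra extends to a homogeneous basis of `g`. -/
theorem exists_homBasis_extending [Module.Finite k g] {κ : Type w}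
    (F : (L.sub a ha).HomBasis κ) :
    ∃ (m : ℕ) (E : L.HomBasis (Fin m ⊕ₗ κ)),
      ∀ j, E.basis (Sum.inrₗ j) = F.basis j ∧ E.parity (Sum.inrₗ j) = F.parity j := by
  classical
  let s : Set g := Set.range fun j => (F.basis j : g)
  let t : Set g := {x | ∃ i, x ∈ L.part i}
  have hli : LinearIndependent k (fun j => (F.basis j : g)) :=
    F.basis.linearIndependent.map' a.subtype (Submodule.ker_subtype a)
  have hst : s ⊆ t := by
    rintro _ ⟨j, rfl⟩
    exact ⟨F.parity j, F.mem j⟩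
  obtain ⟨b, hbt, hsb, htb, hb⟩ := exists_linearIndepOn_id_extension (linearIndepOn_id_range_iff
    hli.injective |>.2 hli) hst
  have hbli : LinearIndependent k ((↑) : b → g) := hb
  have hspan : Submodule.span k b = ⊤ := by
    rw [eq_top_iff, ← L.isCompl.sup_eq_top, sup_le_iff]
    exact ⟨fun x hx => htb ⟨0, hx⟩, fun x hx => htb ⟨1, hx⟩⟩
  have hfin : Finite b := hbli.finite
  have : Finite ↥(b \ s) := Set.Finite.subset (Set.toFinite b) Set.sdiff_subset
  obtain ⟨m, ⟨e⟩⟩ := Finite.exists_equiv_fin ↥(b \ s)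
  let f : Fin m ⊕ κ → b := Sum.elim (fun i => ⟨(e.symm i : g), (e.symm i).2.1⟩)
    (fun j => ⟨F.basis j, hsb ⟨j, rfl⟩⟩)
  have hf : Function.Bijective f := by
    constructor
    · rintro (i | i) (j | j) h
      · have h' : (e.symm i : g) = (e.symm j : g) := congrArg (fun z : b => (z : g)) h
        exact congrArg Sum.inl (e.symm.injective (Subtype.ext h'))
      · have h' : (e.symm i : g) = F.basis j := congrArg (fun z : b => (z : g)) h
        exact absurd ⟨j, h'.symm⟩ (e.symm i).2.2
      · have h' : (F.basis i : g) = e.symm j := congrArg (fun z : b => (z : g)) h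
        exact absurd ⟨i, h'⟩ (e.symm j).2.2
      · have h' : (F.basis i : g) = (F.basis j : g) := congrArg (fun z : b => (z : g)) h
        exact congrArg Sum.inr (hli.injective h')
    · rintro ⟨x, hx⟩
      by_cases hxs : x ∈ s
      · obtain ⟨j, rfl⟩ := hxs
        exact ⟨Sum.inr j, rfl⟩
      · exact ⟨Sum.inl (e ⟨x, hx, hxs⟩), by simp [f]⟩
  let B : Basis b k g := Basis.mk hbli (by rw [Subtype.range_coe, hspan])
  let B' : Basis (Fin m ⊕ₗ κ) k g := B.reindex ((Equiv.ofBijective f hf).symm.trans toLex)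
  have hB' : ∀ s, B' (toLex s) = f s := by
    intro s
    simp only [B', Basis.reindex_apply, B, Basis.mk_apply]
    rfl
  choose par hpar using fun x : b => hbt x.2
  refine ⟨m, ⟨B', fun s => Sum.elim (fun i => par (f (Sum.inl i))) F.parity (ofLex s), ?_⟩, ?_⟩
  · rintro (i | j)
    · exact (hB' (Sum.inl i)).symm ▸ hpar (f (Sum.inl i))
    · exact (hB' (Sum.inr j)).symm ▸ F.mem j
  · intro j
    exact ⟨hB' (Sum.inr j), rfl⟩

end Existence

section Extension

variable (L : RestrictedLieSuperalgebra k p g) {a : Submodule k g} (ha : L.IsSubalgebra a)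

/-- The map `u(a) → u(g)` for a subalgebra `a` of `g`. -/
noncomputable def subEnv : (L.sub a ha).Env →ₐ[k] L.Env :=
  (L.sub a ha).lift (L.ι ∘ₗ a.subtype) (fun hx hy => L.ι_bracket hx hy)
    (fun x => L.ι_pmap ⟨x.1.1, x.2⟩)

@[simp] theorem subEnv_ι (x : a) : L.subEnv ha ((L.sub a ha).ι x) = L.ι (x : g) :=
  (L.sub a ha).lift_ι _ (fun hx hy => L.ι_bracket hx hy) (fun x => L.ι_pmap ⟨x.1.1, x.2⟩) x

/-- The data exhibiting `u(g)` as a free right `u(a)`-module, with a finite basis of homogeneous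
elements containing `1`.  The last condition says that the basis contains elements of `g` that are
independent modulo `a`. -/
structure FreeExtension where
  index : Type
  [fintype : Fintype index]
  [decidableEq : DecidableEq index]
  gen : index → L.Env
  par : index → ZMod 2
  gen_mem : ∀ c, gen c ∈ L.envPart (par c)
  one : index
  gen_one : gen one = 1
  par_one : par one = 0
  coord : L.Env ≃ₗ[k] (index → (L.sub a ha).Env)
  coord_symm : ∀ f, coord.symm f = ∑ c, gen c * L.subEnv ha (f c)
  exists_coord : ∀ y : g, y ∉ a → ∃ c, ∃ s : k, s ≠ 0 ∧ coord (L.ι y) c = algebraMap k _ s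

attribute [instance] FreeExtension.fintype FreeExtension.decidableEq

theorem subEnv_envWord {κ : Type w} (F : (L.sub a ha).HomBasis κ) {ι : Type*}
    (E : L.HomBasis (ι ⊕ₗ κ)) (hE : ∀ j, E.basis (Sum.inrₗ j) = F.basis j) (d : List κ) :
    L.subEnv ha (F.envWord d) = E.envWord (d.map Sum.inrₗ) := by
  induction d with
  | nil => simp
  | cons j d ih =>
    rw [List.map_cons, HomBasis.envWord_cons, HomBasis.envWord_cons, map_mul, subEnv_ι, ih, hE]

/-- In an ordered basis of `g` that ends with a basis of `a`, a reduced word is a reduced word in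
the new basis elements followed by one in the basis of `a`; so the former ones form a basis of
`u(g)` over `u(a)`. -/
theorem nonempty_freeExtension [Module.Finite k g] [NeZero (2 : k)] [Fact p.Prime] [CharP k p] :
    Nonempty (L.FreeExtension ha) := by
  classical
  have hp := two_lt_of_char k p
  obtain ⟨m₀, n₀, ⟨F⟩⟩ := (L.sub a ha).exists_homBasis
  obtain ⟨m, E, hE⟩ := exists_homBasis_extending ha F
  have : Finite {c : List (Fin m) // IsReducedWord p (fun i => E.parity (Sum.inlₗ i)) c} :=
    finite_isReducedWord hp
  let P := {c : List (Fin m) // IsReducedWord p (fun i => E.parity (Sum.inlₗ i)) c}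
  have : Fintype P := Fintype.ofFinite _
  have hpar : (fun i => E.parity (Sum.inrₗ i)) = F.parity := funext fun j => (hE j).2
  let e₁ : {d // IsReducedWord p F.parity d} ≃
      {d // IsReducedWord p (fun i => E.parity (Sum.inrₗ i)) d} :=
    Equiv.subtypeEquivRight fun d => by rw [hpar]
  let B₁ : Basis ((_ : P) × {d // IsReducedWord p F.parity d}) k (P → (L.sub a ha).Env) :=
    Pi.basis fun _ => F.pbwBasis
  let e₂ : ((_ : P) × {d // IsReducedWord p F.parity d}) ≃ {w // IsReducedWord p E.parity w} :=
    (Equiv.sigmaCongrRight fun _ => e₁).trans (reducedWordEquiv hp)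
  let coord : L.Env ≃ₗ[k] (P → (L.sub a ha).Env) := E.pbwBasis.equiv B₁ e₂.symm
  let gen : P → L.Env := fun c => E.envWord (c.1.map Sum.inlₗ)
  have hsymm : ∀ f, coord.symm f = ∑ c, gen c * L.subEnv ha (f c) := by
    intro f
    let Φ : (P → (L.sub a ha).Env) →ₗ[k] L.Env :=
      ∑ c, (LinearMap.mulLeft k (gen c) ∘ₗ (L.subEnv ha).toLinearMap) ∘ₗ LinearMap.proj c
    have hΦ : ∀ f, Φ f = ∑ c, gen c * L.subEnv ha (f c) := fun f => by simp [Φ]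
    have : coord.symm.toLinearMap = Φ := by
      refine B₁.ext fun s => ?_
      rw [hΦ, LinearEquiv.coe_coe, Basis.equiv_symm, Basis.equiv_apply, HomBasis.pbwBasis_apply,
        Pi.basis_apply, Finset.sum_eq_single s.1]
      · rw [Pi.single_eq_same, HomBasis.pbwBasis_apply, subEnv_envWord L ha F E fun j => (hE j).1]
        exact E.envWord_append _ _
      · intro c _ hc
        rw [Pi.single_eq_of_ne hc, map_zero, mul_zero]
      · simp
    rw [← hΦ, ← this]; rfl
  have hcoord : ∀ c b, coord (gen c * L.subEnv ha b) = Pi.single c b := by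
    intro c b
    rw [← LinearEquiv.eq_symm_apply, hsymm, Finset.sum_eq_single c]
    · simp
    · intro c' _ hc
      rw [Pi.single_eq_of_ne hc, map_zero, mul_zero]
    · simp
  let single : Fin m → P := fun i => ⟨[i], isReducedWord_singleton hp i⟩
  let one : P := ⟨[], isReducedWord_nil hp⟩
  have hι : ∀ i (y : g), coord (L.ι y) (single i) =
      algebraMap k _ (E.basis.repr y (Sum.inlₗ i)) := by
    intro i y
    induction E.basis.mem_span y using Submodule.span_induction with
    | mem y h =>
      obtain ⟨s, rfl⟩ := h
      rcases s with i' | j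
      · have h1 := hcoord (single i') 1
        have h2 : gen (single i') = L.ι (E.basis (Sum.inlₗ i')) := by simp [gen, single]
        rw [map_one, mul_one, h2] at h1
        change coord (L.ι (E.basis (Sum.inlₗ i'))) (single i) =
          algebraMap k _ (E.basis.repr (E.basis (Sum.inlₗ i')) (Sum.inlₗ i))
        rw [h1]
        rcases eq_or_ne i i' with rfl | hne
        · simp
        · have h3 : single i ≠ single i' := fun h =>
            hne (by simpa [single] using congrArg Subtype.val h)
          rw [Pi.single_eq_of_ne h3, Basis.repr_self, Finsupp.single_eq_of_ne, map_zero]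
          exact fun h => hne (Sum.Lex.inl_strictMono.injective h)
      · have h1 := hcoord one ((L.sub a ha).ι (F.basis j))
        have h2 : gen one = 1 := by simp [gen, one]
        rw [h2, one_mul, subEnv_ι, ← (hE j).1] at h1
        change coord (L.ι (E.basis (Sum.inrₗ j))) (single i) =
          algebraMap k _ (E.basis.repr (E.basis (Sum.inrₗ j)) (Sum.inlₗ i))
        have h3 : single i ≠ one := fun h => by
          simpa [single, one] using congrArg Subtype.val h
        rw [h1, Pi.single_eq_of_ne h3, Basis.repr_self, Finsupp.single_eq_of_ne, map_zero]
        rintro ⟨⟩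
    | zero => simp
    | add x y _ _ hx hy => simp [hx, hy]
    | smul c x _ hx =>
      rw [map_smul, map_smul, map_smul, Pi.smul_apply, hx, Finsupp.smul_apply, smul_eq_mul,
        map_mul, Algebra.smul_def]
  refine ⟨⟨P, gen, fun c => ((c.1.map Sum.inlₗ).map E.parity).sum,
    fun c => E.envParity_envWord _, one, by simp [gen, one], by simp [one], coord, hsymm, ?_⟩⟩
  intro y hy
  by_contra! h
  have h0 : ∀ i, E.basis.repr y (Sum.inlₗ i) = 0 := by
    intro i
    by_contra hi
    exact h (single i) _ hi (hι i y)
  refine hy ?_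
  have : Fintype (Fin m ⊕ₗ (Fin m₀ ⊕ₗ Fin n₀)) := Fintype.ofFinite _
  rw [← E.basis.sum_repr y]
  refine Submodule.sum_mem _ fun s _ => ?_
  rcases s with i | j
  · exact (h0 i).symm ▸ (zero_smul k (E.basis (Sum.inlₗ i))).symm ▸ a.zero_mem
  · exact a.smul_mem _ ((hE j).1.symm ▸ (F.basis j).2)

end Extension

end RestrictedLieSuperalgebra

/-! ### Parity and subquotients of supermodules -/

namespace RestrictedLieSuperalgebra

variable {k : Type u} {p : ℕ} {g : Type v} [Field k] [AddCommGroup g] [Module k g]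

section EnvLemmas

variable (L : RestrictedLieSuperalgebra k p g)

/-- Induction on elements of `u(g)`, as an algebra generated by `g`. -/
theorem env_induction {P : L.Env → Prop} (hk : ∀ r : k, P (algebraMap k _ r))
    (hι : ∀ x, P (L.ι x)) (hmul : ∀ a b, P a → P b → P (a * b))
    (hadd : ∀ a b, P a → P b → P (a + b)) (a : L.Env) : P a := by
  obtain ⟨t, rfl⟩ := L.mkEnv_surjective a
  induction t using TensorAlgebra.induction with
  | algebraMap r => simpa using hk r
  | ι x => exact hι x
  | mul a b ha hb => simpa using hmul _ _ ha hb
  | add a b ha hb => simpa using hadd _ _ ha hb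

variable {L}

theorem mem_envPart {i : ZMod 2} {a : L.Env} :
    a ∈ L.envPart i ↔ L.envParity a = paritySign k i • a := Iff.rfl

theorem ι_mem_envPart {i : ZMod 2} {x : g} (hx : x ∈ L.part i) : L.ι x ∈ L.envPart i := by
  rw [mem_envPart, envParity_ι, parity_apply _ hx, map_smul]

theorem mul_mem_envPart {i j : ZMod 2} {a b : L.Env} (ha : a ∈ L.envPart i)
    (hb : b ∈ L.envPart j) : a * b ∈ L.envPart (i + j) := by
  rw [mem_envPart] at *
  rw [map_mul, ha, hb, smul_mul_smul_comm, paritySign_add]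

theorem exists_parts (x : g) : ∃ y ∈ L.part 0, ∃ z ∈ L.part 1, y + z = x :=
  Submodule.mem_sup.1 (L.isCompl.sup_eq_top ▸ Submodule.mem_top)

end EnvLemmas

theorem add_self_zmod_two (i : ZMod 2) : i + i = 0 := by
  revert i; decide

namespace Supermodule

variable {L : RestrictedLieSuperalgebra k p g} (M : L.Supermodule)

theorem exists_parts (m : M.carrier) : ∃ y ∈ M.part 0, ∃ z ∈ M.part 1, y + z = m :=
  Submodule.mem_sup.1 (M.isCompl.sup_eq_top ▸ Submodule.mem_top)

/-- The parity involution of a supermodule, acting on `part i` by `(-1)^i`. -/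
noncomputable def parity : M.carrier →ₗ[k] M.carrier :=
  (M.part 0).projection (M.part 1) M.isCompl - (M.part 1).projection (M.part 0) M.isCompl.symm

theorem parity_apply {i : ZMod 2} {x : M.carrier} (hx : x ∈ M.part i) :
    M.parity x = paritySign k i • x := by
  rcases eq_zero_or_one i with rfl | rfl
  · have h0 := Submodule.projection_apply_of_mem_left M.isCompl hx
    have h1 : (M.part 1).projection (M.part 0) M.isCompl.symm x = 0 := by
      simpa using hx
    simp [parity, h0, h1, paritySign]
  · have h0 := Submodule.projection_apply_of_mem_left M.isCompl.symm hx
    have h1 : (M.part 0).projection (M.part 1) M.isCompl x = 0 := by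
      simpa using hx
    simp [parity, h0, h1, paritySign]

theorem parity_parity (x : M.carrier) : M.parity (M.parity x) = x := by
  obtain ⟨y, hy, z, hz, rfl⟩ := M.exists_parts x
  simp [M.parity_apply hy, M.parity_apply hz, paritySign]

theorem mem_part_iff [h2 : NeZero (2 : k)] {i : ZMod 2} {x : M.carrier} :
    x ∈ M.part i ↔ M.parity x = paritySign k i • x := by
  refine ⟨M.parity_apply, fun h => ?_⟩
  have h2' := h2.out
  obtain ⟨y, hy, z, hz, rfl⟩ := M.exists_parts x
  have hs : ∀ t : M.carrier, t + t = 0 → t = 0 := fun t ht => by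
    rw [← two_smul k] at ht
    exact (smul_eq_zero.1 ht).resolve_left h2'
  rw [map_add, M.parity_apply hy, M.parity_apply hz] at h
  rcases eq_zero_or_one i with rfl | rfl
  · have hz0 : z = 0 := by
      refine hs z ?_
      simp only [paritySign, if_true, one_ne_zero, if_false, one_smul, neg_smul] at h
      have := add_left_cancel h
      nth_rewrite 1 [← this]
      simp
    simpa [hz0] using hy
  · have hy0 : y = 0 := by
      refine hs y ?_
      simp only [paritySign, if_true, one_ne_zero, if_false, one_smul, neg_smul, neg_add] at h
      have := add_right_cancel h
      nth_rewrite 1 [this]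
      simp
    simpa [hy0] using hz

theorem parity_smul (b : L.Env) (m : M.carrier) :
    M.parity (b • m) = L.envParity b • M.parity m := by
  induction b using env_induction L generalizing m with
  | hk r => simp [algebraMap_smul]
  | hι x =>
    obtain ⟨x, hx, x', hx', rfl⟩ := L.exists_parts x
    obtain ⟨y, hy, z, hz, rfl⟩ := M.exists_parts m
    have key : ∀ {i j : ZMod 2} {x : g} {m : M.carrier}, x ∈ L.part i → m ∈ M.part j →
        M.parity (L.ι x • m) = L.ι (L.parity x) • M.parity m := by
      intro i j x m hx hm
      rw [M.parity_apply (M.smul_mem hx hm), M.parity_apply hm, L.parity_apply hx, map_smul,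
        paritySign_add, smul_assoc, smul_comm (L.ι x), smul_smul]
    simp only [map_add, add_smul, smul_add, envParity_ι, key hx hy, key hx' hy, key hx hz,
      key hx' hz]
  | hmul a b ha hb => rw [mul_smul, ha, hb, map_mul, mul_smul]
  | hadd a b ha hb => simp only [add_smul, map_add, ha, hb]

variable {M} in
theorem smul_mem_part [NeZero (2 : k)] {i j : ZMod 2} {b : L.Env} {m : M.carrier}
    (hb : b ∈ L.envPart i) (hm : m ∈ M.part j) : b • m ∈ M.part (i + j) := by
  rw [mem_part_iff] at *
  rw [parity_smul, mem_envPart.1 hb, hm, paritySign_add, smul_assoc, smul_comm b, smul_smul]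

variable {M}

theorem isGraded_iff [h2 : NeZero (2 : k)] {N : Submodule L.Env M.carrier} :
    M.IsGraded N ↔ ∀ m ∈ N, M.parity m ∈ N := by
  constructor
  · intro h m hm
    obtain ⟨y, hy, z, hz, rfl⟩ := M.exists_parts m
    obtain ⟨hy', hz'⟩ := h hy hz hm
    rw [map_add, M.parity_apply hy, M.parity_apply hz]
    exact N.add_mem (N.smul_of_tower_mem _ hy') (N.smul_of_tower_mem _ hz')
  · intro h y z hy hz hm
    have h1 := h _ hm
    rw [map_add, M.parity_apply hy, M.parity_apply hz] at h1
    simp only [paritySign, if_true, one_ne_zero, if_false, one_smul, neg_smul] at h1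
    have h3 : y ∈ N := by
      have := N.smul_of_tower_mem (2⁻¹ : k) (N.add_mem hm h1)
      have h4 : y + z + (y + -z) = (2 : k) • y := by rw [two_smul]; abel
      rwa [h4, smul_smul, inv_mul_cancel₀ h2.out, one_smul] at this
    exact ⟨h3, by simpa using N.sub_mem hm h3⟩

/-- A map is homogeneous when it commutes with the parity involutions up to a sign. -/
theorem isHomogeneousMap_iff [NeZero (2 : k)] {S : L.Supermodule} {B : Submodule L.Env M.carrier}
    {f : B →ₗ[L.Env] S.carrier} (hB : M.IsGraded B) :
    IsHomogeneousMap f ↔ ∃ ε : ZMod 2, ∀ b : B,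
      f ⟨M.parity b, isGraded_iff.1 hB b b.2⟩ = paritySign k ε • S.parity (f b) := by
  refine exists_congr fun ε => ⟨fun h b => ?_, fun h i b hb => ?_⟩
  · obtain ⟨⟨b, hb⟩, rfl⟩ : ∃ b' : B, b' = b := ⟨b, rfl⟩
    obtain ⟨y, hy, z, hz, rfl⟩ := M.exists_parts b
    obtain ⟨hy', hz'⟩ := hB hy hz hb
    have key : ∀ {i : ZMod 2} (y : B), (y : M.carrier) ∈ M.part i →
        f ⟨M.parity y, isGraded_iff.1 hB y y.2⟩ = paritySign k ε • S.parity (f y) := by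
      intro i y hy
      rw [S.parity_apply (h i y hy), smul_smul, paritySign_add, mul_comm, mul_assoc,
        paritySign_mul_self, mul_one, ← LinearMap.map_smul_of_tower]
      exact congrArg f (Subtype.ext (M.parity_apply hy))
    have h1 := key ⟨y, hy'⟩ hy
    have h2 := key ⟨z, hz'⟩ hz
    have h3 : f ⟨M.parity (y + z), isGraded_iff.1 hB _ hb⟩ =
        f ⟨M.parity y, isGraded_iff.1 hB y hy'⟩ + f ⟨M.parity z, isGraded_iff.1 hB z hz'⟩ := by
      rw [← map_add]
      exact congrArg f (Subtype.ext (map_add _ _ _))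
    have h4 : f ⟨y + z, hb⟩ = f ⟨y, hy'⟩ + f ⟨z, hz'⟩ := by
      rw [← map_add]; rfl
    rw [h3, h4, h1, h2, map_add, smul_add]
  · have h1 := h b
    have h2 : (⟨M.parity b, isGraded_iff.1 hB b b.2⟩ : B) = paritySign k i • b :=
      Subtype.ext (M.parity_apply hb)
    rw [h2, LinearMap.map_smul_of_tower] at h1
    rw [mem_part_iff, paritySign_add, mul_comm, mul_smul, h1, smul_smul, paritySign_mul_self,
      one_smul]

/-- `S` is, up to parity change, isomorphic to a subquotient of `M`. -/
def IsSubquotient (S M : L.Supermodule) : Prop :=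
  ∃ B : Submodule L.Env M.carrier, M.IsGraded B ∧
    ∃ f : B →ₗ[L.Env] S.carrier, IsHomogeneousMap f ∧ Function.Surjective f

theorem IsSubquotient.trans [NeZero (2 : k)] {S T M : L.Supermodule} (hTS : T.IsSubquotient S)
    (hSM : S.IsSubquotient M) : T.IsSubquotient M := by
  obtain ⟨C, hC, e, he, hes⟩ := hTS
  obtain ⟨B, hB, f, hf, hfs⟩ := hSM
  obtain ⟨ε, he⟩ := (isHomogeneousMap_iff hC).1 he
  obtain ⟨δ, hf⟩ := (isHomogeneousMap_iff hB).1 hf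
  let B' : Submodule L.Env M.carrier := (C.comap f).map B.subtype
  have hB'B : B' ≤ B := Submodule.map_subtype_le _ _
  have hmem : ∀ b (hb : b ∈ B), b ∈ B' ↔ f ⟨b, hb⟩ ∈ C := by
    intro b hb
    simp [B', hb]
  have hB' : M.IsGraded B' := by
    rw [isGraded_iff]
    intro m hm
    rw [hmem _ (isGraded_iff.1 hB m (hB'B hm)), hf ⟨m, hB'B hm⟩]
    exact C.smul_of_tower_mem _ (isGraded_iff.1 hC _ ((hmem m (hB'B hm)).1 hm))
  let f' : B' →ₗ[L.Env] C := (f ∘ₗ Submodule.inclusion hB'B).codRestrict C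
    fun b => (hmem b.1 (hB'B b.2)).1 b.2
  refine ⟨B', hB', e ∘ₗ f', (isHomogeneousMap_iff hB').2 ⟨ε + δ, fun b => ?_⟩,
    hes.comp fun c => ?_⟩
  · have h1 : f' ⟨M.parity b, isGraded_iff.1 hB' b b.2⟩ =
        paritySign k δ • ⟨S.parity (f' b), isGraded_iff.1 hC _ (f' b).2⟩ :=
      Subtype.ext (hf ⟨b.1, hB'B b.2⟩)
    rw [LinearMap.comp_apply, h1, LinearMap.map_smul_of_tower, he, smul_smul, mul_comm,
      paritySign_add]
    rfl
  · obtain ⟨b, hb⟩ := hfs c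
    exact ⟨⟨b, (hmem b b.2).2 (hb ▸ c.2)⟩, Subtype.ext hb⟩

end Supermodule

end RestrictedLieSuperalgebra

/-! ### Induced supermodules -/

namespace RestrictedLieSuperalgebra

variable {k : Type u} {p : ℕ} {g : Type v} [Field k] [AddCommGroup g] [Module k g]
  {L : RestrictedLieSuperalgebra k p g} {a : Submodule k g} {ha : L.IsSubalgebra a}

theorem subEnv_envParity (b : (L.sub a ha).Env) :
    L.subEnv ha ((L.sub a ha).envParity b) = L.envParity (L.subEnv ha b) := by
  induction b using env_induction with
  | hk r => simp
  | hι x =>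
    obtain ⟨x, hx, x', hx', rfl⟩ := (L.sub a ha).exists_parts x
    have key : ∀ {i : ZMod 2} {x : a}, x ∈ (L.sub a ha).part i →
        (L.sub a ha).parity x = paritySign k i • x := fun h => parity_apply _ h
    have key' : ∀ {i : ZMod 2} {x : a}, x ∈ (L.sub a ha).part i →
        L.parity (x : g) = paritySign k i • (x : g) := fun h => parity_apply _ h
    simp only [map_add, envParity_ι, subEnv_ι, key hx, key hx', map_smul, key' hx, key' hx']
  | hmul a b ha hb => simp only [map_mul, ha, hb]
  | hadd a b ha hb => simp only [map_add, ha, hb]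

namespace FreeExtension

variable (X : L.FreeExtension ha)

theorem eq_sum (A : L.Env) : A = ∑ c, X.gen c * L.subEnv ha (X.coord A c) := by
  rw [← X.coord_symm, LinearEquiv.symm_apply_apply]

theorem coord_gen_mul (c : X.index) (b : (L.sub a ha).Env) :
    X.coord (X.gen c * L.subEnv ha b) = Pi.single c b := by
  rw [← LinearEquiv.eq_symm_apply, X.coord_symm, Finset.sum_eq_single c]
  · simp
  · intro c' _ hc
    rw [Pi.single_eq_of_ne hc, map_zero, mul_zero]
  · simp

theorem coord_gen (c : X.index) : X.coord (X.gen c) = Pi.single c 1 := by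
  simpa using X.coord_gen_mul c 1

theorem coord_mul_subEnv (A : L.Env) (b : (L.sub a ha).Env) (c : X.index) :
    X.coord (A * L.subEnv ha b) c = X.coord A c * b := by
  have h : A * L.subEnv ha b = X.coord.symm (fun c => X.coord A c * b) := by
    rw [X.coord_symm]
    conv_lhs => rw [X.eq_sum A]
    simp only [Finset.sum_mul, map_mul, mul_assoc]
  rw [h, LinearEquiv.apply_symm_apply]

theorem coord_subEnv (b : (L.sub a ha).Env) : X.coord (L.subEnv ha b) = Pi.single X.one b := by
  simpa [X.gen_one] using X.coord_gen_mul X.one b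

theorem coord_mul_mul (A B : L.Env) (c : X.index) :
    X.coord (A * B) c = ∑ d, X.coord (A * X.gen d) c * X.coord B d := by
  conv_lhs => rw [X.eq_sum B]
  rw [Finset.mul_sum, map_sum, Finset.sum_apply]
  simp only [← mul_assoc, coord_mul_subEnv]

theorem coord_mem_envPart {i : ZMod 2} {A : L.Env} (hA : A ∈ L.envPart i) (c : X.index) :
    X.coord A c ∈ (L.sub a ha).envPart (i + X.par c) := by
  have h : L.envParity A = X.coord.symm
      fun c => paritySign k (X.par c) • (L.sub a ha).envParity (X.coord A c) := by
    rw [X.coord_symm]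
    conv_lhs => rw [X.eq_sum A]
    rw [map_sum]
    refine Finset.sum_congr rfl fun c _ => ?_
    rw [map_mul, mem_envPart.1 (X.gen_mem c), map_smul, subEnv_envParity, smul_mul_assoc,
      mul_smul_comm]
  rw [mem_envPart.1 hA, LinearEquiv.eq_symm_apply, map_smul] at h
  have h1 := congrFun h c
  rw [mem_envPart, paritySign_add, mul_comm, mul_smul]
  rw [Pi.smul_apply] at h1
  rw [h1, smul_smul, paritySign_mul_self, one_smul]

section Induced

variable (M : Supermodule.{u, v, w} (L.sub a ha))

/-- The action of `u(g)` on `u(g) ⊗_{u(a)} M`, identified with the functions `X.index → M`: the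
function `t` stands for `∑ c, X.gen c ⊗ t c`. -/
noncomputable instance instModuleInduced : Module L.Env (X.index → M.carrier) where
  smul A t c' := ∑ c, X.coord (A * X.gen c) c' • t c
  one_smul t := by
    funext c'
    change ∑ c, X.coord (1 * X.gen c) c' • t c = t c'
    rw [Finset.sum_eq_single c']
    · rw [one_mul, coord_gen, Pi.single_eq_same, one_smul]
    · intro c _ hc
      rw [one_mul, coord_gen, Pi.single_eq_of_ne hc.symm, zero_smul]
    · simp
  mul_smul A B t := by
    funext c'
    change ∑ c, X.coord (A * B * X.gen c) c' • t c =
      ∑ d, X.coord (A * X.gen d) c' • ∑ c, X.coord (B * X.gen c) d • t c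
    have h : ∀ c, X.coord (A * B * X.gen c) c' • t c =
        ∑ d, X.coord (A * X.gen d) c' • X.coord (B * X.gen c) d • t c := by
      intro c
      rw [mul_assoc, coord_mul_mul, Finset.sum_smul]
      exact Finset.sum_congr rfl fun d _ => mul_smul _ _ _
    rw [Finset.sum_congr rfl fun c _ => h c, Finset.sum_comm]
    exact Finset.sum_congr rfl fun d _ => Finset.smul_sum.symm
  smul_zero A := by
    funext c'
    change ∑ c, X.coord (A * X.gen c) c' • (0 : M.carrier) = 0
    simp
  zero_smul t := by
    funext c'
    change ∑ c, X.coord (0 * X.gen c) c' • t c = 0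
    simp
  smul_add A t t' := by
    funext c'
    change ∑ c, X.coord (A * X.gen c) c' • (t c + t' c) =
      ∑ c, X.coord (A * X.gen c) c' • t c + ∑ c, X.coord (A * X.gen c) c' • t' c
    simp [Finset.sum_add_distrib]
  add_smul A B t := by
    funext c'
    change ∑ c, X.coord ((A + B) * X.gen c) c' • t c =
      ∑ c, X.coord (A * X.gen c) c' • t c + ∑ c, X.coord (B * X.gen c) c' • t c
    simp [add_mul, add_smul, Finset.sum_add_distrib]

variable [NeZero (2 : k)]

/-- The induced supermodule `u(g) ⊗_{u(a)} M`. -/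
noncomputable def ind : Supermodule.{u, v, w} L where
  carrier := X.index → M.carrier
  moduleEnv := X.instModuleInduced M
  isScalarTower := by
    let _ := X.instModuleInduced M
    refine ⟨fun r A t => funext fun c' => ?_⟩
    change ∑ c, X.coord (r • A * X.gen c) c' • t c = r • ∑ c, X.coord (A * X.gen c) c' • t c
    simp [Finset.smul_sum]
  part i := Submodule.pi Set.univ fun c => M.part (i + X.par c)
  isCompl := by
    constructor
    · rw [Submodule.disjoint_def]
      intro t h0 h1
      funext c
      have h0 : t c ∈ M.part (0 + X.par c) := h0 c trivial
      have h1 : t c ∈ M.part (1 + X.par c) := h1 c trivial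
      rw [Supermodule.mem_part_iff] at h0 h1
      rw [h0, paritySign_add, paritySign_add, mul_smul, mul_smul] at h1
      simp only [paritySign, if_true, one_ne_zero, if_false, one_smul, neg_smul] at h1
      change paritySign k (X.par c) • t c = -(paritySign k (X.par c) • t c) at h1
      have h4 : (2 : k) • t c = 0 := by
        rw [← one_smul k (t c), ← paritySign_mul_self (X.par c), mul_smul, smul_comm, two_smul]
        nth_rewrite 1 [h1]
        rw [neg_add_cancel, smul_zero]
      exact (smul_eq_zero.1 h4).resolve_left (NeZero.ne 2)
    · rw [codisjoint_iff, eq_top_iff]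
      intro t _
      have h : ∀ c, ∃ y ∈ M.part (0 + X.par c), ∃ z ∈ M.part (1 + X.par c), y + z = t c := by
        intro c
        obtain ⟨y, hy, z, hz, hyz⟩ := M.exists_parts (t c)
        rcases eq_zero_or_one (X.par c) with hc | hc
        · exact ⟨y, by simpa [hc] using hy, z, by simpa [hc] using hz, hyz⟩
        · exact ⟨z, by simpa [hc] using hz, y, by simpa [hc, add_self_zmod_two] using hy,
            by rw [add_comm, hyz]⟩
      choose y hy z hz hyz using h
      exact Submodule.mem_sup.2 ⟨y, fun c _ => hy c, z, fun c _ => hz c, funext hyz⟩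
  smul_mem := by
    intro i j x t hx ht c' _
    change ∑ c, X.coord (L.ι x * X.gen c) c' • t c ∈ M.part _
    refine Submodule.sum_mem _ fun c _ => ?_
    have h := Supermodule.smul_mem_part (X.coord_mem_envPart
      (mul_mem_envPart (ι_mem_envPart hx) (X.gen_mem c)) c') (ht c trivial)
    have h1 : i + X.par c + X.par c' + (j + X.par c) = i + j + X.par c' := by
      rw [show i + X.par c + X.par c' + (j + X.par c) =
        i + j + X.par c' + (X.par c + X.par c) by ring, add_self_zmod_two, add_zero]
    rwa [h1] at h

/-- The map `m ↦ 1 ⊗ m`. -/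
noncomputable def toInd : M.carrier →ₛₗ[(L.subEnv ha).toRingHom] (X.ind M).carrier where
  toFun m := (Pi.single X.one m : X.index → M.carrier)
  map_add' m m' := Pi.single_add _ _ _
  map_smul' b m := by
    funext c'
    change (Pi.single X.one (b • m) : X.index → M.carrier) c' =
      ∑ c, X.coord (L.subEnv ha b * X.gen c) c' • (Pi.single X.one m : X.index → M.carrier) c
    rw [Finset.sum_eq_single X.one]
    · rw [X.gen_one, mul_one, coord_subEnv, Pi.single_eq_same]
      rcases eq_or_ne c' X.one with rfl | hc
      · simp
      · simp [Pi.single_eq_of_ne hc]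
    · intro c _ hc
      rw [Pi.single_eq_of_ne hc, smul_zero]
    · simp

theorem toInd_injective : Function.Injective (X.toInd M) :=
  Pi.single_injective (M := fun _ : X.index => M.carrier) X.one

theorem toInd_mem_part {i : ZMod 2} {m : M.carrier} (hm : m ∈ M.part i) :
    X.toInd M m ∈ (X.ind M).part i := by
  intro c _
  change (Pi.single X.one m : X.index → M.carrier) c ∈ M.part (i + X.par c)
  rcases eq_or_ne c X.one with rfl | hc
  · simpa [X.par_one] using hm
  · simp [Pi.single_eq_of_ne hc]

theorem ind_eq_sum (t : X.index → M.carrier) :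
    (show (X.ind M).carrier from t) = ∑ c, X.gen c • X.toInd M (t c) := by
  have h : ∀ c (m : M.carrier), X.gen c • X.toInd M m = (Pi.single c m : X.index → M.carrier) := by
    intro c m
    funext c'
    change ∑ d, X.coord (X.gen c * X.gen d) c' • (Pi.single X.one m : X.index → M.carrier) d = _
    rw [Finset.sum_eq_single X.one]
    · rw [X.gen_one, mul_one, coord_gen, Pi.single_eq_same]
      rcases eq_or_ne c' c with rfl | hc
      · simp
      · simp [Pi.single_eq_of_ne hc]
    · intro c _ hc
      rw [Pi.single_eq_of_ne hc, smul_zero]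
    · simp
  refine Eq.trans ?_ (Finset.sum_congr rfl fun c _ => (h c (t c)).symm)
  exact (Finset.univ_sum_single t).symm

theorem span_range_toInd : Submodule.span L.Env (Set.range (X.toInd M)) = ⊤ := by
  rw [eq_top_iff]
  intro t _
  have h := X.ind_eq_sum M t
  change t = _ at h
  rw [h]
  exact Submodule.sum_mem _ fun c _ => Submodule.smul_mem _ _ (Submodule.subset_span ⟨_, rfl⟩)

variable {M}

/-- Frobenius reciprocity for subquotients: a `g`-module generated by the image of an
`a`-equivariant map defined on a submodule of `M` is a subquotient of the induced module. -/
theorem isSubquotient_ind {N : Supermodule.{u, v, w} L}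
    (R : Submodule (L.sub a ha).Env M.carrier) (hR : M.IsGraded R)
    (f : R →ₛₗ[(L.subEnv ha).toRingHom] N.carrier) (ε : ZMod 2)
    (hf : ∀ (i : ZMod 2) (r : R), (r : M.carrier) ∈ M.part i → f r ∈ N.part (i + ε))
    (hspan : Submodule.span L.Env (Set.range f) = ⊤) : N.IsSubquotient (X.ind M) := by
  let B : Submodule L.Env (X.ind M).carrier :=
    { carrier := {t : X.index → M.carrier | ∀ c, t c ∈ R}
      add_mem' := fun h h' c => R.add_mem (h c) (h' c)
      zero_mem' := fun c => R.zero_mem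
      smul_mem' := fun A t ht c => Submodule.sum_mem _ fun d _ => R.smul_mem _ (ht d) }
  let F : B →ₗ[L.Env] N.carrier :=
    { toFun := fun t => ∑ c, X.gen c • f ⟨t.1 c, t.2 c⟩
      map_add' := fun t t' => by
        rw [← Finset.sum_add_distrib]
        refine Finset.sum_congr rfl fun c _ => ?_
        rw [← smul_add, ← map_add]
        rfl
      map_smul' := fun A t => by
        change ∑ c, X.gen c • f ⟨∑ d, X.coord (A * X.gen d) c • t.1 d, _⟩ =
          A • ∑ c, X.gen c • f ⟨t.1 c, t.2 c⟩
        have h : ∀ c, f ⟨∑ d, X.coord (A * X.gen d) c • t.1 d, (A • t).2 c⟩ =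
            ∑ d, L.subEnv ha (X.coord (A * X.gen d) c) • f ⟨t.1 d, t.2 d⟩ := by
          intro c
          have h1 : (⟨∑ d, X.coord (A * X.gen d) c • t.1 d, (A • t).2 c⟩ : R) =
              ∑ d, X.coord (A * X.gen d) c • (⟨t.1 d, t.2 d⟩ : R) := by
            apply Subtype.ext
            simp
          rw [h1, map_sum]
          exact Finset.sum_congr rfl fun d _ => f.map_smulₛₗ _ _
        rw [Finset.sum_congr rfl fun c _ => congrArg (X.gen c • ·) (h c)]
        simp only [Finset.smul_sum, smul_smul]
        rw [Finset.sum_comm]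
        refine Finset.sum_congr rfl fun d _ => ?_
        rw [← Finset.sum_smul, ← X.eq_sum] }
  refine ⟨B, ?_, F, ⟨ε, ?_⟩, ?_⟩
  · intro y z hy hz h
    have h' : ∀ c, y c ∈ R ∧ z c ∈ R := by
      intro c
      have hy : y c ∈ M.part (0 + X.par c) := hy c trivial
      have hz : z c ∈ M.part (1 + X.par c) := hz c trivial
      rcases eq_zero_or_one (X.par c) with hc | hc
      · rw [hc] at hy hz
        exact hR hy hz (h c)
      · rw [hc] at hy hz
        refine (hR hz hy ?_).symm
        rw [add_comm]
        exact h c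
    exact ⟨fun c => (h' c).1, fun c => (h' c).2⟩
  · intro i t ht
    refine Submodule.sum_mem _ fun c _ => ?_
    have h := Supermodule.smul_mem_part (X.gen_mem c) (hf _ ⟨t.1 c, t.2 c⟩ (ht c trivial))
    rwa [show X.par c + (i + X.par c + ε) = i + ε + (X.par c + X.par c) by ring,
      add_self_zmod_two, add_zero] at h
  · rw [← LinearMap.range_eq_top, eq_top_iff, ← hspan, Submodule.span_le]
    rintro _ ⟨r, rfl⟩
    refine ⟨⟨X.toInd M r, fun c => ?_⟩, ?_⟩
    · change (Pi.single X.one (r : M.carrier) : X.index → M.carrier) c ∈ R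
      rcases eq_or_ne c X.one with rfl | hc
      · simp
      · simp [Pi.single_eq_of_ne hc]
    · change ∑ c, X.gen c • f ⟨(Pi.single X.one (r : M.carrier) : X.index → M.carrier) c, _⟩ = _
      rw [Finset.sum_eq_single X.one]
      · rw [X.gen_one, one_smul]
        congr 1
        exact Subtype.ext (Pi.single_eq_same (M := fun _ : X.index => M.carrier) _ _)
      · intro c _ hc
        have h0 : ∀ h, f ⟨(Pi.single X.one (r : M.carrier) : X.index → M.carrier) c, h⟩ = 0 := by
          rw [Pi.single_eq_of_ne hc]
          exact fun _ => map_zero f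
        exact (congrArg (X.gen c • ·) (h0 _)).trans (smul_zero _)
      · simp

/-- Induction is exact, so it preserves subquotients. -/
theorem _root_.RestrictedLieSuperalgebra.Supermodule.IsSubquotient.ind
    {M' : Supermodule.{u, v, w} (L.sub a ha)} (h : M'.IsSubquotient M) :
    (X.ind M').IsSubquotient (X.ind M) := by
  obtain ⟨R, hR, f, ⟨ε, hf⟩, hfs⟩ := h
  refine X.isSubquotient_ind R hR ((X.toInd M').comp f) ε
    (fun i r hr => X.toInd_mem_part M' (hf i r hr)) ?_
  rw [LinearMap.coe_comp, Set.range_comp, hfs.range_eq, Set.image_univ, span_range_toInd]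

theorem finite_ind (h : Module.Finite k M.carrier) : Module.Finite k (X.ind M).carrier :=
  inferInstanceAs (Module.Finite k (X.index → M.carrier))

end Induced

end FreeExtension

end RestrictedLieSuperalgebra

/-! ### Engel's theorem for Lie superalgebras -/

namespace RestrictedLieSuperalgebra

variable {k : Type u} {p : ℕ} {g : Type v} [Field k] [AddCommGroup g] [Module k g]
  (L : RestrictedLieSuperalgebra k p g)

/-- A graded subspace closed under the bracket, all of whose even elements are killed by an
iterate of the `p`-mapping. -/
structure IsNilSubalgebra (H : Submodule k g) : Prop where
  graded : ∀ {x y : g}, x ∈ L.part 0 → y ∈ L.part 1 → x + y ∈ H → x ∈ H ∧ y ∈ H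
  bracket_mem : ∀ {x y : g}, x ∈ H → y ∈ H → L.bracket x y ∈ H
  pNilpotent : L.IsPNilpotent H

/-- A representation of the Lie superalgebra `g`, not necessarily graded. -/
def IsRep {V : Type w} [AddCommGroup V] [Module k V] (ρ : g →ₗ[k] Module.End k V) : Prop :=
  ∀ {i j : ZMod 2} {x y : g}, x ∈ L.part i → y ∈ L.part j →
    ρ x * ρ y - koszulSign k i j • (ρ y * ρ x) = ρ (L.bracket x y)

/-- In any nonzero subquotient `U / A` by `H`-stable subspaces, some nonzero vector is killed by
`H`. -/
def HasInvariants {V : Type w} [AddCommGroup V] [Module k V] (ρ : g →ₗ[k] Module.End k V)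
    (H : Submodule k g) : Prop :=
  ∀ A U : Submodule k V, A < U → (∀ x ∈ H, ∀ v ∈ A, ρ x v ∈ A) → (∀ x ∈ H, ∀ v ∈ U, ρ x v ∈ U) →
    ∃ v ∈ U, v ∉ A ∧ ∀ x ∈ H, ρ x v ∈ A

variable {L}

theorem isRep_bracket : L.IsRep L.bracket := by
  intro i j x y hx hy
  ext z
  simp [L.jacobi z hx hy]

theorem isNilpotent_bracket {H : Submodule k g} (hH : L.IsPNilpotent H) (x : L.part 0)
    (hx : (x : g) ∈ H) : IsNilpotent (L.bracket (x : g) : Module.End k g) := by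
  obtain ⟨m, hm⟩ := hH x hx
  refine ⟨p ^ m, ?_⟩
  have h : ∀ m, (L.bracket (L.pmap^[m] x : g) : Module.End k g) = L.bracket (x : g) ^ p ^ m := by
    intro m
    induction m with
    | zero => simp
    | succ m ih =>
      rw [Function.iterate_succ_apply', pow_succ, pow_mul, ← ih]
      exact LinearMap.ext fun y => L.ad_pmap _ y
  rw [← h, hm]
  simp

/-- A graded subspace is contained in `A` as soon as its homogeneous elements are. -/
theorem mem_of_mem_parts {H : Submodule k g} {A : Submodule k g}
    (hg : ∀ {x y : g}, x ∈ L.part 0 → y ∈ L.part 1 → x + y ∈ H → x ∈ H ∧ y ∈ H)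
    (h : ∀ (i : ZMod 2) (x : g), x ∈ L.part i → x ∈ H → x ∈ A) : H ≤ A := by
  intro x hx
  obtain ⟨y, hy, z, hz, rfl⟩ := L.exists_parts x
  obtain ⟨hy', hz'⟩ := hg hy hz hx
  exact A.add_mem (h 0 y hy hy') (h 1 z hz hz')

theorem IsNilSubalgebra.mono {H H' : Submodule k g} (hH : L.IsNilSubalgebra H) (h : H' ≤ H)
    (hg : ∀ {x y : g}, x ∈ L.part 0 → y ∈ L.part 1 → x + y ∈ H' → x ∈ H' ∧ y ∈ H')
    (hb : ∀ {x y : g}, x ∈ H' → y ∈ H' → L.bracket x y ∈ H') : L.IsNilSubalgebra H' :=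
  ⟨hg, hb, fun x hx => hH.pNilpotent x (h hx)⟩

theorem IsNilSubalgebra.bot : L.IsNilSubalgebra ⊥ where
  graded := by
    intro x y hx hy h
    rw [Submodule.mem_bot] at *
    have h0 : x = 0 := by
      refine Submodule.disjoint_def.1 L.isCompl.disjoint x hx ?_
      rw [eq_neg_of_add_eq_zero_left h]
      exact Submodule.neg_mem _ hy
    exact ⟨h0, by simpa [h0] using h⟩
  bracket_mem := by
    intro x y hx _
    rw [Submodule.mem_bot] at *
    simp [hx]
  pNilpotent := by
    intro x hx
    exact ⟨0, Subtype.ext hx⟩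

/-- Adjoining to `H` a homogeneous element that normalizes it. -/
theorem IsNilSubalgebra.sup_span {H K : Submodule k g} (hH : L.IsNilSubalgebra H)
    (hK : L.IsNilSubalgebra K) (hHK : H ≤ K) {i : ZMod 2} {z : g} (hz : z ∈ L.part i)
    (hzK : z ∈ K) (hzH : ∀ x ∈ H, L.bracket z x ∈ H) (hzz : L.bracket z z ∈ H) :
    L.IsNilSubalgebra (H ⊔ Submodule.span k {z}) := by
  have hHz : ∀ x ∈ H, L.bracket x z ∈ H := by
    refine mem_of_mem_parts (A := H.comap (L.bracket.flip z)) hH.graded fun j x hx hxH => ?_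
    change L.bracket x z ∈ H
    rw [L.skew hx hz]
    exact H.neg_mem (H.smul_mem _ (hzH x hxH))
  refine hK.mono (sup_le hHK ((Submodule.span_singleton_le_iff_mem _ _).2 hzK)) ?_ ?_
  · intro x y hx hy h
    obtain ⟨u, hu, w, hw, huw⟩ := Submodule.mem_sup.1 h
    obtain ⟨c, rfl⟩ := Submodule.mem_span_singleton.1 hw
    obtain ⟨u₀, hu₀, u₁, hu₁, rfl⟩ := L.exists_parts u
    obtain ⟨hu₀', hu₁'⟩ := hH.graded hu₀ hu₁ hu
    have hz' : c • z ∈ H ⊔ Submodule.span k {z} := Submodule.mem_sup_right hw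
    have hle : H ≤ H ⊔ Submodule.span k {z} := le_sup_left
    rcases eq_zero_or_one i with rfl | rfl
    · have h1 : x - (u₀ + c • z) = u₁ - y := by
        rw [sub_eq_sub_iff_add_eq_add, ← huw]; abel
      have h2 : x - (u₀ + c • z) = 0 := Submodule.disjoint_def.1 L.isCompl.disjoint _
        (sub_mem hx (add_mem hu₀ (Submodule.smul_mem _ _ hz))) (h1 ▸ sub_mem hu₁ hy)
      rw [h2] at h1
      rw [sub_eq_zero.1 h2, ← sub_eq_zero.1 h1.symm]
      exact ⟨add_mem (hle hu₀') hz', hle hu₁'⟩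
    · have h1 : x - u₀ = u₁ + c • z - y := by
        rw [sub_eq_sub_iff_add_eq_add, ← huw]; abel
      have h2 : x - u₀ = 0 := Submodule.disjoint_def.1 L.isCompl.disjoint _
        (sub_mem hx hu₀) (h1 ▸ sub_mem (add_mem hu₁ (Submodule.smul_mem _ _ hz)) hy)
      rw [h2] at h1
      rw [sub_eq_zero.1 h2, ← sub_eq_zero.1 h1.symm]
      exact ⟨hle hu₀', add_mem (hle hu₁') hz'⟩
  · intro x y hx hy
    obtain ⟨u, hu, w, hw, rfl⟩ := Submodule.mem_sup.1 hx
    obtain ⟨c, rfl⟩ := Submodule.mem_span_singleton.1 hw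
    obtain ⟨u', hu', w', hw', rfl⟩ := Submodule.mem_sup.1 hy
    obtain ⟨c', rfl⟩ := Submodule.mem_span_singleton.1 hw'
    refine Submodule.mem_sup_left ?_
    simp only [map_add, map_smul, LinearMap.add_apply, LinearMap.smul_apply]
    exact add_mem (add_mem (hH.bracket_mem hu hu') (H.smul_mem _ (hzH _ hu')))
      (H.smul_mem _ (add_mem (hHz _ hu) (H.smul_mem _ hzz)))

namespace Supermodule

variable (M : L.Supermodule)

/-- The action of `g` on a supermodule. -/
noncomputable def toEnd : g →ₗ[k] Module.End k M.carrier :=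
  (Algebra.lsmul k k M.carrier).toLinearMap ∘ₗ L.ι

theorem toEnd_apply (x : g) (m : M.carrier) : M.toEnd x m = L.ι x • m := rfl

theorem isRep_toEnd : L.IsRep M.toEnd := by
  intro i j x y hx hy
  ext m
  simp only [LinearMap.sub_apply, Module.End.mul_apply, LinearMap.smul_apply, toEnd_apply,
    ← L.ι_bracket hx hy, sub_smul, mul_smul, smul_assoc]

end Supermodule

variable [NeZero (2 : k)]

/-- A proper nil subalgebra `H` of `K` is normalized by a homogeneous element of `K` outside
`H`, whose square may be taken in `H`. -/
theorem IsNilSubalgebra.exists_normalizing {H K : Submodule k g} (hH : L.IsNilSubalgebra H)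
    (hK : L.IsNilSubalgebra K) (hHK : H < K) (had : HasInvariants L.bracket H) :
    ∃ (i : ZMod 2) (z : g), z ∈ L.part i ∧ z ∈ K ∧ z ∉ H ∧ (∀ x ∈ H, L.bracket z x ∈ H) ∧
      L.bracket z z ∈ H := by
  obtain ⟨v, hvK, hvH, hv⟩ := had H K hHK (fun x hx y hy => hH.bracket_mem hx hy)
    fun x hx y hy => hK.bracket_mem (hHK.le hx) hy
  obtain ⟨v₀, hv₀, v₁, hv₁, rfl⟩ := L.exists_parts v
  obtain ⟨hv₀K, hv₁K⟩ := hK.graded hv₀ hv₁ hvK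
  have key : ∀ x ∈ H, L.bracket v₀ x ∈ H ∧ L.bracket v₁ x ∈ H := by
    have : H ≤ H.comap (L.bracket v₀) ⊓ H.comap (L.bracket v₁) := by
      refine mem_of_mem_parts hH.graded fun j x hx hxH => ?_
      have h := hv x hxH
      rw [map_add] at h
      have h' : L.bracket x v₀ ∈ H ∧ L.bracket x v₁ ∈ H := by
        have h₀ := L.bracket_mem hx hv₀
        have h₁ := L.bracket_mem hx hv₁
        rcases eq_zero_or_one j with rfl | rfl
        · exact hH.graded h₀ h₁ h
        · rw [add_comm] at h
          exact (hH.graded h₁ h₀ h).symm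
      constructor
      · change L.bracket v₀ x ∈ H
        rw [L.skew hv₀ hx]
        exact H.neg_mem (H.smul_mem _ h'.1)
      · change L.bracket v₁ x ∈ H
        rw [L.skew hv₁ hx]
        exact H.neg_mem (H.smul_mem _ h'.2)
    exact fun x hx => this hx
  by_cases h0 : v₀ ∈ H
  · have h1 : v₁ ∉ H := fun h1 => hvH (H.add_mem h0 h1)
    by_cases hsq : L.bracket v₁ v₁ ∈ H
    · exact ⟨1, v₁, hv₁, hv₁K, h1, fun x hx => (key x hx).2, hsq⟩
    · have heven : L.bracket v₁ v₁ ∈ L.part 0 := L.bracket_mem hv₁ hv₁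
      refine ⟨0, _, heven, hK.bracket_mem hv₁K hv₁K, hsq, fun x hx => ?_, ?_⟩
      · have h2 := L.jacobi x hv₁ hv₁
        rw [← sub_eq_iff_eq_add] at h2
        rw [← h2]
        exact H.sub_mem (key _ (key x hx).2).2 (H.smul_mem _ (key _ (key x hx).2).2)
      · rw [HomBasis.bracket_self_of_even heven]
        exact H.zero_mem
  · refine ⟨0, v₀, hv₀, hv₀K, h0, fun x hx => (key x hx).1, ?_⟩
    rw [HomBasis.bracket_self_of_even hv₀]
    exact H.zero_mem

variable [Module.Finite k g] {V : Type w} [AddCommGroup V] [Module k V]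
  {ρ : g →ₗ[k] Module.End k V}

/-- The inductive step of Engel's theorem: a maximal proper nil subalgebra `K` of `H` satisfies
`H = K + k z` with `z` normalizing `K`, and `z` acts nilpotently on the `K`-invariants. -/
theorem IsNilSubalgebra.hasInvariants_of_lt {H : Submodule k g}
    (hH : L.IsNilSubalgebra H) (hρ : L.IsRep ρ)
    (hnil : ∀ x ∈ L.part 0, x ∈ H → IsNilpotent (ρ x))
    (had : ∀ K, K < H → L.IsNilSubalgebra K → HasInvariants L.bracket K)
    (hind : ∀ K, K < H → L.IsNilSubalgebra K → HasInvariants ρ K) : HasInvariants ρ H := by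
  intro A U hAU hA hU
  rcases eq_or_ne H ⊥ with rfl | hne
  · obtain ⟨v, hv, hvA⟩ := SetLike.exists_of_lt hAU
    refine ⟨v, hv, hvA, fun x hx => ?_⟩
    rw [(Submodule.mem_bot k).1 hx]
    simp
  obtain ⟨K, ⟨hKH, hK⟩, hmax⟩ := (wellFounded_gt (α := Submodule k g)).has_min
    {K | K < H ∧ L.IsNilSubalgebra K} ⟨⊥, bot_lt_iff_ne_bot.2 hne, .bot⟩
  obtain ⟨i, z, hz, hzH, hzK, hzn, hzz⟩ := hK.exists_normalizing hH hKH (had K hKH hK)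
  have hsup : K ⊔ Submodule.span k {z} = H := by
    have hle : K ⊔ Submodule.span k {z} ≤ H :=
      sup_le hKH.le ((Submodule.span_singleton_le_iff_mem _ _).2 hzH)
    rcases hle.eq_or_lt with h | h
    · exact h
    · refine absurd ?_ (hmax _ ⟨h, hK.sup_span hH hKH.le hz hzH hzn hzz⟩)
      refine lt_of_le_of_ne le_sup_left fun h' => hzK ?_
      rw [h']
      exact Submodule.mem_sup_right (Submodule.mem_span_singleton_self z)
  have hznil : IsNilpotent (ρ z) := by
    rcases eq_zero_or_one i with rfl | rfl
    · exact hnil z hz hzH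
    · have h1 := hρ hz hz
      have h2 : ρ z * ρ z = (2⁻¹ : k) • ρ (L.bracket z z) := by
        rw [← h1]
        simp only [koszulSign, and_self, if_true, neg_smul, one_smul, sub_neg_eq_add]
        rw [← two_smul k, smul_smul, inv_mul_cancel₀ (NeZero.ne (2 : k)), one_smul]
      have h3 : IsNilpotent (ρ z ^ 2) := by
        rw [pow_two, h2]
        exact (hnil _ (L.bracket_mem hz hz) (hH.bracket_mem hzH hzH)).smul _
      exact (IsNilpotent.pow_iff_pos two_ne_zero).1 h3
  obtain ⟨v, hvU, hvA, hv⟩ := hind K hKH hK A U hAU (fun x hx => hA x (hKH.le hx))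
    fun x hx => hU x (hKH.le hx)
  -- the iterates of `z` on `v` remain in `U` and are killed by `K` modulo `A`
  have hiter : ∀ n, (ρ z ^ n) v ∈ U ∧ ∀ x ∈ K, ρ x ((ρ z ^ n) v) ∈ A := by
    intro n
    induction n with
    | zero => exact ⟨hvU, hv⟩
    | succ n ih =>
      rw [pow_succ', Module.End.mul_apply]
      refine ⟨hU z hzH _ ih.1, ?_⟩
      have : K ≤ A.comap (ρ.flip (ρ z ((ρ z ^ n) v))) := by
        refine mem_of_mem_parts hK.graded fun j x hx hxK => ?_
        change ρ x (ρ z ((ρ z ^ n) v)) ∈ A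
        have h1 := LinearMap.congr_fun (hρ hz hx) ((ρ z ^ n) v)
        simp only [LinearMap.sub_apply, Module.End.mul_apply, LinearMap.smul_apply] at h1
        have h2 : koszulSign k i j • ρ x (ρ z ((ρ z ^ n) v)) ∈ A := by
          rw [← sub_sub_self (ρ z (ρ x ((ρ z ^ n) v))) (koszulSign k i j • _), h1]
          exact A.sub_mem (hA z hzH _ (ih.2 x hxK)) (ih.2 _ (hzn x hxK))
        have h3 := A.smul_mem (koszulSign k i j) h2
        rwa [smul_smul, koszulSign_mul_self, one_smul] at h3
      exact fun x hx => this hx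
  classical
  have hex : ∃ n, (ρ z ^ n) v ∈ A := by
    obtain ⟨n, hn⟩ := hznil
    exact ⟨n, by rw [hn]; exact A.zero_mem⟩
  have hpos : Nat.find hex ≠ 0 := fun h0 => hvA (by simpa [h0] using Nat.find_spec hex)
  obtain ⟨n, hn⟩ := Nat.exists_eq_succ_of_ne_zero hpos
  refine ⟨(ρ z ^ n) v, (hiter n).1, Nat.find_min hex (by omega), ?_⟩
  have hzA : ρ z ((ρ z ^ n) v) ∈ A := by
    have := Nat.find_spec hex
    rwa [hn, Nat.succ_eq_add_one, pow_succ', Module.End.mul_apply] at this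
  have hle : H ≤ A.comap (ρ.flip ((ρ z ^ n) v)) := by
    rw [← hsup, sup_le_iff, Submodule.span_singleton_le_iff_mem]
    exact ⟨(hiter n).2, hzA⟩
  exact fun x hx => hle hx

theorem IsNilSubalgebra.hasInvariants_bracket {H : Submodule k g}
    (hH : L.IsNilSubalgebra H) : HasInvariants L.bracket H := by
  induction H using (wellFounded_lt (α := Submodule k g)).induction with
  | _ H ih =>
    exact hH.hasInvariants_of_lt isRep_bracket
      (fun x hx hxH => isNilpotent_bracket hH.pNilpotent ⟨x, hx⟩ hxH) (fun K h hK => ih K h hK)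
      fun K h hK => ih K h hK

/-- The super version of Engel's theorem. -/
theorem IsNilSubalgebra.hasInvariants {H : Submodule k g}
    (hH : L.IsNilSubalgebra H) (hρ : L.IsRep ρ)
    (hnil : ∀ x ∈ L.part 0, x ∈ H → IsNilpotent (ρ x)) : HasInvariants ρ H := by
  induction H using (wellFounded_lt (α := Submodule k g)).induction with
  | _ H ih =>
    exact hH.hasInvariants_of_lt hρ hnil (fun K _ hK => hK.hasInvariants_bracket)
      fun K h hK => ih K h hK fun x hx hxK => hnil x hx (h.le hxK)

namespace Supermodule

variable (M : L.Supermodule)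

/-- Engel's theorem for supermodules. -/
theorem hasInvariants {H : Submodule k g} (hH : L.IsNilSubalgebra H) :
    HasInvariants M.toEnd H := by
  refine hH.hasInvariants M.isRep_toEnd fun x hx hxH => ?_
  obtain ⟨m, hm⟩ := hH.pNilpotent ⟨x, hx⟩ hxH
  have h : ∀ m, L.ι (L.pmap^[m] ⟨x, hx⟩ : g) = L.ι x ^ p ^ m := by
    intro m
    induction m with
    | zero => simp
    | succ m ih => rw [Function.iterate_succ_apply', pow_succ, pow_mul, ← ih, ι_pmap]
  have h1 : IsNilpotent (L.ι x) := ⟨p ^ m, by rw [← h, hm]; simp⟩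
  exact h1.map (Algebra.lsmul k k M.carrier)

end Supermodule

end RestrictedLieSuperalgebra

/-! ### Simple sections and finiteness -/

namespace RestrictedLieSuperalgebra

variable {k : Type u} {p : ℕ} {g : Type v} [Field k] [AddCommGroup g] [Module k g]
  {L : RestrictedLieSuperalgebra k p g}

namespace Supermodule

variable (M : Supermodule.{u, v, w} L)

/-- The parity involution as a semilinear map. -/
noncomputable def parityHom : M.carrier →ₛₗ[L.envParity.toRingHom] M.carrier where
  toFun := M.parity
  map_add' := map_add _
  map_smul' := M.parity_smul

/-- A `u(g)`-module with an involution compatible with the parity of `u(g)` is a supermodule. -/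
def ofInvolution [h2 : NeZero (2 : k)] (V : Type w) [AddCommGroup V] [Module k V] [Module L.Env V]
    [IsScalarTower k L.Env V] (σ : V →ₛₗ[L.envParity.toRingHom] V) (hσ : ∀ v, σ (σ v) = v) :
    Supermodule.{u, v, w} L where
  carrier := V
  part i :=
    { carrier := {v | σ v = paritySign k i • v}
      add_mem' := fun {x y} hx hy => by
        simp only [Set.mem_ofPred_eq] at *
        rw [map_add, hx, hy, smul_add]
      zero_mem' := by
        change σ 0 = _
        rw [map_zero, smul_zero]
      smul_mem' := fun c x hx => by
        simp only [Set.mem_ofPred_eq] at *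
        rw [← algebraMap_smul L.Env c x, map_smulₛₗ, hx]
        change L.envParity _ • _ = _
        rw [AlgHom.commutes, algebraMap_smul, algebraMap_smul, smul_comm] }
  isCompl := by
    have h2' := h2.out
    have hk : ∀ (c : k) (v : V), σ (c • v) = c • σ v := by
      intro c v
      rw [← algebraMap_smul L.Env c v, map_smulₛₗ]
      simp
    constructor
    · rw [Submodule.disjoint_def]
      intro v (h0 : σ v = paritySign k 0 • v) (h1 : σ v = paritySign k 1 • v)
      rw [h0] at h1
      simp only [paritySign, if_true, one_ne_zero, if_false, one_smul, neg_smul] at h1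
      have h3 : (2 : k) • v = 0 := by
        rw [two_smul]
        nth_rewrite 1 [h1]
        simp
      exact (smul_eq_zero.1 h3).resolve_left h2'
    · rw [codisjoint_iff, eq_top_iff]
      intro v _
      refine Submodule.mem_sup.2 ⟨(2⁻¹ : k) • (v + σ v), ?_, (2⁻¹ : k) • (v - σ v), ?_, ?_⟩
      · change σ _ = _
        rw [hk, map_add, hσ, add_comm]
        simp [paritySign]
      · change σ _ = _
        rw [hk, map_sub, hσ, ← neg_sub, smul_neg]
        simp only [paritySign, one_ne_zero, if_false, neg_smul, one_smul]
      · rw [← smul_add, add_add_sub_cancel, ← two_smul k, smul_smul, inv_mul_cancel₀ h2', one_smul]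
  smul_mem := by
    intro i j x m hx (hm : σ m = paritySign k j • m)
    change σ _ = _
    rw [map_smulₛₗ, hm]
    change L.envParity (L.ι x) • _ = _
    rw [mem_envPart.1 (ι_mem_envPart hx), smul_assoc, smul_comm (L.ι x), smul_smul, paritySign_add]

theorem parity_ofInvolution [NeZero (2 : k)] (V : Type w) [AddCommGroup V] [Module k V]
    [Module L.Env V] [IsScalarTower k L.Env V] (σ : V →ₛₗ[L.envParity.toRingHom] V)
    (hσ : ∀ v, σ (σ v) = v) (v : V) : (ofInvolution V σ hσ).parity v = σ v := by
  obtain ⟨y, hy, z, hz, hyz⟩ := (ofInvolution V σ hσ).exists_parts v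
  have hy' : σ y = paritySign k 0 • y := hy
  have hz' : σ z = paritySign k 1 • z := hz
  rw [← hyz, map_add, (ofInvolution V σ hσ).parity_apply hy, (ofInvolution V σ hσ).parity_apply hz]
  exact (((map_add σ y z).trans (congrArg₂ (· + ·) hy' hz'))).symm

variable {M}

theorem IsGraded.mem_of_mem_parts {N : Submodule L.Env M.carrier} (hN : M.IsGraded N)
    {m : M.carrier} (hm : m ∈ N) :
    ∃ y ∈ M.part 0, ∃ z ∈ M.part 1, y ∈ N ∧ z ∈ N ∧ y + z = m := by
  obtain ⟨y, hy, z, hz, rfl⟩ := M.exists_parts m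
  obtain ⟨hy', hz'⟩ := hN hy hz hm
  exact ⟨y, hy, z, hz, hy', hz', rfl⟩

theorem isGraded_top : M.IsGraded ⊤ := fun _ _ _ _ _ => ⟨trivial, trivial⟩

theorem exists_ne_zero_mem_part {N : Submodule L.Env M.carrier} (hN : M.IsGraded N) (h : N ≠ ⊥) :
    ∃ (i : ZMod 2) (m : M.carrier), m ∈ M.part i ∧ m ∈ N ∧ m ≠ 0 := by
  obtain ⟨m, hm, hm0⟩ := N.exists_mem_ne_zero_of_ne_bot h
  obtain ⟨y, hy, z, hz, hyN, hzN, rfl⟩ := hN.mem_of_mem_parts hm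
  by_cases h0 : y = 0
  · exact ⟨1, z, hz, hzN, fun h => hm0 (by rw [h0, h, add_zero])⟩
  · exact ⟨0, y, hy, hyN, h0⟩

section Graded

variable [NeZero (2 : k)]

theorem IsGraded.sup {N N' : Submodule L.Env M.carrier} (h : M.IsGraded N) (h' : M.IsGraded N') :
    M.IsGraded (N ⊔ N') := by
  rw [isGraded_iff] at *
  intro m hm
  obtain ⟨y, hy, z, hz, rfl⟩ := Submodule.mem_sup.1 hm
  rw [map_add]
  exact add_mem (Submodule.mem_sup_left (h y hy)) (Submodule.mem_sup_right (h' z hz))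

theorem IsGraded.inf {N N' : Submodule L.Env M.carrier} (h : M.IsGraded N) (h' : M.IsGraded N') :
    M.IsGraded (N ⊓ N') := by
  rw [isGraded_iff] at *
  exact fun m hm => ⟨h m hm.1, h' m hm.2⟩

theorem isGraded_bot : M.IsGraded ⊥ := by
  rw [isGraded_iff]
  intro m hm
  rw [(Submodule.mem_bot _).1 hm, map_zero]
  exact Submodule.zero_mem _

theorem isGraded_span_singleton {i : ZMod 2} {m : M.carrier} (hm : m ∈ M.part i) :
    M.IsGraded (Submodule.span L.Env {m}) := by
  rw [isGraded_iff]
  intro x hx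
  obtain ⟨b, rfl⟩ := Submodule.mem_span_singleton.1 hx
  rw [parity_smul, M.parity_apply hm]
  exact Submodule.smul_mem _ _
    (Submodule.smul_of_tower_mem _ _ (Submodule.mem_span_singleton_self m))

/-- In a finite-dimensional supermodule, a homogeneous vector `w` outside a graded submodule `A`
gives a nonzero vector in a simple subquotient, as a quotient of a submodule containing `A`. -/
theorem exists_isSimple_of_notMem (hM : Module.Finite k M.carrier) {A : Submodule L.Env M.carrier}
    (hA : M.IsGraded A) {i : ZMod 2} {w : M.carrier} (hw : w ∈ M.part i) (hwA : w ∉ A) :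
    ∃ S : Supermodule.{u, v, w} L, S.IsSimple ∧ ∃ B : Submodule L.Env M.carrier, M.IsGraded B ∧
      ∃ f : B →ₗ[L.Env] S.carrier,
        (∀ (i : ZMod 2) (b : B), (b : M.carrier) ∈ M.part i → f b ∈ S.part i) ∧
        Function.Surjective f ∧ (∀ b : B, (b : M.carrier) ∈ A → f b = 0) ∧ A ≤ B ∧
        ∃ hwB : w ∈ B, f ⟨w, hwB⟩ ≠ 0 := by
  have : IsNoetherian L.Env M.carrier := isNoetherian_of_tower k inferInstance
  let B : Submodule L.Env M.carrier := A ⊔ Submodule.span L.Env {w}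
  have hB : M.IsGraded B := hA.sup (isGraded_span_singleton hw)
  have hwB : w ∈ B := Submodule.mem_sup_right (Submodule.mem_span_singleton_self w)
  obtain ⟨A', ⟨hAA', hA'B, hA', hwA'⟩, hmax⟩ :=
    (wellFounded_gt (α := Submodule L.Env M.carrier)).has_min
    {C | A ≤ C ∧ C ≤ B ∧ M.IsGraded C ∧ w ∉ C} ⟨A, le_rfl, le_sup_left, hA, hwA⟩
  let A₀ : Submodule L.Env B := A'.comap B.subtype
  let σ : B →ₛₗ[L.envParity.toRingHom] B :=
    (M.parityHom.comp B.subtype).codRestrict B fun b => isGraded_iff.1 hB b b.2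
  let τ : (B ⧸ A₀) →ₛₗ[L.envParity.toRingHom] (B ⧸ A₀) :=
    A₀.mapQ A₀ σ fun b hb => isGraded_iff.1 hA' b hb
  have hτ : ∀ b, τ (A₀.mkQ b) = A₀.mkQ (σ b) := fun b => rfl
  have hττ : ∀ x, τ (τ x) = x := by
    intro x
    obtain ⟨b, rfl⟩ := A₀.mkQ_surjective x
    rw [hτ, hτ]
    exact congrArg A₀.mkQ (Subtype.ext (M.parity_parity b))
  let S : Supermodule.{u, v, w} L := ofInvolution (B ⧸ A₀) τ hττ
  let f : B →ₗ[L.Env] S.carrier := A₀.mkQ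
  have hf0 : ∀ b : B, f b = 0 ↔ (b : M.carrier) ∈ A' := fun b =>
    Submodule.Quotient.mk_eq_zero A₀
  have hfw : f ⟨w, hwB⟩ ≠ 0 := fun h => hwA' ((hf0 _).1 h)
  have hfs : Function.Surjective f := A₀.mkQ_surjective
  have hfσ : ∀ b : B, f (σ b) = S.parity (f b) := fun b =>
    (parity_ofInvolution (B ⧸ A₀) τ hττ (A₀.mkQ b)).symm
  refine ⟨S, ⟨⟨_, _, hfw⟩, fun N hN => ?_⟩, B, hB, f, fun i b hb => ?_, hfs,
    fun b hb => (hf0 b).2 (hAA' hb), le_sup_left, hwB, hfw⟩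
  · let C : Submodule L.Env M.carrier := (N.comap f).map B.subtype
    have hCB : C ≤ B := Submodule.map_subtype_le _ _
    have hmem : ∀ b : B, (b : M.carrier) ∈ C ↔ f b ∈ N := fun b => by simp [C]
    have hC : M.IsGraded C := by
      rw [isGraded_iff]
      intro m hm
      have h1 := (hmem (σ ⟨m, hCB hm⟩)).2 (by
        rw [hfσ]
        exact isGraded_iff.1 hN _ ((hmem ⟨m, hCB hm⟩).1 hm))
      exact h1
    have hA'C : A' ≤ C := fun m hm =>
      (hmem ⟨m, hA'B hm⟩).2 (((hf0 ⟨m, hA'B hm⟩).2 hm).symm ▸ N.zero_mem)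
    by_cases hwC : w ∈ C
    · right
      have hBC : B ≤ C :=
        sup_le (hAA'.trans hA'C) ((Submodule.span_singleton_le_iff_mem _ _).2 hwC)
      rw [eq_top_iff]
      intro x _
      obtain ⟨b, rfl⟩ := hfs x
      exact (hmem b).1 (hBC b.2)
    · left
      have h1 : A' = C := hA'C.eq_of_not_lt (hmax C ⟨hAA'.trans hA'C, hCB, hC, hwC⟩)
      rw [eq_bot_iff]
      intro x hx
      obtain ⟨b, rfl⟩ := hfs x
      exact (hf0 b).2 (h1 ▸ (hmem b).2 hx)
  · rw [mem_part_iff, ← hfσ, ← LinearMap.map_smul_of_tower]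
    exact congrArg f (Subtype.ext (M.parity_apply hb))

theorem IsSimple.span_eq_top (h : M.IsSimple) {i : ZMod 2} {m : M.carrier} (hm : m ∈ M.part i)
    (h0 : m ≠ 0) : Submodule.span L.Env {m} = ⊤ :=
  (h.2 _ (isGraded_span_singleton hm)).resolve_left
    fun h => h0 (Submodule.span_singleton_eq_bot.1 h)

end Graded

end Supermodule

section Finite

variable (L) [NeZero (2 : k)] [Fact p.Prime] [CharP k p] [Module.Finite k g]

theorem finite_env : Module.Finite k L.Env := by
  obtain ⟨m, n, ⟨E⟩⟩ := L.exists_homBasis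
  have := finite_isReducedWord (par := E.parity) (two_lt_of_char k p)
  exact Module.Finite.of_basis E.pbwBasis

variable {L}

theorem Supermodule.finite_of_span_eq_top {M : Supermodule.{u, v, w} L} {m : M.carrier}
    (h : Submodule.span L.Env {m} = ⊤) : Module.Finite k M.carrier := by
  have := L.finite_env
  refine Module.Finite.of_surjective
    ((LinearMap.toSpanSingleton L.Env M.carrier m).restrictScalars k) fun x => ?_
  have hx : x ∈ Submodule.span L.Env {m} := h ▸ Submodule.mem_top
  exact Submodule.mem_span_singleton.1 hx

theorem Supermodule.IsSimple.finite {M : Supermodule.{u, v, w} L} (h : M.IsSimple) :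
    Module.Finite k M.carrier := by
  have := h.1
  obtain ⟨i, m, hm, -, h0⟩ := exists_ne_zero_mem_part (M := M) isGraded_top (by
    intro h
    exact (bot_ne_top (α := Submodule L.Env M.carrier)) h.symm)
  exact finite_of_span_eq_top (h.span_eq_top hm h0)

end Finite

end RestrictedLieSuperalgebra

/-! ### Singular vectors and indecomposability -/

namespace RestrictedLieSuperalgebra

variable {k : Type u} {p : ℕ} {g : Type v} [Field k] [AddCommGroup g] [Module k g]
  {L : RestrictedLieSuperalgebra k p g}

theorem env_eq_of_even {x y : g} (hx : x ∈ L.part 0) {j : ZMod 2} (hy : y ∈ L.part j) :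
    L.ι x * L.ι y = L.ι y * L.ι x + L.ι (L.bracket x y) := by
  rw [← L.ι_bracket hx hy, koszulSign_zero_left, one_smul, add_sub_cancel]

namespace Supermodule

variable {M : Supermodule.{u, v, w} L}

/-- A subspace stable under `g` is a `u(g)`-submodule. -/
def ofStable (W : Submodule k M.carrier) (hW : ∀ x, ∀ m ∈ W, L.ι x • m ∈ W) :
    Submodule L.Env M.carrier where
  carrier := W
  add_mem' := W.add_mem
  zero_mem' := W.zero_mem
  smul_mem' := by
    intro b m hm
    induction b using env_induction L generalizing m with
    | hk r => simpa [algebraMap_smul] using W.smul_mem r hm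
    | hι x => exact hW x m hm
    | hmul a b ha hb => rw [mul_smul]; exact ha (hb hm)
    | hadd a b ha hb => rw [add_smul]; exact W.add_mem (ha hm) (hb hm)

theorem mem_ofStable {W : Submodule k M.carrier} {hW : ∀ x, ∀ m ∈ W, L.ι x • m ∈ W}
    {m : M.carrier} : m ∈ ofStable W hW ↔ m ∈ W := Iff.rfl

/-- A nonzero homogeneous vector of weight `lam` for the torus `h` that is killed by `H`. -/
structure IsSingularVector (M : Supermodule.{u, v, w} L) (H h : Submodule k g)
    (lam : Module.Dual k h) (m : M.carrier) : Prop where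
  ne_zero : m ≠ 0
  homogeneous : ∃ i, m ∈ M.part i
  smul_eq_zero : ∀ x ∈ H, L.ι x • m = 0
  weight : ∀ z : h, L.ι (z : g) • m = lam z • m

theorem exists_weight_vector [IsAlgClosed k] [hM : Module.Finite k M.carrier] {h : Submodule k g}
    (hh : L.IsTorus h) {D : Submodule k M.carrier} (hD : ∀ z ∈ h, ∀ m ∈ D, L.ι z • m ∈ D)
    (hD0 : D ≠ ⊥) : ∃ (lam : Module.Dual k h) (m : M.carrier), m ∈ D ∧ m ≠ 0 ∧
      ∀ z : h, L.ι (z : g) • m = lam z • m := by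
  -- every element of the torus is a scalar on a minimal stable subspace
  obtain ⟨W, ⟨hWD, hW0, hW⟩, hmin⟩ := (wellFounded_lt (α := Submodule k M.carrier)).has_min
    {W | W ≤ D ∧ W ≠ ⊥ ∧ ∀ z ∈ h, ∀ m ∈ W, L.ι z • m ∈ W} ⟨D, le_rfl, hD0, hD⟩
  have hscalar : ∀ z ∈ h, ∃ μ : k, ∀ m ∈ W, L.ι z • m = μ • m := by
    intro z hz
    have : Nontrivial W := Submodule.nontrivial_iff_ne_bot.2 hW0
    obtain ⟨μ, hμ⟩ := Module.End.exists_eigenvalue ((M.toEnd z).restrict (hW z hz))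
    obtain ⟨⟨m, hm⟩, hmμ⟩ := hμ.exists_hasEigenvector
    have hmμ' : L.ι z • m = μ • m := congrArg Subtype.val hmμ.apply_eq_smul
    let W' : Submodule k M.carrier := W ⊓ (M.toEnd z).eigenspace μ
    have hW' : W' = W := by
      refine inf_le_left.eq_of_not_lt (hmin W' ⟨inf_le_left.trans hWD, ?_, ?_⟩)
      · refine (Submodule.ne_bot_iff _).2 ⟨m, ⟨hm, Module.End.mem_eigenspace_iff.2 hmμ'⟩, ?_⟩
        exact fun h0 => hmμ.2 (Subtype.ext h0)
      · rintro y hy n ⟨hn, hnμ⟩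
        refine ⟨hW y hy n hn, Module.End.mem_eigenspace_iff.2 ?_⟩
        have h1 : L.ι z • n = μ • n := Module.End.mem_eigenspace_iff.1 hnμ
        change L.ι z • L.ι y • n = μ • L.ι y • n
        rw [smul_smul, env_eq_of_even (hh.le_even hz) (hh.le_even hy), hh.abelian hz hy, map_zero,
          add_zero, mul_smul, h1, smul_comm]
    exact ⟨μ, fun n hn => Module.End.mem_eigenspace_iff.1 (hW'.symm.le hn).2⟩
  obtain ⟨m, hm, hm0⟩ := W.exists_mem_ne_zero_of_ne_bot hW0
  let f : h →ₗ[k] Submodule.span k {m} :=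
    ((M.toEnd.flip m) ∘ₗ h.subtype).codRestrict _ fun z => by
      obtain ⟨μ, hμ⟩ := hscalar z z.2
      exact Submodule.mem_span_singleton.2 ⟨μ, (hμ m hm).symm⟩
  refine ⟨(LinearEquiv.coord k M.carrier m hm0).toLinearMap ∘ₗ f, m, hWD hm, hm0, fun z => ?_⟩
  exact (LinearEquiv.coord_apply_smul k M.carrier m hm0 (f z)).symm

/-- The weights that occur in `u(g)`-modules are restricted. -/
theorem mem_restrictedWeights {h : Submodule k g} {lam : Module.Dual k h} {m : M.carrier}
    (hm0 : m ≠ 0) (hm : ∀ z : h, L.ι (z : g) • m = lam z • m) : lam ∈ L.restrictedWeights h := by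
  intro x hx hx'
  have h1 : ∀ n : ℕ, L.ι (x : g) ^ n • m = lam ⟨x, hx⟩ ^ n • m := by
    intro n
    induction n with
    | zero => simp
    | succ n ih => rw [pow_succ, mul_smul, hm ⟨x, hx⟩, smul_comm, ih, smul_smul, ← pow_succ']
  have h2 := h1 p
  rw [L.ι_pmap, hm ⟨_, hx'⟩] at h2
  exact smul_left_injective k hm0 h2

/-- If `M` is generated by an eigenvector `v` of `b` and `g = b + H`, then `M = k v + H M`. -/
theorem span_sup_map₂_eq_top {b H : Submodule k g}
    (hb : ∀ {x y : g}, x ∈ L.part 0 → y ∈ L.part 1 → x + y ∈ b → x ∈ b ∧ y ∈ b)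
    (hH : ∀ {x y : g}, x ∈ L.part 0 → y ∈ L.part 1 → x + y ∈ H → x ∈ H ∧ y ∈ H)
    (hbH : b ⊔ H = ⊤) {v : M.carrier} (hv : ∀ x ∈ b, L.ι x • v ∈ Submodule.span k {v})
    (hspan : Submodule.span L.Env {v} = ⊤) :
    Submodule.span k {v} ⊔ Submodule.map₂ M.toEnd H ⊤ = ⊤ := by
  obtain ⟨F, hF0, hF⟩ : ∃ F : ℕ → Submodule k M.carrier, F 0 = Submodule.span k {v} ∧
      ∀ n, F (n + 1) = Submodule.span k {v} ⊔ Submodule.map₂ M.toEnd H (F n) :=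
    ⟨fun n => Nat.rec (Submodule.span k {v})
      (fun _ W => Submodule.span k {v} ⊔ Submodule.map₂ M.toEnd H W) n, rfl, fun _ => rfl⟩
  have hmono : ∀ n, F n ≤ F (n + 1) := by
    intro n
    induction n with
    | zero => rw [hF, hF0]; exact le_sup_left
    | succ n ih =>
      rw [hF, hF (n + 1)]
      exact sup_le_sup_left (Submodule.map₂_le_map₂_right ih) _
  have hHF : ∀ n, ∀ x ∈ H, ∀ m ∈ F n, L.ι x • m ∈ F (n + 1) := fun n x hx m hm => by
    rw [hF]
    exact Submodule.mem_sup_right (Submodule.apply_mem_map₂ M.toEnd hx hm)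
  have hgF : ∀ n, ∀ x : g, ∀ m ∈ F n, L.ι x • m ∈ F (n + 1) := by
    intro n
    induction n with
    | zero =>
      intro x
      suffices h : (⊤ : Submodule k g) ≤ (F 1).comap (M.toEnd.flip v) by
        intro m hm
        rw [hF0] at hm
        obtain ⟨c, rfl⟩ := Submodule.mem_span_singleton.1 hm
        rw [smul_comm]
        exact Submodule.smul_mem _ _ (h (Submodule.mem_top (x := x)))
      rw [← hbH, sup_le_iff]
      exact ⟨fun x hx => hmono 0 (hF0.symm ▸ hv x hx),
        fun x hx => hHF 0 x hx v (hF0.symm ▸ Submodule.mem_span_singleton_self v)⟩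
    | succ n ih =>
      suffices h : (⊤ : Submodule k g) ≤ ⨅ m : F (n + 1), (F (n + 2)).comap (M.toEnd.flip m) by
        intro x m hm
        exact (Submodule.mem_iInf _).1 (h (Submodule.mem_top (x := x))) ⟨m, hm⟩
      rw [← hbH, sup_le_iff]
      constructor
      · refine RestrictedLieSuperalgebra.mem_of_mem_parts hb fun i x hx hxb => ?_
        rw [Submodule.mem_iInf]
        rintro ⟨m, hm⟩
        change L.ι x • m ∈ F (n + 2)
        suffices h : F (n + 1) ≤ (F (n + 2)).comap (M.toEnd x) from h hm
        rw [hF, sup_le_iff, Submodule.span_singleton_le_iff_mem, Submodule.map₂_le]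
        refine ⟨?_, fun y hy m hm => ?_⟩
        · change L.ι x • v ∈ F (n + 2)
          rw [hF]
          exact Submodule.mem_sup_left (hv x hxb)
        suffices h : H ≤ (F (n + 2)).comap ((M.toEnd x) ∘ₗ (M.toEnd.flip m)) from h hy
        refine RestrictedLieSuperalgebra.mem_of_mem_parts hH fun j y hy hyH => ?_
        change L.ι x • L.ι y • m ∈ F (n + 2)
        have h1 : L.ι x * L.ι y = koszulSign k i j • (L.ι y * L.ι x) + L.ι (L.bracket x y) := by
          rw [← L.ι_bracket hx hy, add_sub_cancel]
        rw [smul_smul, h1, add_smul, smul_assoc, mul_smul]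
        exact add_mem (Submodule.smul_mem _ _ (hHF _ y hyH _ (ih x m hm))) (hmono _ (ih _ m hm))
      · intro x hx
        rw [Submodule.mem_iInf]
        exact fun m => hHF _ x hx m m.2
  have hmono' : Monotone F := monotone_nat_of_le_succ hmono
  have hmem : ∀ {m}, m ∈ ⨆ n, F n ↔ ∃ n, m ∈ F n :=
    Submodule.mem_iSup_of_directed F hmono'.directed_le
  have htop : ofStable (⨆ n, F n) (fun x m hm => by
      obtain ⟨n, hn⟩ := hmem.1 hm
      exact hmem.2 ⟨n + 1, hgF n x m hn⟩) = ⊤ := by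
    rw [eq_top_iff, ← hspan, Submodule.span_singleton_le_iff_mem]
    exact hmem.2 ⟨0, hF0.symm ▸ Submodule.mem_span_singleton_self v⟩
  rw [eq_top_iff]
  intro m _
  obtain ⟨n, hn⟩ := hmem.1 (mem_ofStable.1 (htop.symm ▸ Submodule.mem_top : m ∈ ofStable _ _))
  have hn' := hmono n hn
  rw [hF] at hn'
  exact sup_le_sup le_rfl (Submodule.map₂_le_map₂_right (f := M.toEnd) le_top) hn'

variable [NeZero (2 : k)] [Module.Finite k g]

/-- Every nonzero finite-dimensional supermodule has a singular vector. -/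
theorem exists_isSingularVector [IsAlgClosed k] [Module.Finite k M.carrier]
    [Nontrivial M.carrier] {H h : Submodule k g} (hH : L.IsNilSubalgebra H) (hh : L.IsTorus h)
    (hhH : ∀ z ∈ h, ∀ x ∈ H, L.bracket z x ∈ H) :
    ∃ lam ∈ L.restrictedWeights h, ∃ m, M.IsSingularVector H h lam m := by
  let C : Submodule k M.carrier := ⨅ x : H, LinearMap.ker (M.toEnd x)
  have hC : ∀ m, m ∈ C ↔ ∀ x ∈ H, L.ι x • m = 0 := by
    intro m
    simp [C, toEnd_apply]
  have hCpar : ∀ m ∈ C, M.parity m ∈ C := by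
    intro m hm
    rw [hC] at *
    have : H ≤ LinearMap.ker (M.toEnd.flip (M.parity m)) := by
      refine RestrictedLieSuperalgebra.mem_of_mem_parts hH.graded fun i x hx hxH => ?_
      have h1 := M.parity_smul (L.ι x) m
      rw [hm x hxH, map_zero, mem_envPart.1 (ι_mem_envPart hx), smul_assoc] at h1
      change L.ι x • M.parity m = 0
      rw [← one_smul k (L.ι x • M.parity m), ← paritySign_mul_self i, mul_smul, ← h1, smul_zero]
    exact fun x hx => this hx
  obtain ⟨m, -, hm0, hm⟩ := M.hasInvariants hH ⊥ ⊤ bot_lt_top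
    (fun x _ v hv => by rw [(Submodule.mem_bot k).1 hv]; simp) fun _ _ _ _ => trivial
  rw [Submodule.mem_bot] at hm0
  have hmC : m ∈ C := (hC m).2 fun x hx => (Submodule.mem_bot k).1 (hm x hx)
  have hex : ∃ i, C ⊓ M.part i ≠ ⊥ := by
    by_contra! hcon
    obtain ⟨y, hy, z, hz, rfl⟩ := M.exists_parts m
    have h1 := hCpar _ hmC
    rw [map_add, M.parity_apply hy, M.parity_apply hz] at h1
    simp only [paritySign, if_true, one_ne_zero, if_false, one_smul, neg_smul] at h1
    have hyC : y ∈ C := by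
      have h3 := C.smul_mem (2⁻¹ : k) (add_mem hmC h1)
      have h4 : y + z + (y + -z) = (2 : k) • y := by rw [two_smul]; abel
      rwa [h4, smul_smul, inv_mul_cancel₀ (NeZero.ne (2 : k)), one_smul] at h3
    have hzC : z ∈ C := by simpa using sub_mem hmC hyC
    have hy0 : y = 0 := (Submodule.mem_bot k).1 (hcon 0 ▸ ⟨hyC, hy⟩)
    have hz0 : z = 0 := (Submodule.mem_bot k).1 (hcon 1 ▸ ⟨hzC, hz⟩)
    exact hm0 (by rw [hy0, hz0, add_zero])
  obtain ⟨i, hi⟩ := hex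
  obtain ⟨lam, v, hv, hv0, hlam⟩ := exists_weight_vector hh (D := C ⊓ M.part i) (by
    rintro z hz m ⟨hm, hmi⟩
    refine ⟨(hC _).2 ?_, by simpa using M.smul_mem (hh.le_even hz) hmi⟩
    have : H ≤ LinearMap.ker (M.toEnd.flip (L.ι z • m)) := by
      refine RestrictedLieSuperalgebra.mem_of_mem_parts hH.graded fun i x hx hxH => ?_
      change L.ι x • L.ι z • m = 0
      have h1 := congrArg (· • m) (env_eq_of_even (hh.le_even hz) hx)
      simp only [mul_smul, add_smul, (hC m).1 hm x hxH, smul_zero,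
        (hC m).1 hm _ (hhH z hz x hxH), add_zero] at h1
      exact h1.symm
    exact fun x hx => this hx) hi
  exact ⟨lam, mem_restrictedWeights hv0 hlam, v, hv0, ⟨i, hv.2⟩, (hC v).1 hv.1, hlam⟩

/-- A proper `H`-stable subspace does not become everything after adding `H M`. -/
theorem exists_lt_top_of_stable [Module.Finite k M.carrier] {H : Submodule k g}
    (hH : L.IsNilSubalgebra H) {N : Submodule k M.carrier} (hN : N < ⊤)
    (hNH : ∀ x ∈ H, ∀ m ∈ N, L.ι x • m ∈ N) :
    ∃ A < ⊤, N ≤ A ∧ Submodule.map₂ M.toEnd H ⊤ ≤ A := by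
  obtain ⟨A, ⟨hA, hNA, hAH⟩, hmax⟩ := (wellFounded_gt (α := Submodule k M.carrier)).has_min
    {A | A < ⊤ ∧ N ≤ A ∧ ∀ x ∈ H, ∀ m ∈ A, L.ι x • m ∈ A} ⟨N, hN, le_rfl, hNH⟩
  obtain ⟨v, -, hvA, hv⟩ := M.hasInvariants hH A ⊤ hA hAH fun _ _ _ _ => trivial
  refine ⟨A, hA, hNA, Submodule.map₂_le.2 fun x hx m _ => ?_⟩
  have hlt : A < A ⊔ Submodule.span k {v} := by
    refine lt_of_le_of_ne le_sup_left fun h' => hvA ?_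
    rw [h']
    exact Submodule.mem_sup_right (Submodule.mem_span_singleton_self v)
  have hsm : ∀ x ∈ H, ∀ m ∈ A ⊔ Submodule.span k {v}, L.ι x • m ∈ A := by
    intro x hx
    have : A ⊔ Submodule.span k {v} ≤ A.comap (M.toEnd x) := by
      rw [sup_le_iff, Submodule.span_singleton_le_iff_mem]
      exact ⟨fun m hm => hAH x hx m hm, hv x hx⟩
    exact fun m hm => this hm
  have htop : A ⊔ Submodule.span k {v} = ⊤ := by
    by_contra hne
    exact hmax _ ⟨lt_top_iff_ne_top.2 hne, hNA.trans le_sup_left,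
      fun x hx m hm => Submodule.mem_sup_left (hsm x hx m hm)⟩ hlt
  exact hsm x hx m (htop ▸ Submodule.mem_top)

/-- A finite-dimensional module generated by an eigenvector of `b`, where `g = b + H`, has a
unique maximal `H`-stable subspace, and hence is indecomposable. -/
theorem isIndecomposable_of_span_eq_top [Module.Finite k M.carrier] {b H : Submodule k g}
    (hb : ∀ {x y : g}, x ∈ L.part 0 → y ∈ L.part 1 → x + y ∈ b → x ∈ b ∧ y ∈ b)
    (hH : L.IsNilSubalgebra H)
    (hbH : b ⊔ H = ⊤) {v : M.carrier} (hv : ∀ x ∈ b, L.ι x • v ∈ Submodule.span k {v})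
    (hspan : Submodule.span L.Env {v} = ⊤) (hnt : Nontrivial M.carrier) :
    M.IsIndecomposable := by
  have htop := span_sup_map₂_eq_top hb hH.graded hbH hv hspan
  refine ⟨hnt, fun N N' _ _ hc => ?_⟩
  by_contra! hne
  have hle : ∀ N : Submodule L.Env M.carrier, N ≠ ⊤ →
      N.restrictScalars k ≤ Submodule.map₂ M.toEnd H ⊤ ∧ Submodule.map₂ M.toEnd H ⊤ < ⊤ := by
    intro N hN
    obtain ⟨A, hA, hNA, hHA⟩ := exists_lt_top_of_stable hH (N := N.restrictScalars k)
      (lt_top_iff_ne_top.2 fun h => hN (Submodule.restrictScalars_injective k _ _ h))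
      fun x _ m hm => N.smul_mem _ hm
    refine ⟨fun m hm => ?_, hHA.trans_lt hA⟩
    obtain ⟨w, hw, y, hy, rfl⟩ := Submodule.mem_sup.1 (htop ▸ Submodule.mem_top (x := m))
    obtain ⟨c, rfl⟩ := Submodule.mem_span_singleton.1 hw
    have h1 : c • v ∈ A := by simpa using sub_mem (hNA hm) (hHA hy)
    by_cases hc0 : c = 0
    · simpa [hc0] using hy
    · refine absurd ?_ hA.ne
      rw [eq_top_iff, ← htop, sup_le_iff, Submodule.span_singleton_le_iff_mem]
      refine ⟨?_, hHA⟩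
      have h2 := A.smul_mem c⁻¹ h1
      rwa [smul_smul, inv_mul_cancel₀ hc0, one_smul] at h2
  have h1 : N ≠ ⊤ := by
    rintro rfl
    exact hne.2 (by simpa using hc.inf_eq_bot)
  have h2 : N' ≠ ⊤ := by
    rintro rfl
    exact hne.1 (by simpa using hc.inf_eq_bot)
  refine (hle N h1).2.ne (eq_top_iff.2 ?_)
  intro m _
  obtain ⟨y, hy, z, hz, rfl⟩ := Submodule.mem_sup.1 (hc.sup_eq_top ▸ Submodule.mem_top (x := m))
  exact add_mem ((hle N h1).1 hy) ((hle N' h2).1 hz)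

end Supermodule

end RestrictedLieSuperalgebra

/-! ### Characters of the halves of a triangular decomposition -/

namespace RestrictedLieSuperalgebra

variable {k : Type u} {p : ℕ} {g : Type v} [Field k] [AddCommGroup g] [Module k g]
  {L : RestrictedLieSuperalgebra k p g}

theorem eq_zero_of_mem_parts {x : g} (h0 : x ∈ L.part 0) (h1 : x ∈ L.part 1) : x = 0 :=
  Submodule.disjoint_def.1 L.isCompl.disjoint x h0 h1

/-- The sum of an even and an odd subspace is graded. -/
theorem mem_of_add_mem_sup {n o : Submodule k g} (hn : n ≤ L.part 0) (ho : o ≤ L.part 1) {x y : g}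
    (hx : x ∈ L.part 0) (hy : y ∈ L.part 1) (h : x + y ∈ o ⊔ n) : x ∈ n ∧ y ∈ o := by
  obtain ⟨y', hy', x', hx', hxy⟩ := Submodule.mem_sup.1 h
  have h1 : x - x' = y' - y := by rw [sub_eq_sub_iff_add_eq_add, ← hxy]
  have h2 : x - x' = 0 := eq_zero_of_mem_parts (sub_mem hx (hn hx')) (h1 ▸ sub_mem (ho hy') hy)
  rw [h2] at h1
  rw [sub_eq_zero.1 h2, ← sub_eq_zero.1 h1.symm]
  exact ⟨hx', hy'⟩

theorem jacobsonCoeff_mem_of_stable {n : Submodule k g} {x y : g} (hx : x ∈ n)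
    (hxn : ∀ z ∈ n, L.bracket x z ∈ n) (hyn : ∀ z ∈ n, L.bracket y z ∈ n) (i j : ℕ) :
    jacobsonCoeff L.bracket x y i j ∈ n := by
  induction i generalizing j with
  | zero => cases j <;> simp [jacobsonCoeff, hx]
  | succ i ih =>
    cases j with
    | zero => exact hyn _ (ih _)
    | succ j => exact add_mem (hyn _ (ih _)) (hxn _ (ih _))

theorem IsSubalgebra.comap {a b : Submodule k g} (ha : L.IsSubalgebra a) (hb : L.IsSubalgebra b) :
    (L.sub b hb).IsSubalgebra (a.comap b.subtype) where
  graded hx hy h := ha.graded (x := (_ : b).1) (y := (_ : b).1) hx hy h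
  bracket_mem hx hy := ha.bracket_mem hx hy
  pmap_mem x hx := ha.pmap_mem ⟨x.1.1, x.2⟩ hx

namespace IsNilpotentHalf

variable {h n o : Submodule k g}

theorem mem_parts_of_add_mem (N : L.IsNilpotentHalf h n o) (hh : L.IsTorus h) {x y : g}
    (hx : x ∈ L.part 0) (hy : y ∈ L.part 1) (hxy : x + y ∈ o ⊔ n ⊔ h) : x ∈ n ⊔ h ∧ y ∈ o := by
  rw [sup_assoc] at hxy
  exact mem_of_add_mem_sup (sup_le N.even hh.le_even) N.odd hx hy hxy

theorem mem_of_mem_part_zero (N : L.IsNilpotentHalf h n o) (hh : L.IsTorus h) {x : g}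
    (hx : x ∈ L.part 0) (hxa : x ∈ o ⊔ n ⊔ h) : x ∈ n ⊔ h :=
  (N.mem_parts_of_add_mem hh hx (L.part 1).zero_mem (by rwa [add_zero])).1

theorem mem_of_mem_part_one (N : L.IsNilpotentHalf h n o) (hh : L.IsTorus h) {x : g}
    (hx : x ∈ L.part 1) (hxa : x ∈ o ⊔ n ⊔ h) : x ∈ o :=
  (N.mem_parts_of_add_mem hh (L.part 0).zero_mem hx (by rwa [zero_add])).2

theorem bracket_even (N : L.IsNilpotentHalf h n o) (hh : L.IsTorus h) {x y : g}
    (hx : x ∈ n ⊔ h) (hy : y ∈ n ⊔ h) : L.bracket x y ∈ n := by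
  obtain ⟨x, hx', s, hs, rfl⟩ := Submodule.mem_sup.1 hx
  obtain ⟨y, hy', t, ht, rfl⟩ := Submodule.mem_sup.1 hy
  simp only [map_add, LinearMap.add_apply, hh.abelian hs ht, add_zero]
  refine add_mem (add_mem (N.even_even hx' hy') (N.torus_even hs hy')) ?_
  rw [L.skew (N.even hx') (hh.le_even ht)]
  exact neg_mem (Submodule.smul_mem _ _ (N.torus_even ht hx'))

theorem bracket_even_odd (N : L.IsNilpotentHalf h n o) {x y : g} (hx : x ∈ n ⊔ h) (hy : y ∈ o) :
    L.bracket x y ∈ o := by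
  obtain ⟨x, hx', s, hs, rfl⟩ := Submodule.mem_sup.1 hx
  simp only [map_add, LinearMap.add_apply]
  exact add_mem (N.even_odd hx' hy) (N.torus_odd hs hy)

theorem bracket_odd_even (N : L.IsNilpotentHalf h n o) (hh : L.IsTorus h) {x y : g}
    (hx : x ∈ o) (hy : y ∈ n ⊔ h) : L.bracket x y ∈ o := by
  rw [L.skew (N.odd hx) (sup_le N.even hh.le_even hy)]
  exact neg_mem (Submodule.smul_mem _ _ (N.bracket_even_odd hy hx))

/-- Modulo `n`, the `p`-mapping is additive on `n + h`. -/
theorem pmap_add_sub_mem (N : L.IsNilpotentHalf h n o) {x z : L.part 0} (hx : (x : g) ∈ n)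
    (hz : (z : g) ∈ h) :
    (L.pmap (x + z) : g) - L.pmap z ∈ n := by
  rw [L.pmap_add, add_right_comm, add_sub_cancel_right]
  refine add_mem (N.pmap_mem x hx) (Submodule.sum_mem _ fun i _ => Submodule.smul_mem _ _ ?_)
  exact jacobsonCoeff_mem_of_stable hx (fun y hy => N.even_even hx hy)
    (fun y hy => N.torus_even hz hy) _ _

theorem isSubalgebra (N : L.IsNilpotentHalf h n o) (hh : L.IsTorus h) :
    L.IsSubalgebra (o ⊔ n ⊔ h) where
  graded hx hy hxy := by
    obtain ⟨h1, h2⟩ := N.mem_parts_of_add_mem hh hx hy hxy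
    exact ⟨sup_le_sup_right le_sup_right h h1, Submodule.mem_sup_left (Submodule.mem_sup_left h2)⟩
  bracket_mem := by
    intro x y hx hy
    rw [sup_assoc] at *
    obtain ⟨x₁, hx₁, x₀, hx₀, rfl⟩ := Submodule.mem_sup.1 hx
    obtain ⟨y₁, hy₁, y₀, hy₀, rfl⟩ := Submodule.mem_sup.1 hy
    simp only [map_add, LinearMap.add_apply]
    refine add_mem (add_mem ?_ ?_) (add_mem ?_ ?_)
    · exact Submodule.mem_sup_right (Submodule.mem_sup_left (N.odd_odd hx₁ hy₁))
    · exact Submodule.mem_sup_left (N.bracket_even_odd hx₀ hy₁)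
    · exact Submodule.mem_sup_left (N.bracket_odd_even hh hx₁ hy₀)
    · exact Submodule.mem_sup_right (Submodule.mem_sup_left (N.bracket_even hh hx₀ hy₀))
  pmap_mem := by
    intro x hx
    obtain ⟨y, hy, z, hz, hyz⟩ := Submodule.mem_sup.1 (N.mem_of_mem_part_zero hh x.2 hx)
    have hx' : x = ⟨y, N.even hy⟩ + ⟨z, hh.le_even hz⟩ := Subtype.ext hyz.symm
    have h1 := N.pmap_add_sub_mem (x := ⟨y, N.even hy⟩) (z := ⟨z, hh.le_even hz⟩) hy hz
    rw [← hx'] at h1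
    rw [← sub_add_cancel (L.pmap x : g) (L.pmap ⟨z, hh.le_even hz⟩)]
    exact add_mem (Submodule.mem_sup_left (Submodule.mem_sup_right h1))
      (Submodule.mem_sup_right (hh.pmap_mem _ hz))

theorem isNilSubalgebra (N : L.IsNilpotentHalf h n o) : L.IsNilSubalgebra (o ⊔ n) where
  graded hx hy hxy := by
    obtain ⟨h1, h2⟩ := mem_of_add_mem_sup N.even N.odd hx hy hxy
    exact ⟨Submodule.mem_sup_right h1, Submodule.mem_sup_left h2⟩
  bracket_mem := by
    intro x y hx hy
    obtain ⟨x₁, hx₁, x₀, hx₀, rfl⟩ := Submodule.mem_sup.1 hx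
    obtain ⟨y₁, hy₁, y₀, hy₀, rfl⟩ := Submodule.mem_sup.1 hy
    simp only [map_add, LinearMap.add_apply]
    refine add_mem (add_mem ?_ ?_) (add_mem ?_ ?_)
    · exact Submodule.mem_sup_right (N.odd_odd hx₁ hy₁)
    · exact Submodule.mem_sup_left (N.even_odd hx₀ hy₁)
    · refine Submodule.mem_sup_left ?_
      rw [L.skew (N.odd hx₁) (N.even hy₀)]
      exact neg_mem (Submodule.smul_mem _ _ (N.even_odd hy₀ hx₁))
    · exact Submodule.mem_sup_right (N.even_even hx₀ hy₀)
  pNilpotent := by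
    intro x hx
    refine N.pNilpotent x ?_
    exact (mem_of_add_mem_sup N.even N.odd x.2 (L.part 1).zero_mem (by rwa [add_zero])).1

theorem bracket_torus_mem (N : L.IsNilpotentHalf h n o) :
    ∀ z ∈ h, ∀ x ∈ o ⊔ n, L.bracket z x ∈ o ⊔ n := by
  intro z hz x hx
  obtain ⟨y, hy, x, hx', rfl⟩ := Submodule.mem_sup.1 hx
  rw [map_add]
  exact add_mem (Submodule.mem_sup_left (N.torus_odd hz hy))
    (Submodule.mem_sup_right (N.torus_even hz hx'))

/-- A weight extends by zero on `o + n`. -/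
theorem exists_functional (N : L.IsNilpotentHalf h n o) (hh : L.IsTorus h) (hd : Disjoint n h)
    (lam : Module.Dual k h) :
    ∃ φ : g →ₗ[k] k, (∀ z : h, φ z = lam z) ∧ ∀ x ∈ o ⊔ n, φ x = 0 := by
  have hdis : Disjoint (o ⊔ n) h := by
    rw [Submodule.disjoint_def]
    intro x hx hxh
    have h1 := (mem_of_add_mem_sup N.even N.odd (hh.le_even hxh) (L.part 1).zero_mem
      (by rwa [add_zero])).1
    exact Submodule.disjoint_def.1 hd x h1 hxh
  obtain ⟨c, hle, hc⟩ := hdis.exists_isCompl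
  refine ⟨LinearMap.ofIsCompl hc 0 lam, fun z => LinearMap.ofIsCompl_apply_right hc z, ?_⟩
  exact fun x hx => LinearMap.ofIsCompl_apply_left hc ⟨x, hle hx⟩

/-- The character of `u(o + n + h)` given by a restricted weight of `h`. -/
theorem exists_character (N : L.IsNilpotentHalf h n o) (hh : L.IsTorus h) (hd : Disjoint n h)
    {lam : Module.Dual k h} (hlam : lam ∈ L.restrictedWeights h) {b : Submodule k g}
    (hb : L.IsSubalgebra b) (ha : (L.sub b hb).IsSubalgebra ((o ⊔ n ⊔ h).comap b.subtype))
    [Fact p.Prime] :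
    ∃ χ : ((L.sub b hb).sub _ ha).Env →ₐ[k] k,
      (∀ x : (o ⊔ n ⊔ h).comap b.subtype, (x : g) ∈ o ⊔ n →
        χ (((L.sub b hb).sub _ ha).ι x) = 0) ∧
      ∀ (x : (o ⊔ n ⊔ h).comap b.subtype) (hx : (x : g) ∈ h),
        χ (((L.sub b hb).sub _ ha).ι x) = lam ⟨x, hx⟩ := by
  obtain ⟨φ, hφh, hφ⟩ := N.exists_functional hh hd lam
  have hφn : ∀ x ∈ n, φ x = 0 := fun x hx => hφ x (Submodule.mem_sup_right hx)
  have hφo : ∀ x ∈ o, φ x = 0 := fun x hx => hφ x (Submodule.mem_sup_left hx)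
  let f : (o ⊔ n ⊔ h).comap b.subtype →ₗ[k] k := φ ∘ₗ b.subtype ∘ₗ Submodule.subtype _
  refine ⟨((L.sub b hb).sub _ ha).lift f ?_ ?_, ?_, ?_⟩
  · intro i j x y (hx : (x : g) ∈ L.part i) (hy : (y : g) ∈ L.part j)
    have hxa : (x : g) ∈ o ⊔ n ⊔ h := x.2
    have hya : (y : g) ∈ o ⊔ n ⊔ h := y.2
    change φ (x : g) * φ (y : g) - koszulSign k i j • (φ (y : g) * φ (x : g)) =
      φ (L.bracket (x : g) (y : g))
    rcases eq_zero_or_one i with rfl | rfl <;> rcases eq_zero_or_one j with rfl | rfl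
    · rw [hφn _ (N.bracket_even hh (N.mem_of_mem_part_zero hh hx hxa)
        (N.mem_of_mem_part_zero hh hy hya)), koszulSign_zero_left, one_smul, mul_comm, sub_self]
    · have hy' := N.mem_of_mem_part_one hh hy hya
      rw [hφo _ (N.bracket_even_odd (N.mem_of_mem_part_zero hh hx hxa) hy'), hφo _ hy']
      simp
    · have hx' := N.mem_of_mem_part_one hh hx hxa
      rw [hφo _ (N.bracket_odd_even hh hx' (N.mem_of_mem_part_zero hh hy hya)), hφo _ hx']
      simp
    · have hx' := N.mem_of_mem_part_one hh hx hxa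
      have hy' := N.mem_of_mem_part_one hh hy hya
      rw [hφn _ (N.odd_odd hx' hy'), hφo _ hx']
      simp
  · intro x
    have hxe : ((x : (o ⊔ n ⊔ h).comap b.subtype) : g) ∈ L.part 0 := x.2
    obtain ⟨y, hy, z, hz, hyz⟩ := Submodule.mem_sup.1
      (N.mem_of_mem_part_zero hh hxe (x : (o ⊔ n ⊔ h).comap b.subtype).2)
    have hx' : (⟨_, hxe⟩ : L.part 0) = ⟨y, N.even hy⟩ + ⟨z, hh.le_even hz⟩ :=
      Subtype.ext hyz.symm
    have h1 := N.pmap_add_sub_mem (x := ⟨y, N.even hy⟩) (z := ⟨z, hh.le_even hz⟩) hy hz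
    rw [← hx'] at h1
    have h2 := hφn _ h1
    rw [map_sub, sub_eq_zero] at h2
    change φ ((x : (o ⊔ n ⊔ h).comap b.subtype) : g) ^ p = φ (L.pmap ⟨_, hxe⟩)
    rw [h2, ← hyz, map_add, hφn y hy, zero_add]
    exact (congrArg (· ^ p) (hφh ⟨z, hz⟩)).trans ((hlam ⟨z, _⟩ hz (hh.pmap_mem _ hz)).symm.trans
      (hφh ⟨_, hh.pmap_mem _ hz⟩).symm)
  · intro x hx
    exact (lift_ι _ _ _ _ _).trans (hφ x hx)
  · intro x hx
    exact (lift_ι _ _ _ _ _).trans (hφh ⟨x, hx⟩)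

end IsNilpotentHalf

end RestrictedLieSuperalgebra

/-! ### Baby Verma modules -/

namespace RestrictedLieSuperalgebra

variable {k : Type u} {p : ℕ} {g : Type v} [Field k] [AddCommGroup g] [Module k g]
  {L : RestrictedLieSuperalgebra k p g} [NeZero (2 : k)]

section BabyVerma

variable {b h n o : Submodule k g} (hb : L.IsSubalgebra b) (hh : h ≤ L.part 0)
  (hn : n ≤ L.part 0) (ho : o ≤ L.part 1) (lam : Module.Dual k h)

/-- The canonical generator `1 ⊗ 1` of a baby Verma module. -/
noncomputable def babyVermaGen : (babyVerma hb hh hn ho lam).carrier :=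
  (babyVermaIdeal hb n o lam).mkQ 1

theorem smul_babyVermaGen (A : (L.sub b hb).Env) :
    A • babyVermaGen hb hh hn ho lam = (babyVermaIdeal hb n o lam).mkQ A := by
  refine (map_smul (babyVermaIdeal hb n o lam).mkQ A 1).symm.trans ?_
  rw [smul_eq_mul, mul_one]

theorem smul_babyVermaGen_eq_zero_iff {A : (L.sub b hb).Env} :
    A • babyVermaGen hb hh hn ho lam = 0 ↔ A ∈ babyVermaIdeal hb n o lam := by
  rw [smul_babyVermaGen]
  exact Submodule.Quotient.mk_eq_zero _

theorem span_babyVermaGen :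
    Submodule.span (L.sub b hb).Env {babyVermaGen hb hh hn ho lam} = ⊤ := by
  rw [eq_top_iff]
  intro x _
  obtain ⟨A, rfl⟩ := (babyVermaIdeal hb n o lam).mkQ_surjective x
  rw [← smul_babyVermaGen hb hh hn ho lam]
  exact Submodule.smul_mem _ _ (Submodule.mem_span_singleton_self _)

theorem babyVermaGen_mem_part :
    babyVermaGen hb hh hn ho lam ∈ (babyVerma hb hh hn ho lam).part 0 :=
  ⟨1, by simp [mem_envPart, paritySign], rfl⟩

theorem ι_smul_babyVermaGen_eq_zero {x : b} (hx : (x : g) ∈ o ⊔ n) :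
    (L.sub b hb).ι x • babyVermaGen hb hh hn ho lam = 0 := by
  rw [smul_babyVermaGen_eq_zero_iff]
  obtain ⟨y, hy, z, hz, hyz⟩ := Submodule.mem_sup.1 hx
  obtain ⟨hzb, hyb⟩ := hb.graded (hn hz) (ho hy) (by rw [add_comm, hyz]; exact x.2)
  have hx' : x = ⟨y, hyb⟩ + ⟨z, hzb⟩ := Subtype.ext hyz.symm
  rw [hx', map_add]
  exact add_mem (Submodule.subset_span (Or.inl ⟨_, Or.inr hy, rfl⟩))
    (Submodule.subset_span (Or.inl ⟨_, Or.inl hz, rfl⟩))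

theorem ι_smul_babyVermaGen {x : b} (hx : (x : g) ∈ h) :
    (L.sub b hb).ι x • babyVermaGen hb hh hn ho lam =
      lam ⟨x, hx⟩ • babyVermaGen hb hh hn ho lam := by
  rw [← algebraMap_smul (L.sub b hb).Env (lam ⟨x, hx⟩), ← sub_eq_zero, ← sub_smul,
    smul_babyVermaGen_eq_zero_iff]
  exact Submodule.subset_span (Or.inr ⟨x, hx, rfl⟩)

/-- A vector of a `g`-supermodule that satisfies the relations of the generator of a baby Verma
module of `b` defines an equivariant map. -/
theorem exists_babyVerma_hom (N : Supermodule.{u, v, max u v} L) {m : N.carrier} {ε : ZMod 2}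
    (hm : m ∈ N.part ε) (hm0 : ∀ x ∈ o ⊔ n, L.ι x • m = 0)
    (hmh : ∀ z : h, L.ι (z : g) • m = lam z • m) :
    ∃ f : (babyVerma hb hh hn ho lam).carrier →ₛₗ[(L.subEnv hb).toRingHom] N.carrier,
      f (babyVermaGen hb hh hn ho lam) = m ∧
      ∀ i, ∀ t ∈ (babyVerma hb hh hn ho lam).part i, f t ∈ N.part (i + ε) := by
  let f₀ : (L.sub b hb).Env →ₛₗ[(L.subEnv hb).toRingHom] N.carrier :=
    { toFun := fun A => L.subEnv hb A • m
      map_add' := fun A B => by rw [map_add, add_smul]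
      map_smul' := fun A B => by
        rw [smul_eq_mul, map_mul, mul_smul]
        rfl }
  have hf₀ : babyVermaIdeal hb n o lam ≤ LinearMap.ker f₀ := by
    rw [babyVermaIdeal, Submodule.span_le]
    rintro A (⟨y, hy, rfl⟩ | ⟨y, hy, rfl⟩)
    · change L.subEnv hb _ • m = 0
      rw [subEnv_ι]
      exact hm0 y (hy.elim (fun h => Submodule.mem_sup_right h) fun h => Submodule.mem_sup_left h)
    · change L.subEnv hb _ • m = 0
      rw [map_sub, subEnv_ι, AlgHom.commutes, sub_smul, algebraMap_smul, hmh ⟨y, hy⟩, sub_self]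
  refine ⟨(babyVermaIdeal hb n o lam).liftQ f₀ hf₀, ?_, ?_⟩
  · change L.subEnv hb 1 • m = m
    rw [map_one, one_smul]
  · rintro i _ ⟨A, hA, rfl⟩
    change L.subEnv hb A • m ∈ _
    refine Supermodule.smul_mem_part ?_ hm
    have hA' : (L.sub b hb).envParity A = paritySign k i • A := hA
    rw [mem_envPart, ← subEnv_envParity, hA', map_smul]

/-- A supermodule generated by a vector that satisfies the relations of the generator of a baby
Verma module of `b` is a quotient of the induced module. -/
theorem isSubquotient_ind_babyVerma (X : L.FreeExtension hb) {N : Supermodule.{u, v, max u v} L}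
    {m : N.carrier} {ε : ZMod 2} (hm : m ∈ N.part ε) (hm0 : ∀ x ∈ o ⊔ n, L.ι x • m = 0)
    (hmh : ∀ z : h, L.ι (z : g) • m = lam z • m) (hspan : Submodule.span L.Env {m} = ⊤) :
    N.IsSubquotient (X.ind (babyVerma hb hh hn ho lam)) := by
  obtain ⟨f, hf, hfp⟩ := exists_babyVerma_hom hb hh hn ho lam N hm hm0 hmh
  refine X.isSubquotient_ind ⊤ Supermodule.isGraded_top (f.comp (Submodule.subtype ⊤)) ε
    (fun i r hr => hfp i r hr) ?_
  rw [eq_top_iff, ← hspan]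
  exact Submodule.span_mono (Set.singleton_subset_iff.2 ⟨⟨_, trivial⟩, hf⟩)

/-- In a baby Verma module of `b`, the generator is not killed by the elements of `b` outside
`o + n + h`. -/
theorem ι_smul_babyVermaGen_ne_zero [Module.Finite k g] [Fact p.Prime] [CharP k p]
    (N : L.IsNilpotentHalf h n o) (hhT : L.IsTorus h) (hd : Disjoint n h)
    (hlam : lam ∈ L.restrictedWeights h) :
    babyVermaGen hb hh hn ho lam ≠ 0 ∧
    ∀ y : b, (y : g) ∉ o ⊔ n ⊔ h → (L.sub b hb).ι y • babyVermaGen hb hh hn ho lam ≠ 0 := by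
  have ha := (N.isSubalgebra hhT).comap hb
  obtain ⟨χ, hχ0, hχ⟩ := N.exists_character hhT hd hlam hb ha
  obtain ⟨X⟩ := (L.sub b hb).nonempty_freeExtension ha
  -- with `a = o + n + h`, the coordinates of the ideal in the right `u(a)`-module `u(b)` are killed
  -- by the character `χ` of `u(a)`, whereas one coordinate of `y` is a nonzero scalar
  have key : ∀ A ∈ babyVermaIdeal hb n o lam, ∀ c, χ (X.coord A c) = 0 := by
    intro A hA c
    have hgen : ∀ A, ∀ B ∈ babyVermaGenerators hb n o lam, χ (X.coord (A * B) c) = 0 := by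
      intro A B hB
      obtain ⟨u, rfl, hu⟩ : ∃ u, (L.sub b hb).subEnv ha u = B ∧ χ u = 0 := by
        rcases hB with ⟨y, hy, rfl⟩ | ⟨y, hy, rfl⟩
        · have hy' : (y : g) ∈ o ⊔ n :=
            hy.elim (fun h => Submodule.mem_sup_right h) fun h => Submodule.mem_sup_left h
          exact ⟨((L.sub b hb).sub _ ha).ι ⟨y, Submodule.mem_sup_left hy'⟩, subEnv_ι _ _ _,
            hχ0 _ hy'⟩
        · refine ⟨((L.sub b hb).sub _ ha).ι ⟨y, Submodule.mem_sup_right hy⟩ -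
            algebraMap k _ (lam ⟨y, hy⟩), ?_, ?_⟩
          · rw [map_sub, subEnv_ι, AlgHom.commutes]
          · rw [map_sub, hχ _ hy, AlgHom.commutes]
            exact sub_self _
      rw [X.coord_mul_subEnv, map_mul, hu, mul_zero]
    refine Submodule.span_induction (p := fun A _ => ∀ D, χ (X.coord (D * A) c) = 0)
      (fun B hB D => hgen D B hB) ?_ ?_ ?_ hA 1 |> fun h => by rwa [one_mul] at h
    · simp
    · intro x y _ _ hx hy D
      rw [mul_add, map_add, Pi.add_apply, map_add, hx, hy, add_zero]
    · intro B x _ hx D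
      rw [smul_eq_mul, ← mul_assoc, hx]
  constructor
  · rw [← one_smul (L.sub b hb).Env (babyVermaGen hb hh hn ho lam), Ne,
      smul_babyVermaGen_eq_zero_iff]
    intro h1
    have h2 := key 1 h1 X.one
    rw [← X.gen_one, X.coord_gen, Pi.single_eq_same, map_one] at h2
    exact one_ne_zero h2
  · intro y hy h0
    rw [smul_babyVermaGen_eq_zero_iff] at h0
    obtain ⟨c, s, hs, hc⟩ := X.exists_coord y hy
    have h2 := key _ h0 c
    rw [hc, AlgHom.commutes] at h2
    exact hs h2

end BabyVerma

end RestrictedLieSuperalgebra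

/-! ### Sections of supermodules -/

namespace RestrictedLieSuperalgebra

variable {k : Type u} {p : ℕ} {g : Type v} [Field k] [AddCommGroup g] [Module k g]
  {L : RestrictedLieSuperalgebra k p g}

theorem IsNilSubalgebra.comap {H b : Submodule k g} (hH : L.IsNilSubalgebra H)
    (hb : L.IsSubalgebra b) : (L.sub b hb).IsNilSubalgebra (H.comap b.subtype) where
  graded hx hy h := hH.graded (x := (_ : b).1) (y := (_ : b).1) hx hy h
  bracket_mem hx hy := hH.bracket_mem hx hy
  pNilpotent := by
    intro x hx
    have hxe : (x.1 : g) ∈ L.part 0 := x.2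
    obtain ⟨m, hm⟩ := hH.pNilpotent ⟨x.1, hxe⟩ hx
    have h : ∀ m, ((((L.sub b hb).pmap^[m] x : (L.sub b hb).part 0) : b) : g) =
        L.pmap^[m] ⟨x.1, hxe⟩ := by
      intro m
      induction m with
      | zero => rfl
      | succ m ih =>
        rw [Function.iterate_succ_apply', Function.iterate_succ_apply']
        exact congrArg (fun y : L.part 0 => (L.pmap y : g)) (Subtype.ext ih)
    refine ⟨m, Subtype.ext (Subtype.ext ?_)⟩
    rw [h, hm]
    rfl

namespace Supermodule

variable [NeZero (2 : k)] {M : Supermodule.{u, v, w} L}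

/-- A simple subquotient of `M` is a subquotient of a graded section `D / C` of `M` if it vanishes
on `C` but not on `D`; the section enters as the image of a map `e` on `D` with kernel `C`. -/
theorem isSubquotient_of_section {S N : Supermodule.{u, v, w} L} (hS : S.IsSimple)
    {B C D : Submodule L.Env M.carrier} (hB : M.IsGraded B) (hD : M.IsGraded D)
    {f : B →ₗ[L.Env] S.carrier} (hf : IsHomogeneousMap f) {e : D →ₗ[L.Env] N.carrier}
    (he : IsHomogeneousMap e) (hC : ∀ d : D, e d = 0 → (d : M.carrier) ∈ C)
    (hfC : ∀ b : B, (b : M.carrier) ∈ C → f b = 0)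
    (hfD : ∃ b : B, (b : M.carrier) ∈ D ∧ f b ≠ 0) : S.IsSubquotient N := by
  obtain ⟨ε, hf⟩ := (isHomogeneousMap_iff hB).1 hf
  obtain ⟨δ, he⟩ := (isHomogeneousMap_iff hD).1 he
  let E : Submodule L.Env M.carrier := B ⊓ D
  have hE : M.IsGraded E := hB.inf hD
  let fE : E →ₗ[L.Env] S.carrier := f ∘ₗ Submodule.inclusion inf_le_left
  let eE : E →ₗ[L.Env] N.carrier := e ∘ₗ Submodule.inclusion inf_le_right
  have hfE : ∀ x : E, fE ⟨M.parity x, isGraded_iff.1 hE x x.2⟩ = paritySign k ε • S.parity (fE x) :=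
    fun x => hf ⟨x, x.2.1⟩
  have heE : ∀ x : E, eE ⟨M.parity x, isGraded_iff.1 hE x x.2⟩ = paritySign k δ • N.parity (eE x) :=
    fun x => he ⟨x, x.2.2⟩
  have hsurj : Function.Surjective fE := by
    rw [← LinearMap.range_eq_top]
    refine (hS.2 _ ?_).resolve_left fun h => ?_
    · rw [isGraded_iff]
      rintro _ ⟨x, rfl⟩
      refine ⟨paritySign k ε • ⟨M.parity x, isGraded_iff.1 hE x x.2⟩, ?_⟩
      rw [LinearMap.map_smul_of_tower, hfE, smul_smul, paritySign_mul_self, one_smul]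
    · obtain ⟨b, hbD, hb⟩ := hfD
      refine hb ?_
      have h1 : fE ⟨b, b.2, hbD⟩ ∈ LinearMap.range fE := ⟨_, rfl⟩
      rw [h] at h1
      exact (Submodule.mem_bot _).1 h1
  have hker : LinearMap.ker eE.rangeRestrict ≤ LinearMap.ker fE := by
    rw [LinearMap.ker_rangeRestrict]
    exact fun x hx => hfC ⟨x, x.2.1⟩ (hC ⟨x, x.2.2⟩ hx)
  let f' : LinearMap.range eE →ₗ[L.Env] S.carrier :=
    (LinearMap.ker eE.rangeRestrict).liftQ fE hker ∘ₗ
      (eE.rangeRestrict.quotKerEquivOfSurjective eE.surjective_rangeRestrict).symm.toLinearMap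
  have hf' : ∀ x, f' (eE.rangeRestrict x) = fE x := by
    intro x
    have h1 : (eE.rangeRestrict.quotKerEquivOfSurjective eE.surjective_rangeRestrict).symm
        (eE.rangeRestrict x) = (LinearMap.ker eE.rangeRestrict).mkQ x := by
      rw [LinearEquiv.symm_apply_eq]
      rfl
    change (LinearMap.ker eE.rangeRestrict).liftQ fE hker (LinearEquiv.symm _ _) = _
    rw [h1]
    rfl
  have hR : N.IsGraded (LinearMap.range eE) := by
    rw [isGraded_iff]
    rintro _ ⟨x, rfl⟩
    refine ⟨paritySign k δ • ⟨M.parity x, isGraded_iff.1 hE x x.2⟩, ?_⟩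
    rw [LinearMap.map_smul_of_tower, heE, smul_smul, paritySign_mul_self, one_smul]
  refine ⟨LinearMap.range eE, hR, f', (isHomogeneousMap_iff hR).2 ⟨ε + δ, fun y => ?_⟩, fun s => ?_⟩
  · obtain ⟨x, rfl⟩ := eE.surjective_rangeRestrict y
    have h1 : (⟨N.parity (eE.rangeRestrict x), isGraded_iff.1 hR _ (eE.rangeRestrict x).2⟩ :
        LinearMap.range eE) = paritySign k δ •
          eE.rangeRestrict ⟨M.parity x, isGraded_iff.1 hE x x.2⟩ := by
      apply Subtype.ext
      change N.parity (eE x) = paritySign k δ • eE ⟨M.parity x, isGraded_iff.1 hE x x.2⟩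
      rw [heE, smul_smul, paritySign_mul_self, one_smul]
    rw [h1, LinearMap.map_smul_of_tower, hf', hf', hfE, smul_smul, mul_comm, paritySign_add]
  · obtain ⟨x, rfl⟩ := hsurj s
    exact ⟨eE.rangeRestrict x, hf' x⟩

/-- A simple subquotient of a filtered supermodule is a subquotient of a layer. -/
theorem IsSubquotient.exists_layer {S : Supermodule.{u, v, w} L} (hS : S.IsSimple)
    (hSM : S.IsSubquotient M) {n : ℕ} {N : Fin n → Supermodule.{u, v, w} L}
    {c : Fin (n + 1) → Submodule L.Env M.carrier} (h0 : c 0 = ⊥) (hlast : c (Fin.last n) = ⊤)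
    (hc : ∀ i, M.IsGraded (c i))
    (hN : ∀ i : Fin n, ∃ e : c i.succ →ₗ[L.Env] (N i).carrier, IsHomogeneousMap e ∧
      ∀ d, e d = 0 → (d : M.carrier) ∈ c i.castSucc) : ∃ i, S.IsSubquotient (N i) := by
  obtain ⟨B, hB, f, hf, hfs⟩ := hSM
  by_contra! hcon
  have hvan : ∀ i, ∀ b : B, (b : M.carrier) ∈ c i → f b = 0 := by
    intro i
    induction i using Fin.induction with
    | zero =>
      intro b hb
      rw [h0, Submodule.mem_bot] at hb
      rw [show b = 0 from Subtype.ext hb, map_zero]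
    | succ i ih =>
      intro b hb
      by_contra hb0
      obtain ⟨e, he, hker⟩ := hN i
      exact hcon i (isSubquotient_of_section hS hB (hc _) hf he hker ih ⟨b, hb, hb0⟩)
  have := hS.1
  obtain ⟨s, hs⟩ := exists_ne (0 : S.carrier)
  obtain ⟨b, rfl⟩ := hfs s
  exact hs (hvan (Fin.last n) b (hlast ▸ Submodule.mem_top))

variable [Module.Finite k g]

/-- If `g = H + t` with `H` a nil ideal, then a graded submodule `A` that is maximal among those
not containing the homogeneous vector `w` satisfies `H w ⊆ A`. -/
theorem exists_isGraded_notMem [Module.Finite k M.carrier] {H t : Submodule k g}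
    (hH : L.IsNilSubalgebra H) (ht : t ≤ L.part 0) (htH : ∀ z ∈ t, ∀ x ∈ H, L.bracket z x ∈ H)
    (hg : H ⊔ t = ⊤) {w : M.carrier} (hw0 : w ≠ 0) :
    ∃ A : Submodule L.Env M.carrier, M.IsGraded A ∧ w ∉ A ∧ ∀ x ∈ H, L.ι x • w ∈ A := by
  have : IsNoetherian L.Env M.carrier := isNoetherian_of_tower k inferInstance
  obtain ⟨A, ⟨hA, hwA⟩, hmax⟩ := (wellFounded_gt (α := Submodule L.Env M.carrier)).has_min
    {A | M.IsGraded A ∧ w ∉ A} ⟨⊥, isGraded_bot, hw0⟩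
  refine ⟨A, hA, hwA, ?_⟩
  let W : Submodule k M.carrier := ⨅ x : H, (A.restrictScalars k).comap (M.toEnd x)
  have hW : ∀ m, m ∈ W ↔ ∀ x ∈ H, L.ι x • m ∈ A := by
    intro m
    simp [W, toEnd_apply]
  let C : Submodule L.Env M.carrier := ofStable W (by
    intro x m hm
    rw [hW] at *
    obtain ⟨y, hy, z, hz, rfl⟩ := Submodule.mem_sup.1 (hg ▸ Submodule.mem_top (x := x))
    have : H ≤ (A.restrictScalars k).comap (M.toEnd.flip (L.ι (y + z) • m)) := by
      refine RestrictedLieSuperalgebra.mem_of_mem_parts hH.graded fun i x hx hxH => ?_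
      change L.ι x • L.ι (y + z) • m ∈ A
      have h1 := congrArg (· • m) (env_eq_of_even (ht hz) hx)
      simp only [mul_smul, add_smul] at h1
      rw [map_add, add_smul, smul_add, ← sub_eq_of_eq_add h1]
      exact add_mem (A.smul_mem _ (hm y hy))
        (sub_mem (A.smul_mem _ (hm x hxH)) (hm _ (htH z hz x hxH)))
    exact fun x hx => this hx)
  have hC : M.IsGraded C := by
    rw [isGraded_iff]
    intro m hm
    have hm' := (hW m).1 hm
    refine (hW _).2 ?_
    have : H ≤ (A.restrictScalars k).comap (M.toEnd.flip (M.parity m)) := by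
      refine RestrictedLieSuperalgebra.mem_of_mem_parts hH.graded fun i x hx hxH => ?_
      change L.ι x • M.parity m ∈ A
      have h1 := isGraded_iff.1 hA _ (hm' x hxH)
      rw [parity_smul, mem_envPart.1 (ι_mem_envPart hx), smul_assoc] at h1
      have h2 := A.smul_of_tower_mem (paritySign k i) h1
      rwa [smul_smul, paritySign_mul_self, one_smul] at h2
    exact fun x hx => this hx
  have hAC : A ≤ C := fun m hm => (hW m).2 fun x _ => A.smul_mem _ hm
  obtain ⟨v, -, hvA, hv⟩ := M.hasInvariants hH (A.restrictScalars k) ⊤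
    (lt_top_iff_ne_top.2 fun h => hwA (h.symm ▸ Submodule.mem_top : w ∈ A.restrictScalars k))
    (fun x _ m hm => A.smul_mem _ hm) fun _ _ _ _ => trivial
  have hvC : v ∈ C := (hW v).2 hv
  have hwC : w ∈ C := by
    by_contra hwC
    exact hmax C ⟨hC, hwC⟩ (lt_of_le_of_ne hAC fun h => hvA (h ▸ hvC : v ∈ A))
  exact (hW w).1 hwC

end Supermodule

end RestrictedLieSuperalgebra

/-! ### Composition factors of induced supermodules -/

namespace RestrictedLieSuperalgebra

variable {k : Type u} {p : ℕ} {g : Type v} [Field k] [AddCommGroup g] [Module k g]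
  {L : RestrictedLieSuperalgebra k p g} [NeZero (2 : k)]

namespace FreeExtension

variable {b : Submodule k g} {hb : L.IsSubalgebra b} (X : L.FreeExtension hb)
  {M : Supermodule.{u, v, w} (L.sub b hb)}

/-- The submodule `u(g) ⊗ A` of the induced module. -/
def indSubmodule (A : Submodule (L.sub b hb).Env M.carrier) :
    Submodule L.Env (X.ind M).carrier where
  carrier := {t : X.index → M.carrier | ∀ c, t c ∈ A}
  add_mem' h h' c := A.add_mem (h c) (h' c)
  zero_mem' _ := A.zero_mem
  smul_mem' _ _ ht _ := Submodule.sum_mem _ fun d _ => A.smul_mem _ (ht d)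

theorem isGraded_indSubmodule {A : Submodule (L.sub b hb).Env M.carrier} (hA : M.IsGraded A) :
    (X.ind M).IsGraded (X.indSubmodule A) := by
  intro y z hy hz h
  have h' : ∀ c, y c ∈ A ∧ z c ∈ A := by
    intro c
    have hy : y c ∈ M.part (0 + X.par c) := hy c trivial
    have hz : z c ∈ M.part (1 + X.par c) := hz c trivial
    rcases eq_zero_or_one (X.par c) with hc | hc
    · rw [hc] at hy hz
      exact hA hy hz (h c)
    · rw [hc] at hy hz
      refine (hA hz hy ?_).symm
      rw [add_comm]
      exact h c
  exact ⟨fun c => (h' c).1, fun c => (h' c).2⟩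

theorem toInd_mem_indSubmodule {A : Submodule (L.sub b hb).Env M.carrier} {m : M.carrier} :
    X.toInd M m ∈ X.indSubmodule A ↔ m ∈ A := by
  constructor
  · intro h
    have h1 : (Pi.single X.one m : X.index → M.carrier) X.one ∈ A := h X.one
    rwa [Pi.single_eq_same] at h1
  · intro h c
    change (Pi.single X.one m : X.index → M.carrier) c ∈ A
    rcases eq_or_ne c X.one with rfl | hc
    · simpa using h
    · simp [Pi.single_eq_of_ne hc]

theorem ι_smul_toInd (x : b) (m : M.carrier) :
    L.ι (x : g) • X.toInd M m = X.toInd M ((L.sub b hb).ι x • m) := by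
  rw [← subEnv_ι L hb x]
  exact ((X.toInd M).map_smulₛₗ _ _).symm

theorem span_toInd_eq_top {m : M.carrier} (hm : Submodule.span (L.sub b hb).Env {m} = ⊤) :
    Submodule.span L.Env {X.toInd M m} = ⊤ := by
  rw [eq_top_iff, ← X.span_range_toInd M, Submodule.span_le]
  rintro _ ⟨m', rfl⟩
  obtain ⟨A, rfl⟩ := Submodule.mem_span_singleton.1 (hm ▸ Submodule.mem_top (x := m'))
  rw [map_smulₛₗ]
  exact Submodule.smul_mem _ _ (Submodule.mem_span_singleton_self _)

/-- As induction is exact, a composition factor of an induced module is one of the module induced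
from some composition factor. -/
theorem _root_.RestrictedLieSuperalgebra.Supermodule.HasCompositionFactors.exists_isSubquotient_ind
    {S : Supermodule.{u, v, w} L} (hS : S.IsSimple) (hSM : S.IsSubquotient (X.ind M)) {n : ℕ}
    {N : Fin n → Supermodule.{u, v, w} (L.sub b hb)} (hM : M.HasCompositionFactors N) :
    ∃ i, S.IsSubquotient (X.ind (N i)) := by
  obtain ⟨c, h0, hlast, hc, hN⟩ := hM
  refine hSM.exists_layer hS (c := fun i => X.indSubmodule (c i)) ?_ ?_
    (fun i => X.isGraded_indSubmodule (hc i)) fun i => ?_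
  · rw [eq_bot_iff]
    intro t ht
    refine (Submodule.mem_bot _).2 (funext fun c => ?_)
    exact (Submodule.mem_bot (L.sub b hb).Env).1 (h0 ▸ ht c)
  · rw [eq_top_iff]
    intro t _ c
    rw [hlast]
    trivial
  · obtain ⟨-, -, f, ⟨ε, hf⟩, -, hker⟩ := hN i
    let e : X.indSubmodule (c i.succ) →ₗ[L.Env] (X.ind (N i)).carrier :=
      { toFun := fun t c => f ⟨t.1 c, t.2 c⟩
        map_add' := fun t t' => funext fun c => map_add f ⟨t.1 c, t.2 c⟩ ⟨t'.1 c, t'.2 c⟩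
        map_smul' := fun A t => by
          funext c'
          change f ⟨∑ d, X.coord (A * X.gen d) c' • t.1 d, _⟩ =
            ∑ d, X.coord (A * X.gen d) c' • f ⟨t.1 d, t.2 d⟩
          simp only [← map_smul]
          rw [← map_sum]
          congr 1
          apply Subtype.ext
          simp }
    refine ⟨e, ⟨ε, fun j t ht c _ => ?_⟩, fun t ht c => ?_⟩
    · have h1 := hf _ ⟨t.1 c, t.2 c⟩ (ht c trivial)
      change f ⟨t.1 c, t.2 c⟩ ∈ (N i).part (j + ε + X.par c)
      rwa [add_right_comm]
    · exact (hker ⟨t.1 c, t.2 c⟩).1 (congrFun ht c)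

/-- Inducing supermodules with the same composition factors gives supermodules with the same
composition factors. -/
theorem _root_.RestrictedLieSuperalgebra.Supermodule.SameClass.isSubquotient_ind
    {M' : Supermodule.{u, v, w} (L.sub b hb)} (h : M.SameClass M') {S : Supermodule.{u, v, w} L}
    (hS : S.IsSimple) (hSM : S.IsSubquotient (X.ind M')) : S.IsSubquotient (X.ind M) := by
  obtain ⟨n, N, σ, ⟨c, -, -, hc, hN⟩, hM'⟩ := h
  obtain ⟨i, hi⟩ := hM'.exists_isSubquotient_ind X hS hSM
  obtain ⟨-, -, f, hf, hfs, -⟩ := hN (σ i)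
  have h1 : (N (σ i)).IsSubquotient M := ⟨c (σ i).succ, hc _, f, hf, hfs⟩
  exact hi.trans (h1.ind X)

section Weight

variable {I h : Submodule k g}

/-- If `w` spans a weight space modulo `A` on which `I` acts by zero, then the section `(A + k w)
/ A` of `M` maps onto the span of any vector of that weight killed by `I`; by Frobenius
reciprocity a simple supermodule with such a vector is a subquotient of the induced module. -/
theorem isSubquotient_ind_of_isSingularVector (hIb : I ≤ b) (hhb : h ≤ b) (hsup : b ≤ I ⊔ h)
    {A : Submodule (L.sub b hb).Env M.carrier} (hA : M.IsGraded A) {w : M.carrier} (hwA : w ∉ A)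
    (hIA : ∀ x ∈ I.comap b.subtype, (L.sub b hb).ι x • w ∈ A) {i : ZMod 2} (hw : w ∈ M.part i)
    {μ : Module.Dual k h}
    (hwμ : ∀ z (hz : z ∈ h), (L.sub b hb).ι ⟨z, hhb hz⟩ • w = μ ⟨z, hz⟩ • w)
    {S : Supermodule.{u, v, w} L} (hS : S.IsSimple) {m : S.carrier}
    (hm : S.IsSingularVector I h μ m) : S.IsSubquotient (X.ind M) := by
  obtain ⟨hm0, ⟨j, hm⟩, hmI, hmh⟩ := hm
  obtain ⟨θ, hθw, hθA⟩ : ∃ θ : M.carrier →ₗ[k] k, θ w = 1 ∧ ∀ a ∈ A, θ a = 0 := by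
    obtain ⟨θ, hθ, hle⟩ := Submodule.exists_le_ker_of_notMem (p := A.restrictScalars k) hwA
    refine ⟨(θ w)⁻¹ • θ, by simp [hθ], fun a ha => ?_⟩
    have : θ a = 0 := hle ha
    simp [this]
  -- `W = A + k w`, on which `θ` is the coordinate of `w` modulo `A`
  let W : Submodule k M.carrier :=
    (A.restrictScalars k).comap (LinearMap.id - θ.smulRight w)
  have hWA : ∀ t ∈ W, t - θ t • w ∈ A := fun _ ht => ht
  have hAW : ∀ a ∈ A, a ∈ W := by
    intro a ha
    change a - θ a • w ∈ A
    rwa [hθA a ha, zero_smul, sub_zero]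
  have hwW : w ∈ W := by
    change w - θ w • w ∈ A
    rw [hθw, one_smul, sub_self]
    exact A.zero_mem
  have hWI : ∀ y (hy : y ∈ I), ∀ t ∈ W, (L.sub b hb).ι ⟨y, hIb hy⟩ • t ∈ A := by
    intro y hy t ht
    rw [← sub_add_cancel t (θ t • w), smul_add, smul_comm _ (θ t)]
    exact A.add_mem (A.smul_mem _ (hWA t ht)) (A.smul_of_tower_mem _ (hIA ⟨y, hIb hy⟩ hy))
  have hWh : ∀ z (hz : z ∈ h), ∀ t ∈ W, (L.sub b hb).ι ⟨z, hhb hz⟩ • t ∈ W ∧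
      θ ((L.sub b hb).ι ⟨z, hhb hz⟩ • t) = μ ⟨z, hz⟩ * θ t := by
    intro z hz t ht
    have ha : (L.sub b hb).ι ⟨z, hhb hz⟩ • (t - θ t • w) ∈ A := A.smul_mem _ (hWA t ht)
    have h1 : (L.sub b hb).ι ⟨z, hhb hz⟩ • t =
        (L.sub b hb).ι ⟨z, hhb hz⟩ • (t - θ t • w) + θ t • μ ⟨z, hz⟩ • w := by
      rw [← hwμ z hz, smul_sub, smul_comm _ (θ t), sub_add_cancel]
    rw [h1]
    refine ⟨W.add_mem (hAW _ ha) (W.smul_mem _ (W.smul_mem _ hwW)), ?_⟩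
    rw [map_add θ, map_smul θ, map_smul θ, hθA _ ha, hθw]
    simp only [smul_eq_mul]
    ring
  have hdec : ∀ x : b, ∃ y, ∃ hy : y ∈ I, ∃ z, ∃ hz : z ∈ h,
      x = ⟨y, hIb hy⟩ + ⟨z, hhb hz⟩ := by
    intro x
    obtain ⟨y, hy, z, hz, hyz⟩ := Submodule.mem_sup.1 (hsup x.2)
    exact ⟨y, hy, z, hz, Subtype.ext hyz.symm⟩
  let B : Submodule (L.sub b hb).Env M.carrier := Supermodule.ofStable W (by
    intro x t ht
    obtain ⟨y, hy, z, hz, rfl⟩ := hdec x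
    rw [map_add, add_smul]
    exact W.add_mem (hAW _ (hWI y hy t ht)) (hWh z hz t ht).1)
  have hAB : A ≤ B := hAW
  have hwB : w ∈ B := hwW
  have hBdec : ∀ t ∈ B, t - θ t • w ∈ A := hWA
  have hB : M.IsGraded B := by
    rw [Supermodule.isGraded_iff]
    intro t ht
    have h1 := Supermodule.isGraded_iff.1 hA _ (hBdec t ht)
    rw [map_sub, map_smul, M.parity_apply hw] at h1
    rw [← sub_add_cancel (M.parity t) (θ t • paritySign k i • w)]
    exact add_mem (hAB h1) (B.smul_of_tower_mem _ (B.smul_of_tower_mem _ hwB))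
  let f : B →ₛₗ[(L.subEnv hb).toRingHom] S.carrier :=
    { toFun := fun t => θ t • m
      map_add' := fun t t' => by rw [← add_smul, ← map_add]; rfl
      map_smul' := fun u t => by
        change θ (u • (t : M.carrier)) • m = L.subEnv hb u • θ (t : M.carrier) • m
        induction u using env_induction generalizing t with
        | hk r => simp [algebraMap_smul, mul_smul]
        | hι x =>
          obtain ⟨y, hy, z, hz, rfl⟩ := hdec x
          rw [map_add, add_smul, map_add, hθA _ (hWI y hy t t.2), (hWh z hz t t.2).2, zero_add,
            map_add, subEnv_ι, subEnv_ι, add_smul, smul_comm (L.ι _), smul_comm (L.ι _),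
            hmI y hy, hmh ⟨z, hz⟩, smul_zero, zero_add, smul_smul, mul_comm]
        | hmul u u' hu hu' =>
          rw [mul_smul, map_mul, mul_smul, ← hu']
          exact hu (u' • t)
        | hadd u u' hu hu' => rw [add_smul, map_add, map_add, add_smul, add_smul, hu, hu'] }
  refine X.isSubquotient_ind B hB f (i + j) (fun l t ht => ?_) ?_
  · change θ (t : M.carrier) • m ∈ _
    by_cases hli : l = i
    · rw [hli, ← add_assoc, add_self_zmod_two, zero_add]
      exact Submodule.smul_mem _ _ hm
    · have h1 : θ (t : M.carrier) = 0 := by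
        by_contra h0
        have h2 := hBdec t t.2
        have h3 := Supermodule.isGraded_iff.1 hA _ h2
        rw [map_sub, map_smul, M.parity_apply ht, M.parity_apply hw] at h3
        have h4 := sub_mem h3 (A.smul_of_tower_mem (paritySign k l) h2)
        have h5 : paritySign k l - paritySign k i ≠ 0 := by
          have h2 := NeZero.ne (2 : k)
          rcases eq_zero_or_one l with rfl | rfl <;> rcases eq_zero_or_one i with rfl | rfl
          · exact absurd rfl hli
          · simpa [paritySign, one_add_one_eq_two] using h2
          · simp only [paritySign, one_ne_zero, if_false, if_true]
            rw [← neg_add', one_add_one_eq_two]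
            exact neg_ne_zero.2 h2
          · exact absurd rfl hli
        have h6 : paritySign k l • (t : M.carrier) - θ (t : M.carrier) • paritySign k i • w -
            paritySign k l • ((t : M.carrier) - θ (t : M.carrier) • w) =
            ((paritySign k l - paritySign k i) * θ (t : M.carrier)) • w := by
          module
        rw [h6] at h4
        have h7 := A.smul_of_tower_mem
          ((paritySign k l - paritySign k i) * θ (t : M.carrier))⁻¹ h4
        rw [smul_smul, inv_mul_cancel₀ (mul_ne_zero h5 h0), one_smul] at h7
        exact hwA h7
      rw [h1, zero_smul]
      exact Submodule.zero_mem _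
  · rw [eq_top_iff, ← hS.span_eq_top hm hm0]
    refine Submodule.span_mono (Set.singleton_subset_iff.2 ⟨⟨w, hwB⟩, ?_⟩)
    change θ w • m = m
    rw [hθw, one_smul]

/-- The image of `1 ⊗ w` in a simple quotient of a submodule is a singular vector. -/
theorem exists_isSingularVector_ind [Module.Finite k M.carrier] (hIb : I ≤ b) (hhb : h ≤ b)
    {A : Submodule (L.sub b hb).Env M.carrier} (hA : M.IsGraded A) {w : M.carrier} (hwA : w ∉ A)
    (hIA : ∀ x ∈ I.comap b.subtype, (L.sub b hb).ι x • w ∈ A) {i : ZMod 2} (hw : w ∈ M.part i)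
    {μ : Module.Dual k h}
    (hwμ : ∀ z (hz : z ∈ h), (L.sub b hb).ι ⟨z, hhb hz⟩ • w = μ ⟨z, hz⟩ • w) :
    ∃ S : Supermodule.{u, v, w} L, S.IsSimple ∧ (∃ m, S.IsSingularVector I h μ m) ∧
      S.IsSubquotient (X.ind M) := by
  have hfin : Module.Finite k (X.ind M).carrier := X.finite_ind inferInstance
  obtain ⟨S, hS, B, hB, f, hf, hfs, hfA, -, hwB, hfw⟩ := Supermodule.exists_isSimple_of_notMem
    hfin (X.isGraded_indSubmodule hA) (X.toInd_mem_part M hw)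
    (fun h => hwA ((X.toInd_mem_indSubmodule).1 h))
  refine ⟨S, hS, ⟨f ⟨_, hwB⟩, hfw, ⟨i, hf i _ (X.toInd_mem_part M hw)⟩, fun y hy => ?_,
    fun z => ?_⟩, B, hB, f, ⟨0, fun j t ht => by simpa using hf j t ht⟩, hfs⟩
  · rw [← map_smul]
    refine hfA _ ?_
    change L.ι y • X.toInd M w ∈ X.indSubmodule A
    rw [X.ι_smul_toInd ⟨y, hIb hy⟩, toInd_mem_indSubmodule]
    exact hIA ⟨y, hIb hy⟩ hy
  · rw [← map_smul, ← LinearMap.map_smul_of_tower]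
    refine congrArg f (Subtype.ext ?_)
    change L.ι (z : g) • X.toInd M w = μ z • X.toInd M w
    rw [X.ι_smul_toInd ⟨z, hhb z.2⟩, hwμ z z.2, ← algebraMap_smul (L.sub b hb).Env,
      map_smulₛₗ]
    change L.subEnv hb _ • _ = _
    rw [AlgHom.commutes, algebraMap_smul]

/-- Let `b = I + h` with `I` a nil ideal of `b`, and let `w` be a nonzero homogeneous weight
vector of weight `μ` in a `b`-supermodule `M`.  Then every simple `g`-supermodule with a vector of
weight `μ` killed by `I` is a composition factor of the induced module, and there is one. -/
theorem isSubquotient_ind_of_weight [Module.Finite k g] [Module.Finite k M.carrier]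
    (hI : L.IsNilSubalgebra I) (hIb : I ≤ b) (hhe : h ≤ L.part 0)
    (hhb : h ≤ b) (hhI : ∀ z ∈ h, ∀ x ∈ I, L.bracket z x ∈ I) (hsup : b ≤ I ⊔ h)
    {w : M.carrier} (hw0 : w ≠ 0) {i : ZMod 2} (hw : w ∈ M.part i) {μ : Module.Dual k h}
    (hwμ : ∀ z (hz : z ∈ h), (L.sub b hb).ι ⟨z, hhb hz⟩ • w = μ ⟨z, hz⟩ • w) :
    (∀ S : Supermodule.{u, v, w} L, S.IsSimple → (∃ m, S.IsSingularVector I h μ m) →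
      S.IsSubquotient (X.ind M)) ∧
    ∃ S : Supermodule.{u, v, w} L, S.IsSimple ∧ (∃ m, S.IsSingularVector I h μ m) ∧
      S.IsSubquotient (X.ind M) := by
  have hsup' : I.comap b.subtype ⊔ h.comap b.subtype = ⊤ := by
    rw [eq_top_iff]
    intro x _
    obtain ⟨y, hy, z, hz, hyz⟩ := Submodule.mem_sup.1 (hsup x.2)
    exact Submodule.mem_sup.2 ⟨⟨y, hIb hy⟩, hy, ⟨z, hhb hz⟩, hz, Subtype.ext hyz⟩
  obtain ⟨A, hA, hwA, hIA⟩ := Supermodule.exists_isGraded_notMem (M := M) (hI.comap hb)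
    (t := h.comap b.subtype) (fun z hz => hhe hz) (fun z hz x hx => hhI z hz x hx) hsup' hw0
  exact ⟨fun S hS ⟨m, hm⟩ => X.isSubquotient_ind_of_isSingularVector hIb hhb hsup hA hwA hIA hw
    hwμ hS hm, X.exists_isSingularVector_ind hIb hhb hA hwA hIA hw hwμ⟩

end Weight

end FreeExtension

end RestrictedLieSuperalgebra

/-! ### Restricted weights and linkage -/

namespace RestrictedLieSuperalgebra

variable {k : Type u} {p : ℕ} {g : Type v} [Field k] [AddCommGroup g] [Module k g]
  {L : RestrictedLieSuperalgebra k p g}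

section Weights

variable {h : Submodule k g}

/-- A torus is spanned by the elements `x^[p]`. -/
theorem IsTorus.eq_of_pmap_eq (hh : L.IsTorus h) {f f' : Module.Dual k h}
    (hf : ∀ (x : L.part 0) (hx : (x : g) ∈ h),
      f ⟨L.pmap x, hh.pmap_mem x hx⟩ = f' ⟨L.pmap x, hh.pmap_mem x hx⟩) : f = f' := by
  have hiter : ∀ (n : ℕ) (x : L.part 0), (x : g) ∈ h → (L.pmap^[n] x : g) ∈ h := by
    intro n
    induction n with
    | zero => exact fun x hx => hx
    | succ n ih =>
      intro x hx
      rw [Function.iterate_succ_apply']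
      exact hh.pmap_mem _ (ih x hx)
  let K : Submodule k (L.part 0) :=
    ((LinearMap.ker (f - f')).map h.subtype).comap (Submodule.subtype _)
  have hK : ∀ x : L.part 0, (x : g) ∈ h → x ∈ K := by
    intro x hx
    refine Submodule.span_le.2 ?_ (hh.semisimple x hx)
    rintro _ ⟨n, rfl⟩
    refine ⟨⟨(L.pmap^[n + 1] x : g), hiter _ x hx⟩, ?_, rfl⟩
    rw [SetLike.mem_coe, LinearMap.mem_ker, LinearMap.sub_apply, sub_eq_zero]
    have h1 := hf (L.pmap^[n] x) (hiter n x hx)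
    simpa only [Function.iterate_succ_apply'] using h1
  ext ⟨x, hx⟩
  obtain ⟨y, hy, hyx⟩ := hK ⟨x, hh.le_even hx⟩ hx
  have hyx' : y = ⟨x, hx⟩ := Subtype.ext hyx
  rw [hyx', SetLike.mem_coe, LinearMap.mem_ker, LinearMap.sub_apply, sub_eq_zero] at hy
  exact hy

variable [hp : Fact p.Prime]

theorem zero_mem_restrictedWeights : (0 : Module.Dual k h) ∈ L.restrictedWeights h :=
  fun x hx hx' => by simp [hp.out.ne_zero]

variable [CharP k p]

theorem add_mem_restrictedWeights {lam mu : Module.Dual k h} (hl : lam ∈ L.restrictedWeights h)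
    (hm : mu ∈ L.restrictedWeights h) : lam + mu ∈ L.restrictedWeights h := fun x hx hx' => by
  rw [LinearMap.add_apply, LinearMap.add_apply, hl x hx hx', hm x hx hx', add_pow_char]

theorem sub_mem_restrictedWeights {lam mu : Module.Dual k h} (hl : lam ∈ L.restrictedWeights h)
    (hm : mu ∈ L.restrictedWeights h) : lam - mu ∈ L.restrictedWeights h := fun x hx hx' => by
  rw [LinearMap.sub_apply, LinearMap.sub_apply, hl x hx hx', hm x hx hx', sub_pow_char]

variable [Module.Finite k g]

/-- The restricted weights are generated, as an additive monoid, by any `dim h` linearly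
independent ones: their coordinates in such a basis lie in the prime field. -/
theorem mem_closure_of_linearIndependent (hh : L.IsTorus h)
    {α : Fin (finrank k h) → L.restrictedWeights h}
    (hα : LinearIndependent k fun i => (α i : Module.Dual k h)) {lam : Module.Dual k h}
    (hlam : lam ∈ L.restrictedWeights h) :
    lam ∈ AddSubmonoid.closure (Set.range fun i => (α i : Module.Dual k h)) := by
  have hspan := hα.span_eq_top_of_card_eq_finrank' (by
    rw [Fintype.card_fin, Subspace.dual_finrank_eq])
  obtain ⟨c, hc⟩ := (Submodule.mem_span_range_iff_exists_fun k).1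
    (hspan ▸ Submodule.mem_top (x := lam))
  have hfix : ∑ i, (c i ^ p) • (α i : Module.Dual k h) = ∑ i, c i • (α i : Module.Dual k h) := by
    refine hh.eq_of_pmap_eq fun x hx => ?_
    rw [hc, hlam x hx (hh.pmap_mem x hx), ← hc, LinearMap.sum_apply, LinearMap.sum_apply,
      sum_pow_char]
    refine Finset.sum_congr rfl fun i _ => ?_
    rw [LinearMap.smul_apply, LinearMap.smul_apply, (α i).2 x hx (hh.pmap_mem x hx), smul_eq_mul,
      smul_eq_mul, mul_pow]
  have hcp : ∀ i, c i ^ p = c i := by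
    intro i
    have h1 := Fintype.linearIndependent_iff.1 hα (fun i => c i ^ p - c i) (by
      simp only [sub_smul, Finset.sum_sub_distrib, hfix, sub_self]) i
    exact sub_eq_zero.1 h1
  have hnat : ∀ i, ∃ m : ℕ, (m : k) = c i := by
    intro i
    have h1 := (Subfield.mem_bot_iff_pow_eq_self k p).2 (hcp i)
    rw [← ZMod.fieldRange_castHom_eq_bot p] at h1
    obtain ⟨m, hm⟩ := h1
    exact ⟨m.val, by rw [← hm, ZMod.natCast_val]; rfl⟩
  choose m hm using hnat
  rw [← hc]
  refine sum_mem fun i _ => ?_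
  have hi : (α i : Module.Dual k h) ∈ AddSubmonoid.closure (Set.range fun i =>
      (α i : Module.Dual k h)) := AddSubmonoid.subset_closure (Set.mem_range_self i)
  rw [← hm, Nat.cast_smul_eq_nsmul]
  exact nsmul_mem hi _

end Weights

section Linking

theorem Supermodule.IsSingularVector.mono {M : Supermodule.{u, v, w} L} {H H' h : Submodule k g}
    {lam : Module.Dual k h} {m : M.carrier} (hm : M.IsSingularVector H h lam m) (hle : H' ≤ H) :
    M.IsSingularVector H' h lam m :=
  ⟨hm.ne_zero, hm.homogeneous, fun x hx => hm.smul_eq_zero x (hle hx), hm.weight⟩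

theorem Supermodule.IsSingularVector.exists_isSimple [NeZero (2 : k)] {M : Supermodule.{u, v, w} L}
    (hM : Module.Finite k M.carrier) {H h : Submodule k g} {lam : Module.Dual k h} {m : M.carrier}
    (hm : M.IsSingularVector H h lam m) : ∃ S : Supermodule.{u, v, w} L, S.IsSimple ∧
      (∃ s, S.IsSingularVector H h lam s) ∧ S.IsSubquotient M := by
  obtain ⟨hm0, ⟨i, hi⟩, hmH, hmh⟩ := hm
  obtain ⟨S, hS, B, hB, f, hf, hfs, -, -, hmB, hfm⟩ :=
    exists_isSimple_of_notMem hM isGraded_bot hi (by simpa using hm0)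
  refine ⟨S, hS, ⟨f ⟨m, hmB⟩, hfm, ⟨i, hf i _ hi⟩, fun x hx => ?_, fun z => ?_⟩, B, hB, f,
    ⟨0, fun j b hb => by simpa using hf j b hb⟩, hfs⟩
  · rw [← map_smul, show L.ι x • (⟨m, hmB⟩ : B) = 0 from Subtype.ext (hmH x hx), map_zero]
  · rw [← map_smul, ← LinearMap.map_smul_of_tower]
    exact congrArg f (Subtype.ext (hmh z))

variable [NeZero (2 : k)] [Fact p.Prime] [CharP k p] [Module.Finite k g] [IsAlgClosed k]

/-- If for every restricted weight `λ` there is an indecomposable supermodule having as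
composition factors all simple supermodules with a singular vector of weight `λ` and some with one
of weight `λ + α i`, for `dim h` linearly independent weights `α i`, then there is one block. -/
theorem oneBlock_of_forall_exists_isIndecomposable {h H : Submodule k g} (hh : L.IsTorus h)
    (hH : L.IsNilSubalgebra H) (hhH : ∀ z ∈ h, ∀ x ∈ H, L.bracket z x ∈ H)
    {α : Fin (finrank k h) → L.restrictedWeights h}
    (hα : LinearIndependent k fun i => (α i : Module.Dual k h))
    (hM : ∀ lam ∈ L.restrictedWeights h, ∃ M : Supermodule.{u, v, max u v} L,
      Module.Finite k M.carrier ∧ M.IsIndecomposable ∧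
      (∀ S : Supermodule.{u, v, max u v} L, S.IsSimple → (∃ m, S.IsSingularVector H h lam m) →
        S.IsSubquotient M) ∧
      (∃ S : Supermodule.{u, v, max u v} L, S.IsSimple ∧ (∃ m, S.IsSingularVector H h lam m)) ∧
      ∀ i, ∃ S : Supermodule.{u, v, max u v} L, S.IsSimple ∧
        (∃ m, S.IsSingularVector H h (lam + α i) m) ∧ S.IsSubquotient M) : L.OneBlock := by
  constructor
  · obtain ⟨-, -, -, -, ⟨S, hS, -⟩, -⟩ := hM 0 zero_mem_restrictedWeights
    exact ⟨S, hS⟩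
  let P : Module.Dual k h → Module.Dual k h → Prop := fun lam mu =>
    ∀ S T : Supermodule.{u, v, max u v} L, S.IsSimple → T.IsSimple →
      (∃ m, S.IsSingularVector H h lam m) → (∃ m, T.IsSingularVector H h mu m) →
      Relation.EqvGen Supermodule.Linked S T
  have hrefl : ∀ lam ∈ L.restrictedWeights h, P lam lam := by
    intro lam hlam S T hS hT hSl hTl
    obtain ⟨M, hMf, hMi, hMl, -⟩ := hM lam hlam
    exact .rel _ _ ⟨M, hMf, hMi, ⟨hS, hMl S hS hSl⟩, ⟨hT, hMl T hT hTl⟩⟩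
  have key : ∀ δ ∈ AddSubmonoid.closure (Set.range fun i => (α i : Module.Dual k h)),
      δ ∈ L.restrictedWeights h ∧ ∀ lam ∈ L.restrictedWeights h, P lam (lam + δ) := by
    intro δ hδ
    induction hδ using AddSubmonoid.closure_induction with
    | mem δ hδ =>
      obtain ⟨i, rfl⟩ := hδ
      refine ⟨(α i).2, fun lam hlam S T hS hT hSl hTl => ?_⟩
      obtain ⟨M, hMf, hMi, hMl, -, hMα⟩ := hM lam hlam
      obtain ⟨S', hS', hSl', hSM⟩ := hMα i
      exact .trans _ S' _ (.rel _ _ ⟨M, hMf, hMi, ⟨hS, hMl S hS hSl⟩, ⟨hS', hSM⟩⟩)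
        (hrefl _ (add_mem_restrictedWeights hlam (α i).2) S' T hS' hT hSl' hTl)
    | zero =>
      refine ⟨zero_mem_restrictedWeights, fun lam hlam => ?_⟩
      rw [add_zero]
      exact hrefl lam hlam
    | add δ δ' _ _ h1 h2 =>
      refine ⟨add_mem_restrictedWeights h1.1 h2.1, fun lam hlam S T hS hT hSl hTl => ?_⟩
      have hlam' := add_mem_restrictedWeights hlam h1.1
      obtain ⟨-, -, -, -, ⟨S', hS', hSl'⟩, -⟩ := hM _ hlam'
      rw [← add_assoc] at hTl
      exact .trans _ S' _ (h1.2 lam hlam S S' hS hS' hSl hSl')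
        (h2.2 _ hlam' S' T hS' hT hSl' hTl)
  intro S T hS hT
  have hfin : ∀ S : Supermodule.{u, v, max u v} L, S.IsSimple →
      ∃ lam ∈ L.restrictedWeights h, ∃ m, S.IsSingularVector H h lam m := by
    intro S hS
    have := hS.finite
    have := hS.1
    exact Supermodule.exists_isSingularVector hH hh hhH
  obtain ⟨lam, hlam, hSl⟩ := hfin S hS
  obtain ⟨mu, hmu, hTm⟩ := hfin T hT
  have h1 := (key _ (mem_closure_of_linearIndependent hh hα
    (sub_mem_restrictedWeights hmu hlam))).2 lam hlam
  rw [add_sub_cancel] at h1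
  exact h1 S T hS hT hSl hTm

end Linking

end RestrictedLieSuperalgebra

/-! ### Triangular decompositions and the two cases -/

namespace RestrictedLieSuperalgebra

variable {k : Type u} {p : ℕ} {g : Type v} [Field k] [AddCommGroup g] [Module k g]
  {L : RestrictedLieSuperalgebra k p g}

namespace TriangularDecomposition

variable {a h : Submodule k g} (T : L.TriangularDecomposition a h)

/-- The subalgebra `b⁺ = o⁺ ⊕ n⁺ ⊕ h`. -/
def borelPlus : Submodule k g := T.oPlus ⊔ T.nPlus ⊔ h

theorem isTorus (T : L.TriangularDecomposition a h) : L.IsTorus h := T.maximalTorus.prop.1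

theorem isSubalgebra_borelPlus : L.IsSubalgebra T.borelPlus := T.plus.isSubalgebra T.isTorus

theorem isSubalgebra_borelMinus : L.IsSubalgebra T.borelMinus := T.minus.isSubalgebra T.isTorus

theorem le_even : T.nMinus ⊔ h ⊔ T.nPlus ≤ a := T.even_sup.le.trans inf_le_left

theorem le_odd : T.oMinus ⊔ T.oPlus ≤ a := T.odd_sup.le.trans inf_le_left

theorem torus_le (T : L.TriangularDecomposition a h) : h ≤ a := T.maximalTorus.prop.2

theorem borelMinus_le : T.borelMinus ≤ a :=
  sup_le (sup_le (le_sup_left.trans T.le_odd) ((le_sup_left.trans le_sup_left).trans T.le_even))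
    T.torus_le

theorem borelPlus_le : T.borelPlus ≤ a :=
  sup_le (sup_le (le_sup_right.trans T.le_odd) (le_sup_right.trans T.le_even)) T.torus_le

theorem disjoint_plus_torus : Disjoint T.nPlus h :=
  (T.disjoint_plus.mono_left le_sup_right).symm

theorem offTorus_le : T.offTorus ≤ a :=
  sup_le (sup_le (sup_le (le_sup_left.trans T.le_odd)
    ((le_sup_left.trans le_sup_left).trans T.le_even)) (le_sup_right.trans T.le_even))
    (le_sup_right.trans T.le_odd)

theorem minus_le_offTorus : T.oMinus ⊔ T.nMinus ≤ T.offTorus := le_sup_left.trans le_sup_left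

theorem isNilSubalgebra_offTorus (hT : T.OffTorusIsPNilpotentIdeal) :
    L.IsNilSubalgebra T.offTorus where
  graded := by
    have h1 : T.offTorus = (T.oMinus ⊔ T.oPlus) ⊔ (T.nMinus ⊔ T.nPlus) := by
      rw [offTorus, sup_sup_sup_comm, sup_assoc, sup_assoc, sup_comm T.oPlus, ← sup_assoc,
        ← sup_assoc]
    intro x y hx hy hxy
    rw [h1] at *
    obtain ⟨h2, h3⟩ := mem_of_add_mem_sup (sup_le T.minus.even T.plus.even)
      (sup_le T.minus.odd T.plus.odd) hx hy hxy
    exact ⟨Submodule.mem_sup_right h2, Submodule.mem_sup_left h3⟩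
  bracket_mem hx hy := hT.1 (T.offTorus_le hx) hy
  pNilpotent := hT.2

theorem le_borelMinus_sup (ha : L.IsSubalgebra a) : a ≤ T.borelMinus ⊔ (T.oPlus ⊔ T.nPlus) := by
  refine RestrictedLieSuperalgebra.mem_of_mem_parts ha.graded fun i x hx hxa => ?_
  rcases eq_zero_or_one i with rfl | rfl
  · have h1 : x ∈ T.nMinus ⊔ h ⊔ T.nPlus := T.even_sup ▸ ⟨hxa, hx⟩
    exact sup_le_sup (sup_le_sup_right le_sup_right h) le_sup_right h1
  · have h1 : x ∈ T.oMinus ⊔ T.oPlus := T.odd_sup ▸ ⟨hxa, hx⟩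
    have h2 : T.oMinus ⊔ T.oPlus ≤ T.borelMinus ⊔ (T.oPlus ⊔ T.nPlus) :=
      sup_le_sup (le_sup_left.trans le_sup_left) le_sup_left
    exact h2 h1

theorem le_offTorus_sup (ha : L.IsSubalgebra a) : a ≤ T.offTorus ⊔ h := by
  refine (T.le_borelMinus_sup ha).trans (sup_le (sup_le ?_ le_sup_right) ?_)
  · exact T.minus_le_offTorus.trans le_sup_left
  · exact (sup_le le_sup_right (le_sup_right.trans le_sup_left)).trans le_sup_left

theorem notMem_borelMinus {x : g} (hx : x ∈ T.nPlus) (hx0 : x ≠ 0) : x ∉ T.borelMinus := by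
  intro hxb
  have h1 := T.minus.mem_of_mem_part_zero T.isTorus (T.plus.even hx) hxb
  exact hx0 (Submodule.disjoint_def.1 T.disjoint_plus x h1 hx)

end TriangularDecomposition

theorem isSubalgebra_top : L.IsSubalgebra ⊤ := ⟨fun _ _ _ => ⟨trivial, trivial⟩,
  fun _ _ => trivial, fun _ _ => trivial⟩

/-- The components of a weight vector in `n⁺` and `o⁺` are weight vectors of the same weight. -/
theorem TriangularDecomposition.exists_plus_components {h : Submodule k g}
    (T : L.TriangularDecomposition ⊤ h) {α : Module.Dual k h} {x : g}
    (hx : ∀ z : h, L.bracket (z : g) x = α z • x) :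
    ∃ y ∈ T.nPlus, ∃ y' ∈ T.oPlus, (∀ z : h, L.bracket (z : g) y = α z • y) ∧
      (∀ z : h, L.bracket (z : g) y' = α z • y') ∧ x - y - y' ∈ T.borelMinus := by
  obtain ⟨x₀, hx₀, x₁, hx₁, rfl⟩ := L.exists_parts x
  have hx₀' : x₀ ∈ T.nMinus ⊔ h ⊔ T.nPlus := T.even_sup ▸ ⟨trivial, hx₀⟩
  have hx₁' : x₁ ∈ T.oMinus ⊔ T.oPlus := T.odd_sup ▸ ⟨trivial, hx₁⟩
  obtain ⟨s, hs, y, hy, rfl⟩ := Submodule.mem_sup.1 hx₀'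
  obtain ⟨s', hs', y', hy', rfl⟩ := Submodule.mem_sup.1 hx₁'
  have hsum : ∀ z : h, L.bracket (z : g) (s + y) - α z • (s + y) = 0 ∧
      L.bracket (z : g) (s' + y') - α z • (s' + y') = 0 := by
    intro z
    have hz := T.isTorus.le_even z.2
    have h0 : L.bracket (z : g) (s + y) - α z • (s + y) ∈ L.part 0 :=
      sub_mem (by simpa using L.bracket_mem hz hx₀) (Submodule.smul_mem _ _ hx₀)
    have h1 : L.bracket (z : g) (s' + y') - α z • (s' + y') ∈ L.part 1 :=
      sub_mem (by simpa using L.bracket_mem hz hx₁) (Submodule.smul_mem _ _ hx₁)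
    have h2 : (L.bracket (z : g) (s + y) - α z • (s + y)) +
        (L.bracket (z : g) (s' + y') - α z • (s' + y')) = 0 := by
      rw [sub_add_sub_comm, ← map_add, ← smul_add, hx z, sub_self]
    have h3 := eq_zero_of_mem_parts h0 (by
      rw [eq_neg_of_add_eq_zero_left h2]
      exact neg_mem h1)
    exact ⟨h3, by rwa [h3, zero_add] at h2⟩
  have hsplit : ∀ {A B : Submodule k g}, Disjoint A B → ∀ {s y : g}, s ∈ A → y ∈ B → ∀ {z : h},
      L.bracket (z : g) s ∈ A → L.bracket (z : g) y ∈ B →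
      L.bracket (z : g) (s + y) - α z • (s + y) = 0 → L.bracket (z : g) y = α z • y := by
    intro A B hAB s y hs hy z hzs hzy h0
    have h1 : L.bracket (z : g) y - α z • y = -(L.bracket (z : g) s - α z • s) := by
      rw [← sub_eq_zero, ← h0, map_add, smul_add]
      abel
    have h2 := Submodule.disjoint_def.1 hAB _
      (h1 ▸ neg_mem (sub_mem hzs (A.smul_mem _ hs))) (sub_mem hzy (B.smul_mem _ hy))
    exact sub_eq_zero.1 h2
  refine ⟨y, hy, y', hy', fun z => ?_, fun z => ?_, ?_⟩
  · refine hsplit T.disjoint_plus hs hy ?_ (T.plus.torus_even z.2 hy) (hsum z).1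
    obtain ⟨t, ht, t', ht', rfl⟩ := Submodule.mem_sup.1 hs
    rw [map_add, T.isTorus.abelian z.2 ht', add_zero]
    exact Submodule.mem_sup_left (T.minus.torus_even z.2 ht)
  · exact hsplit T.disjoint_odd hs' hy' (T.minus.torus_odd z.2 hs') (T.plus.torus_odd z.2 hy')
      (hsum z).2
  · have h1 : s + y + (s' + y') - y - y' = s' + s := by abel
    rw [h1, borelMinus, sup_assoc]
    exact add_mem (Submodule.mem_sup_left hs') (Submodule.mem_sup_right hs)

section BabyVerma

variable [NeZero (2 : k)] {b h n o : Submodule k g} (hb : L.IsSubalgebra b) (hh : L.IsTorus h)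
  (hn : n ≤ L.part 0) (ho : o ≤ L.part 1) (lam : Module.Dual k h)

theorem isSingularVector_toInd_babyVermaGen (X : L.FreeExtension hb) (hab : o ⊔ n ⊔ h ≤ b)
    (h0 : babyVermaGen hb hh.le_even hn ho lam ≠ 0) :
    (X.ind (babyVerma hb hh.le_even hn ho lam)).IsSingularVector (o ⊔ n) h lam
      (X.toInd _ (babyVermaGen hb hh.le_even hn ho lam)) where
  ne_zero h := h0 (X.toInd_injective _ (h.trans (map_zero _).symm))
  homogeneous := ⟨0, X.toInd_mem_part _ (babyVermaGen_mem_part hb hh.le_even hn ho lam)⟩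
  smul_eq_zero x hx := by
    have hxb : x ∈ b := hab (Submodule.mem_sup_left hx)
    rw [X.ι_smul_toInd ⟨x, hxb⟩, ι_smul_babyVermaGen_eq_zero hb hh.le_even hn ho lam hx, map_zero]
  weight z := by
    have hzb : (z : g) ∈ b := hab (Submodule.mem_sup_right z.2)
    rw [X.ι_smul_toInd ⟨z, hzb⟩, ι_smul_babyVermaGen hb hh.le_even hn ho lam z.2,
      ← algebraMap_smul (L.sub b hb).Env, map_smulₛₗ]
    change L.subEnv hb _ • _ = _
    rw [AlgHom.commutes, algebraMap_smul]

/-- If `y` has weight `α`, then `y` maps the generator of a baby Verma module to a vector of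
weight `λ + α`. -/
theorem ι_smul_ι_smul_babyVermaGen {α : Module.Dual k h} {y : b} {i : ZMod 2}
    (hyi : (y : g) ∈ L.part i) (hy : ∀ z : h, L.bracket (z : g) (y : g) = α z • (y : g)) {z : b}
    (hz : (z : g) ∈ h) :
    (L.sub b hb).ι z • (L.sub b hb).ι y • babyVermaGen hb hh.le_even hn ho lam =
      (lam + α) ⟨z, hz⟩ • (L.sub b hb).ι y • babyVermaGen hb hh.le_even hn ho lam := by
  have h1 : (L.sub b hb).bracket z y = α ⟨z, hz⟩ • y := Subtype.ext (hy ⟨z, hz⟩)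
  have hze : z ∈ (L.sub b hb).part 0 := hh.le_even hz
  have hye : y ∈ (L.sub b hb).part i := hyi
  rw [smul_smul, env_eq_of_even hze hye, h1, map_smul, add_smul, mul_smul,
    ι_smul_babyVermaGen hb hh.le_even hn ho lam hz, smul_comm, smul_assoc, LinearMap.add_apply,
    add_smul]

variable [Fact p.Prime] [CharP k p] [Module.Finite k g]

theorem finite_babyVerma : Module.Finite k (babyVerma hb hh.le_even hn ho lam).carrier :=
  Supermodule.finite_of_span_eq_top (span_babyVermaGen hb hh.le_even hn ho lam)

/-- The module `u(g) ⊗_{u(b⁻)} k_λ` is indecomposable. -/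
theorem TriangularDecomposition.isIndecomposable_ind_babyVermaMinus
    (T : L.TriangularDecomposition ⊤ h) {l : Submodule k g} (hl : L.IsSubalgebra l)
    (Tl : L.TriangularDecomposition l h) (hT : Tl.borelMinus = T.borelMinus)
    (X : L.FreeExtension hl) (mu : L.restrictedWeights h) :
    Module.Finite k (X.ind (Tl.babyVermaMinus hl mu)).carrier ∧
      (X.ind (Tl.babyVermaMinus hl mu)).IsIndecomposable := by
  have hfin : Module.Finite k (X.ind (Tl.babyVermaMinus hl mu)).carrier :=
    X.finite_ind (finite_babyVerma hl Tl.isTorus Tl.minus.even Tl.minus.odd mu)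
  refine ⟨hfin, ?_⟩
  have hs := isSingularVector_toInd_babyVermaGen hl Tl.isTorus Tl.minus.even Tl.minus.odd mu X
    Tl.borelMinus_le (ι_smul_babyVermaGen_ne_zero hl _ _ _ _ Tl.minus Tl.isTorus Tl.disjoint_minus
      mu.2).1
  refine Supermodule.isIndecomposable_of_span_eq_top (b := T.borelMinus)
    T.isSubalgebra_borelMinus.graded T.plus.isNilSubalgebra
    (top_le_iff.1 (T.le_borelMinus_sup isSubalgebra_top)) (fun x hx => ?_)
    (X.span_toInd_eq_top (span_babyVermaGen hl _ _ _ _)) ⟨_, _, hs.ne_zero⟩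
  rw [← hT] at hx
  obtain ⟨y, hy, z, hz, rfl⟩ := Submodule.mem_sup.1 hx
  rw [map_add, add_smul]
  refine add_mem ?_ ?_
  · exact (hs.smul_eq_zero y hy).symm ▸ Submodule.zero_mem _
  · exact (hs.weight ⟨z, hz⟩).symm ▸
      Submodule.smul_mem _ _ (Submodule.mem_span_singleton_self _)

end BabyVerma

section Cases

variable [NeZero (2 : k)] [Fact p.Prime] [CharP k p] [Module.Finite k g] [IsAlgClosed k]
  {h : Submodule k g} (T : L.TriangularDecomposition ⊤ h)

/-- The module `u(g) ⊗_{u(l)} Z`, with `Z` the baby Verma module of `l` for `b_l⁻` of weight `λ`,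
links the weights `λ` and `λ + α i`: the weight vector `x i` of `n_l⁺` moves the generator of `Z`
to a vector of weight `λ + α i`. -/
theorem TriangularDecomposition.LongHypotheses.oneBlock (hT : T.LongHypotheses) : L.OneBlock := by
  obtain ⟨-, l, hl, Tl, hoff, ⟨x, α, hx, hxα, hxi, hαi⟩, hbor, -, -⟩ := hT
  obtain ⟨X⟩ := L.nonempty_freeExtension hl
  have hI := Tl.isNilSubalgebra_offTorus hoff
  refine oneBlock_of_forall_exists_isIndecomposable Tl.isTorus Tl.minus.isNilSubalgebra
    Tl.minus.bracket_torus_mem hαi fun lam hlam => ?_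
  obtain ⟨hfin, hind⟩ := T.isIndecomposable_ind_babyVermaMinus hl Tl hbor X ⟨lam, hlam⟩
  have hne := ι_smul_babyVermaGen_ne_zero hl Tl.isTorus.le_even Tl.minus.even Tl.minus.odd lam
    Tl.minus Tl.isTorus Tl.disjoint_minus hlam
  have hs := isSingularVector_toInd_babyVermaGen hl Tl.isTorus Tl.minus.even Tl.minus.odd lam X
    Tl.borelMinus_le hne.1
  refine ⟨_, hfin, hind, fun S hS ⟨m, hm⟩ => ?_, ?_, fun i => ?_⟩
  · obtain ⟨ε, hε⟩ := hm.homogeneous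
    exact isSubquotient_ind_babyVerma hl _ _ _ lam X hε hm.smul_eq_zero hm.weight
      (hS.span_eq_top hε hm.ne_zero)
  · obtain ⟨S, hS, hSm, -⟩ := hs.exists_isSimple hfin
    exact ⟨S, hS, hSm⟩
  · have hxl : x i ∈ l := Tl.le_even (Submodule.mem_sup_right (hx i))
    have hxe := Tl.plus.even (hx i)
    have := finite_babyVerma hl Tl.isTorus Tl.minus.even Tl.minus.odd lam
    obtain ⟨-, S, hS, ⟨m, hm⟩, hSM⟩ := X.isSubquotient_ind_of_weight (h := h) hI Tl.offTorus_le
      Tl.isTorus.le_even Tl.torus_le (fun z hz x hx => hoff.1 (Tl.torus_le hz) hx)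
      (Tl.le_offTorus_sup hl) (hne.2 ⟨x i, hxl⟩ (Tl.notMem_borelMinus (hx i) (hxi.ne_zero i)))
      (i := 0) (by
        simpa using Supermodule.smul_mem _ (L := L.sub l hl) (x := ⟨x i, hxl⟩) hxe
          (babyVermaGen_mem_part hl Tl.isTorus.le_even Tl.minus.even Tl.minus.odd lam))
      (μ := lam + α i) (fun z hz => ι_smul_ι_smul_babyVermaGen hl Tl.isTorus Tl.minus.even
        Tl.minus.odd lam (y := ⟨x i, hxl⟩) hxe (hxα i) hz)
    exact ⟨S, hS, ⟨m, hm.mono Tl.minus_le_offTorus⟩, hSM⟩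

/-- The module `u(g) ⊗_{u(l)} Z`, with `Z` the baby Verma module of `l` for `b_l⁻` of weight
`ψ⁻¹ μ`, has among its composition factors those of the `g`-module induced from the `b⁺`-module
induced from the weight `μ` of `b_l⁺`. In that `b⁺`-module, a component of `x i` in `n⁺` or `o⁺` outside
`l` moves the generator to a vector of weight `μ + α i`. -/
theorem TriangularDecomposition.BabyVermaHypotheses.oneBlock (hT : T.BabyVermaHypotheses) :
    L.OneBlock := by
  obtain ⟨l, hl, Tl, hnle, hole, hbor, ⟨ψ, hψ⟩, C, hC, x, α, hx, hxα, hxi, hαi⟩ := hT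
  obtain ⟨X⟩ := L.nonempty_freeExtension hl
  obtain ⟨Y⟩ := L.nonempty_freeExtension T.isSubalgebra_borelPlus
  have hb := T.isSubalgebra_borelPlus
  refine oneBlock_of_forall_exists_isIndecomposable T.isTorus T.plus.isNilSubalgebra
    T.plus.bracket_torus_mem hαi fun mu hmu => ?_
  obtain ⟨hfin, hind⟩ := T.isIndecomposable_ind_babyVermaMinus hl Tl hbor X (ψ.symm ⟨mu, hmu⟩)
  have hle : Tl.borelPlus ≤ T.borelPlus := sup_le_sup_right (sup_le_sup hole hnle) h
  have hne := ι_smul_babyVermaGen_ne_zero hb T.isTorus.le_even Tl.plus.even Tl.plus.odd mu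
    Tl.plus T.isTorus Tl.disjoint_plus_torus hmu
  have hs := isSingularVector_toInd_babyVermaGen hb T.isTorus Tl.plus.even Tl.plus.odd mu Y hle
    hne.1
  have hQfin := finite_babyVerma hb T.isTorus Tl.plus.even Tl.plus.odd mu
  -- both `g`-modules are induced from the one-dimensional module of weight `mu` of `b_l⁺`
  have hQ : (Y.ind (babyVerma hb T.isTorus.le_even Tl.plus.even Tl.plus.odd mu)).IsSubquotient
      (X.ind (Tl.babyVermaPlus hl (ψ (ψ.symm ⟨mu, hmu⟩)))) := by
    rw [Equiv.apply_symm_apply]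
    obtain ⟨ε, hε⟩ := hs.homogeneous
    exact isSubquotient_ind_babyVerma hl _ _ _ mu X hε hs.smul_eq_zero hs.weight
      (Y.span_toInd_eq_top (span_babyVermaGen hb _ _ _ _))
  have htrans : ∀ S : Supermodule.{u, v, max u v} L, S.IsSimple →
      S.IsSubquotient (Y.ind (babyVerma hb T.isTorus.le_even Tl.plus.even Tl.plus.odd mu)) →
      S.IsSubquotient (X.ind (Tl.babyVermaMinus hl (ψ.symm ⟨mu, hmu⟩))) := fun S hS hSQ =>
    (hψ _).isSubquotient_ind X hS (hSQ.trans hQ)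
  have hweight := fun {w : (babyVerma hb T.isTorus.le_even Tl.plus.even Tl.plus.odd mu).carrier}
    (hw0 : w ≠ 0) {i : ZMod 2} (hw : w ∈ Supermodule.part _ i) {ν : Module.Dual k h} hwν =>
    Y.isSubquotient_ind_of_weight (h := h) (μ := ν) T.plus.isNilSubalgebra le_sup_left
      T.isTorus.le_even le_sup_right T.plus.bracket_torus_mem le_rfl hw0 hw hwν
  have hgen := babyVermaGen_mem_part hb T.isTorus.le_even Tl.plus.even Tl.plus.odd mu
  obtain ⟨hmu1, S₀, hS₀, hS₀m, -⟩ := hweight hne.1 hgen (ν := mu)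
    fun z hz => ι_smul_babyVermaGen hb T.isTorus.le_even Tl.plus.even Tl.plus.odd mu hz
  refine ⟨_, hfin, hind, fun S hS hSm => htrans S hS (hmu1 S hS hSm), ⟨S₀, hS₀, hS₀m⟩, fun i => ?_⟩
  obtain ⟨y, hy, y', hy', hyα, hyα', hb'⟩ := T.exists_plus_components (hxα i)
  -- one of the components lies outside `l`, because `x i` does and `b⁻` is contained in `l`
  obtain ⟨j, w, hwj, hwl, hwα, hwb⟩ : ∃ (j : ZMod 2) (w : g), w ∈ L.part j ∧ w ∉ l ∧
      (∀ z : h, L.bracket (z : g) w = (α i : Module.Dual k h) z • w) ∧ w ∈ T.borelPlus := by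
    by_cases hyl : y ∈ l
    · by_cases hyl' : y' ∈ l
      · have h1 : x i ∈ l := by
          have h2 : x i = (x i - y - y') + y + y' := by abel
          rw [h2]
          exact add_mem (add_mem (Tl.borelMinus_le (hbor ▸ hb')) hyl) hyl'
        exact absurd (Submodule.disjoint_def.1 hC.disjoint _ h1 (hx i)) (hxi.ne_zero i)
      · exact ⟨1, y', T.plus.odd hy', hyl', hyα',
          Submodule.mem_sup_left (Submodule.mem_sup_left hy')⟩
    · exact ⟨0, y, T.plus.even hy, hyl, hyα, Submodule.mem_sup_left (Submodule.mem_sup_right hy)⟩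
  obtain ⟨-, S, hS, hSm, hSQ⟩ := hweight
    (hne.2 ⟨w, hwb⟩ fun hw => hwl (Tl.borelPlus_le hw))
    (Supermodule.smul_mem _ (L := L.sub _ hb) (x := ⟨w, hwb⟩) hwj hgen)
    (ν := mu + α i) fun z hz => ι_smul_ι_smul_babyVermaGen hb T.isTorus Tl.plus.even Tl.plus.odd mu
      (y := ⟨w, hwb⟩) hwj hwα hz
  exact ⟨S, hS, hSm, htrans S hS hSQ⟩

end Cases

end RestrictedLieSuperalgebra

theorem corollary2p4 {k : Type u} [Field k] [IsAlgClosed k] {p : ℕ} [Fact p.Prime] [CharP k p]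
    [NeZero (2 : k)] {g : Type v} [AddCommGroup g] [Module k g] [Module.Finite k g]
    (L : RestrictedLieSuperalgebra k p g) (h : Submodule k g)
    (T : L.TriangularDecomposition ⊤ h)
    (hT : T.LongHypotheses ∨ T.BabyVermaHypotheses) :
    L.OneBlock := by
  exact hT.elim (fun h => h.oneBlock T) (fun h => h.oneBlock T)
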